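/- **Setting.** Let $k$ be a field. Let $\mathcal C$ be the $k$-linear category of quadruples $(M,V_0,V_1,\varphi)$ with $M$ a finitely generated $\mathbb Z$-graded $k[x]$-module ($\deg x=1$), $V_0,V_1$ vector spaces over $k$ and $\varphi:(M_x)_0\to V_0\oplus V_1$ an isomorphism, where $(M_x)_0$ is the degree zero part of the localization of $M$ at $x$. A morphism is a triple $(f,g_0,g_1)$ with $f:M\to M'$ a $k[x]$-linear map of degree zero and $g_i:V_i\to V_i'$ linear such that $\varphi'(f_x)_0=(g_0\oplus g_1)\varphi$. Let $\mathcal F\subset\mathcal C$ be the full subcategory of objects for which $M$ is $x$-torsion free. For $m\ge 0$ let $R_m\subset k[x]\oplus k[x]$ be the graded subring generated over $k$ by $u=(x,x)$ and $v=(x^m,0)$, and let $\operatorname{gr}(R_m)$ be the category of finitely generated graded $R_m$-modules and degree zero maps. The functor $U_m:\operatorname{gr}(R_m)\to\mathcal C$ sends $M$ to $(M,(M^0_x)_0,(M^1_x)_0,\operatorname{id})$, where $x$ acts on $M$ as $u$ and $M_x=M_x^0\oplus M_x^1$ is the decomposition given by $(R_m)_x=k[x,x^{-1}]\oplus k[x,x^{-1}]$.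 For $a\in\mathbb Z$ write $M(a)_n=M_{n+a}$. For $m\ge0$ put $F_{ma}=U_m(R_m(a))$, and for $i\in\{0,1\}$ let $F^i_{0a}=U_0(S_i(a))$, where $S_i=k[x]$ is the $i$-th factor of $R_0=k[x]\oplus k[x]$. So $F_{0a}\cong F^0_{0a}\oplus F^1_{0a}$. **Proposition.** 1. For $m>0$ and $a\in\mathbb Z$, $R_m(a)$ is, up to isomorphism, the unique indecomposable projective object of $\operatorname{gr}(R_m)$ whose grading starts exactly in degree $-a$; for $m=0$, those in $\operatorname{gr}(R_0)$ are, up to isomorphism, $S_0(a)$ and $S_1(a)$. 2. An object of $\mathcal C$ is torsion free and indecomposable if and only if it is isomorphic to $F_{ma}$ for some $m>0$, $a\in\mathbb Z$, or to $F^i_{0a}$ for some $i\in\{0,1\}$, $a\in\mathbb Z$. These objects are pairwise non-isomorphic. 3. The Auslander–Reiten quiver of $\mathcal F$ (vertices: isomorphism classes of indecomposables; arrows $X\to Y$: a basis of $\operatorname{rad}(X,Y)/\operatorname{rad}^2(X,Y)$; $\tau Y$: the starting term of the almost split sequence ending in $Y$) is the translation quiver $\mathbb Z D_\infty$. Its arrows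 are the following, each with multiplicity one: $$F_{m+1,a}\to F_{m,a},\qquad F_{m,a}\to F_{m+1,a+1}\qquad(m\ge1),$$ $$F_{1,a}\to F^i_{0a},\qquad F^i_{0a}\to F_{1,a+1}\qquad(i=0,1),$$ for all $a\in\mathbb Z$, and the translation is $\tau F_{ma}=F_{m,a-1}$ for $m\geq 1$, $\tau F^i_{0a}=F^{1-i}_{0,a-1}$. 4. The almost split sequences, both in $\mathcal F$ and in $\mathcal C$, are $$0\to F_{m,a-1}\to F_{m-1,a-1}\oplus F_{m+1,a}\to F_{m,a}\to0\qquad(m\ge 1),$$ with maps $z\mapsto(z,-xz)$ and $(z,w)\mapsto xz+w$ (computed in $k[x]\oplus k[x]$, with $x=(x,x)$), and $$0\to F^{1-i}_{0,a-1}\to F_{1a}\to F^i_{0a}\to0\qquad(i=0,1),$$ where the first map sends $p$ to the element of $R_1\subset k[x]\oplus k[x]$ with $(1-i)$-th component $xp$ and $i$-th component $0$, and the second is the $i$-th projection. -/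

import Mathlib

open CategoryTheory CategoryTheory.Limits Polynomial

universe u

namespace ZDInf

noncomputable section

section Graded

variable {k : Type u} [Field k] {A : Type u} [CommRing A] [Algebra k A]

/-- A finitely generated `ℤ`-graded module over the commutative `k`-algebra `A` whose homogeneous
parts are the subspaces `𝒜 n`. -/
structure GrMod (𝒜 : ℤ → Submodule k A) where
  carrier : Type u
  [addCommGroup : AddCommGroup carrier]
  [moduleBase : Module k carrier]
  [module : Module A carrier]
  [isScalarTower : IsScalarTower k A carrier]
  /-- The homogeneous part of degree `n`. -/
  deg : ℤ → Submodule k carrier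
  isInternal : DirectSum.IsInternal deg
  smul_mem : ∀ {i j : ℤ} {a : A} {x : carrier}, a ∈ 𝒜 i → x ∈ deg j → a • x ∈ deg (i + j)
  finite : Module.Finite A carrier

namespace GrMod

variable {𝒜 : ℤ → Submodule k A}

instance : CoeSort (GrMod 𝒜) (Type u) := ⟨GrMod.carrier⟩

attribute [instance] addCommGroup moduleBase module isScalarTower finite

/-- The `A`-linear maps of degree zero. -/
def homs (M N : GrMod 𝒜) : Submodule k (M →ₗ[A] N) where
  carrier := {f | ∀ n : ℤ, ∀ x ∈ M.deg n, f x ∈ N.deg n}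
  add_mem' hf hg n x hx := add_mem (hf n x hx) (hg n x hx)
  zero_mem' n _ _ := zero_mem (N.deg n)
  smul_mem' c _ hf n x hx := (N.deg n).smul_mem c (hf n x hx)

/-- The category `gr(A)` of finitely generated graded modules. -/
instance : Category (GrMod 𝒜) where
  Hom M N := homs M N
  id M := ⟨LinearMap.id, fun _ _ hx => hx⟩
  comp f g := ⟨g.1.comp f.1, fun n x hx => g.2 n _ (f.2 n x hx)⟩

/-- The `A`-linear map underlying a morphism. -/
def toLin {M N : GrMod 𝒜} (f : M ⟶ N) : M →ₗ[A] N := Subtype.val (p := (· ∈ homs M N)) f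

theorem toLin_mem {M N : GrMod 𝒜} (f : M ⟶ N) {n : ℤ} {x : M} (hx : x ∈ M.deg n) :
    toLin f x ∈ N.deg n := Subtype.property (p := (· ∈ homs M N)) f n x hx

@[ext] theorem hom_ext {M N : GrMod 𝒜} {f g : M ⟶ N} (h : ∀ x, toLin f x = toLin g x) : f = g :=
  Subtype.ext (LinearMap.ext h)

instance : Preadditive (GrMod 𝒜) where
  homGroup M N := inferInstanceAs (AddCommGroup (homs M N))
  add_comp M N L f f' g := by
    ext x; exact map_add (toLin g) _ _
  comp_add _ _ _ _ _ _ := rfl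

instance : Linear k (GrMod 𝒜) where
  homModule M N := inferInstanceAs (Module k (homs M N))
  smul_comp M N L r f g := by
    ext x; exact (toLin g).map_smul_of_tower r _
  comp_smul _ _ _ _ _ _ := rfl

@[simp] theorem toLin_id (M : GrMod 𝒜) : toLin (𝟙 M) = LinearMap.id := rfl
@[simp] theorem toLin_comp {M N L : GrMod 𝒜} (f : M ⟶ N) (g : N ⟶ L) :
    toLin (f ≫ g) = (toLin g).comp (toLin f) := rfl
@[simp] theorem toLin_zero {M N : GrMod 𝒜} : toLin (0 : M ⟶ N) = 0 := rfl
@[simp] theorem toLin_add {M N : GrMod 𝒜} (f g : M ⟶ N) : toLin (f + g) = toLin f + toLin g := rfl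
@[simp] theorem toLin_smul {M N : GrMod 𝒜} (c : k) (f : M ⟶ N) : toLin (c • f) = c • toLin f := rfl

theorem eq_zero_of_map {M N : Type u} [AddCommGroup M] [Module k M] [AddCommGroup N] [Module k N]
    {d : ℤ → Submodule k M} {d' : ℤ → Submodule k N} (hd' : iSupIndep d') (f : M →ₗ[k] N)
    (hf : ∀ n, ∀ x ∈ d n, f x ∈ d' n) {i : ℤ} {x : M} (hx : x ∈ d i)
    (hx' : x ∈ ⨆ j, ⨆ _ : j ≠ i, d j) : f x = 0 := by
  refine Submodule.disjoint_def.1 (hd' i) _ (hf i x hx) ?_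
  have h1 : f x ∈ (⨆ j, ⨆ _ : j ≠ i, d j).map f := Submodule.mem_map_of_mem hx'
  rw [Submodule.map_iSup] at h1
  have h2 : ∀ j, (⨆ _ : j ≠ i, d j).map f ≤ ⨆ _ : j ≠ i, d' j := fun j => by
    rw [Submodule.map_iSup]
    refine iSup_mono fun hj => ?_
    rintro _ ⟨y, hy, rfl⟩
    exact hf j y hy
  exact iSup_mono h2 h1

theorem mem_iSup_of_map {M N : Type u} [AddCommGroup M] [Module k M] [AddCommGroup N] [Module k N]
    {d : ℤ → Submodule k M} {d' : ℤ → Submodule k N} (f : M →ₗ[k] N)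
    (hf : ∀ n, ∀ x ∈ d n, f x ∈ d' n) {x : M} (hx : x ∈ iSup d) : f x ∈ iSup d' := by
  have h1 : f x ∈ (iSup d).map f := Submodule.mem_map_of_mem hx
  rw [Submodule.map_iSup] at h1
  have h2 : ∀ j, (d j).map f ≤ d' j := fun j => by
    rintro _ ⟨y, hy, rfl⟩
    exact hf j y hy
  exact iSup_mono h2 h1

/-- The direct sum of two graded modules. -/
def prod (M N : GrMod 𝒜) : GrMod 𝒜 where
  carrier := M × N
  deg n := (M.deg n).prod (N.deg n)
  isInternal := by
    rw [DirectSum.isInternal_submodule_iff_iSupIndep_and_iSup_eq_top]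
    obtain ⟨hM, hM'⟩ := (DirectSum.isInternal_submodule_iff_iSupIndep_and_iSup_eq_top _).1
      M.isInternal
    obtain ⟨hN, hN'⟩ := (DirectSum.isInternal_submodule_iff_iSupIndep_and_iSup_eq_top _).1
      N.isInternal
    constructor
    · intro i
      refine Submodule.disjoint_def.2 fun x hx hx' => Prod.ext ?_ ?_
      · exact eq_zero_of_map (d := fun n => (M.deg n).prod (N.deg n)) hM (LinearMap.fst k M N)
          (fun n x hx => hx.1) hx hx'
      · exact eq_zero_of_map (d := fun n => (M.deg n).prod (N.deg n)) hN (LinearMap.snd k M N)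
          (fun n x hx => hx.2) hx hx'
    · rw [eq_top_iff]
      have h1 : ∀ a : M, (a, (0 : N)) ∈ ⨆ n, (M.deg n).prod (N.deg n) := fun a =>
        mem_iSup_of_map (d' := fun n => (M.deg n).prod (N.deg n)) (LinearMap.inl k M N)
          (fun n x hx => ⟨hx, zero_mem _⟩)
          (hM' ▸ Submodule.mem_top : a ∈ iSup M.deg)
      have h2 : ∀ b : N, ((0 : M), b) ∈ ⨆ n, (M.deg n).prod (N.deg n) := fun b =>
        mem_iSup_of_map (d' := fun n => (M.deg n).prod (N.deg n)) (LinearMap.inr k M N)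
          (fun n x hx => ⟨zero_mem _, hx⟩)
          (hN' ▸ Submodule.mem_top : b ∈ iSup N.deg)
      rintro ⟨a, b⟩ -
      have := add_mem (h1 a) (h2 b)
      simpa using this
  smul_mem ha hx := ⟨M.smul_mem ha hx.1, N.smul_mem ha hx.2⟩
  finite := inferInstance

/-- The first projection. -/
def fst (M N : GrMod 𝒜) : prod M N ⟶ M := ⟨LinearMap.fst A M N, fun _ _ hx => hx.1⟩
/-- The second projection. -/
def snd (M N : GrMod 𝒜) : prod M N ⟶ N := ⟨LinearMap.snd A M N, fun _ _ hx => hx.2⟩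
/-- The first injection. -/
def inl (M N : GrMod 𝒜) : M ⟶ prod M N := ⟨LinearMap.inl A M N, fun _ _ hx => ⟨hx, zero_mem _⟩⟩
/-- The second injection. -/
def inr (M N : GrMod 𝒜) : N ⟶ prod M N := ⟨LinearMap.inr A M N, fun _ _ hx => ⟨zero_mem _, hx⟩⟩

theorem inl_fst (M N : GrMod 𝒜) : inl M N ≫ fst M N = 𝟙 M := rfl
theorem inl_snd (M N : GrMod 𝒜) : inl M N ≫ snd M N = 0 := rfl
theorem inr_fst (M N : GrMod 𝒜) : inr M N ≫ fst M N = 0 := rfl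
theorem inr_snd (M N : GrMod 𝒜) : inr M N ≫ snd M N = 𝟙 N := rfl

theorem total (M N : GrMod 𝒜) : fst M N ≫ inl M N + snd M N ≫ inr M N = 𝟙 (prod M N) := by
  refine hom_ext fun x => ?_
  obtain ⟨a, b⟩ := x
  change (a + 0, 0 + b) = (a, b)
  simp

/-- The direct sum, with its injections and projections. -/
def bicone (M N : GrMod 𝒜) : BinaryBicone M N where
  pt := prod M N
  fst := fst M N
  snd := snd M N
  inl := inl M N
  inr := inr M N
  inl_fst := rfl
  inl_snd := rfl
  inr_fst := rfl
  inr_snd := rfl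

instance : HasBinaryBiproducts (GrMod 𝒜) where
  has_binary_biproduct M N := hasBinaryBiproduct_of_total (bicone M N) (total M N)

/-- The shift `M(a)`, with `M(a)_n = M_{n + a}`. -/
def shift (M : GrMod 𝒜) (a : ℤ) : GrMod 𝒜 where
  carrier := M
  deg n := M.deg (n + a)
  isInternal := by
    rw [DirectSum.isInternal_submodule_iff_iSupIndep_and_iSup_eq_top]
    obtain ⟨hM, hM'⟩ := (DirectSum.isInternal_submodule_iff_iSupIndep_and_iSup_eq_top _).1
      M.isInternal
    exact ⟨hM.comp (add_left_injective a), ((Equiv.addRight a).iSup_comp).trans hM'⟩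
  smul_mem ha hx := by
    rw [add_assoc]; exact M.smul_mem ha hx
  finite := M.finite

/-- The grading of `M` starts exactly in degree `d`. -/
def StartsAt (M : GrMod 𝒜) (d : ℤ) : Prop := M.deg d ≠ ⊥ ∧ ∀ n < d, M.deg n = ⊥

end GrMod

end Graded

section Poly

variable (k : Type u) [Field k]

/-- The homogeneous polynomials of degree `n`, where `deg x = 1`. -/
def polyDeg (n : ℤ) : Submodule k k[X] where
  carrier := {p | ∀ i : ℕ, p.coeff i ≠ 0 → (i : ℤ) = n}
  add_mem' {p q} hp hq i hi := by
    by_contra h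
    have h1 : p.coeff i = 0 := by by_contra h'; exact h (hp i h')
    have h2 : q.coeff i = 0 := by by_contra h'; exact h (hq i h')
    exact hi (by simp [h1, h2])
  zero_mem' i hi := by simp at hi
  smul_mem' c p hp i hi := hp i fun h => hi (by simp [h])

/-- The category `gr(k[x])`. -/
abbrev GrPoly := GrMod (polyDeg k)

variable {k}

theorem monomial_mem_polyDeg (i : ℕ) (c : k) : monomial i c ∈ polyDeg k i := by
  intro j hj
  rw [coeff_monomial] at hj
  split_ifs at hj with h
  · exact_mod_cast h.symm
  · exact absurd rfl hj

theorem X_mem_polyDeg : (X : k[X]) ∈ polyDeg k 1 := by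
  simpa [monomial_one_one_eq_X] using monomial_mem_polyDeg 1 (1 : k)

theorem X_pow_mem_polyDeg (n : ℕ) : (X ^ n : k[X]) ∈ polyDeg k n := by
  simpa [X_pow_eq_monomial] using monomial_mem_polyDeg n (1 : k)

theorem mul_mem_polyDeg {i j : ℤ} {p q : k[X]} (hp : p ∈ polyDeg k i) (hq : q ∈ polyDeg k j) :
    p * q ∈ polyDeg k (i + j) := by
  intro n hn
  rw [coeff_mul] at hn
  obtain ⟨⟨a, b⟩, hab, h⟩ := Finset.exists_ne_zero_of_sum_ne_zero hn
  have h1 := hp a (left_ne_zero_of_mul h)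
  have h2 := hq b (right_ne_zero_of_mul h)
  have := Finset.HasAntidiagonal.mem_antidiagonal.1 hab
  simp only at this
  omega

theorem polyDeg_iSupIndep : iSupIndep (polyDeg k) := by
  intro i
  refine Submodule.disjoint_def.2 fun p hp hp' => ?_
  have key : (⨆ j, ⨆ _ : j ≠ i, polyDeg k j) ≤
      (⨅ n : ℕ, ⨅ _ : (n : ℤ) = i, LinearMap.ker (lcoeff k n)) := by
    refine iSup₂_le fun j hj => le_iInf₂ fun n hn q hq => ?_
    by_contra h
    exact hj ((hq n h).symm.trans hn)
  ext n
  rw [coeff_zero]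
  by_contra h
  have := key hp'
  simp only [Submodule.mem_iInf] at this
  exact h (this n (hp n h))

theorem polyDeg_iSup : iSup (polyDeg k) = ⊤ := by
  rw [eq_top_iff]
  rintro p -
  induction p using Polynomial.induction_on' with
  | add p q hp hq => exact add_mem (hp) (hq)
  | monomial n c => exact Submodule.mem_iSup_of_mem (n : ℤ) (monomial_mem_polyDeg n c)

theorem polyDeg_isInternal : DirectSum.IsInternal (polyDeg k) :=
  (DirectSum.isInternal_submodule_iff_iSupIndep_and_iSup_eq_top _).2
    ⟨polyDeg_iSupIndep, polyDeg_iSup⟩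

variable (k) in
/-- The element `x ^ n` of the multiplicative set of powers of `x`. -/
def xPow (n : ℕ) : Submonoid.powers (X : k[X]) := ⟨X ^ n, n, rfl⟩

/-- The degree zero part `(M_x)_0` of the localization of the graded `k[x]`-module `M` at `x`:
the fractions `m / x ^ n` with `m` homogeneous of degree `n`. -/
def locZero (M : GrPoly k) : Submodule k (LocalizedModule (Submonoid.powers (X : k[X])) M) where
  carrier := {z | ∃ n : ℕ, ∃ m ∈ M.deg n, z = LocalizedModule.mk m (xPow k n)}
  add_mem' := by
    rintro _ _ ⟨n, m, hm, rfl⟩ ⟨n', m', hm', rfl⟩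
    refine ⟨n + n', (X ^ n' : k[X]) • m + (X ^ n : k[X]) • m', add_mem ?_ ?_, ?_⟩
    · have := M.smul_mem (X_pow_mem_polyDeg n') hm
      rwa [add_comm, ← Nat.cast_add] at this
    · have := M.smul_mem (X_pow_mem_polyDeg n) hm'
      rwa [← Nat.cast_add] at this
    · rw [LocalizedModule.mk_add_mk]
      congr 1
      exact Subtype.ext (pow_add _ _ _).symm
  zero_mem' := ⟨0, 0, zero_mem _, (LocalizedModule.zero_mk _).symm⟩
  smul_mem' := by
    rintro c _ ⟨n, m, hm, rfl⟩
    exact ⟨n, c • m, (M.deg n).smul_mem c hm, LocalizedModule.smul'_mk c m _⟩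

/-- The map `(M_x)_0 → (N_x)_0` induced by `f : M ⟶ N`. -/
def locMap {M N : GrPoly k} (f : M ⟶ N) : locZero M →ₗ[k] locZero N :=
  LinearMap.restrict
    ((LocalizedModule.map (Submonoid.powers (X : k[X])) (GrMod.toLin f)).restrictScalars k
      : LocalizedModule (Submonoid.powers (X : k[X])) M →ₗ[k]
        LocalizedModule (Submonoid.powers (X : k[X])) N) <| by
    rintro _ ⟨n, m, hm, rfl⟩
    exact ⟨n, GrMod.toLin f m, GrMod.toLin_mem f hm, LocalizedModule.map_mk _ _ _ _⟩

/-- The element `m / x ^ n` of `(M_x)_0`, for `m` homogeneous of degree `n`. -/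
def locMk {M : GrPoly k} (n : ℕ) (m : M) (hm : m ∈ M.deg n) : locZero M :=
  ⟨LocalizedModule.mk m (xPow k n), n, m, hm, rfl⟩

theorem locMap_mk {M N : GrPoly k} (f : M ⟶ N) (n : ℕ) (m : M) (hm : m ∈ M.deg n) :
    locMap f (locMk n m hm) = locMk n (GrMod.toLin f m) (GrMod.toLin_mem f hm) :=
  Subtype.ext (LocalizedModule.map_mk _ _ _ _)

theorem locZero_ind {M : GrPoly k} {p : locZero M → Prop}
    (h : ∀ (n : ℕ) (m : M) (hm : m ∈ M.deg n), p (locMk n m hm)) (z) : p z := by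
  obtain ⟨_, n, m, hm, rfl⟩ := z
  exact h n m hm

@[simp] theorem locMap_id (M : GrPoly k) : locMap (𝟙 M) = LinearMap.id :=
  LinearMap.ext (locZero_ind fun _ _ _ => locMap_mk _ _ _ _)

@[simp] theorem locMap_comp {M N L : GrPoly k} (f : M ⟶ N) (g : N ⟶ L) :
    locMap (f ≫ g) = (locMap g).comp (locMap f) := by
  refine LinearMap.ext (locZero_ind fun n m hm => ?_)
  rw [LinearMap.comp_apply, locMap_mk, locMap_mk, locMap_mk]
  rfl

theorem locMap_locMap {M N L : GrPoly k} (f : M ⟶ N) (g : N ⟶ L) (z : locZero M) :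
    locMap g (locMap f z) = locMap (f ≫ g) z := by
  rw [locMap_comp]; rfl

@[simp] theorem locMap_add {M N : GrPoly k} (f g : M ⟶ N) :
    locMap (f + g) = locMap f + locMap g := by
  ext z
  change LocalizedModule.map _ (GrMod.toLin f + GrMod.toLin g) z.1 = _
  rw [map_add]; rfl

@[simp] theorem locMap_smul {M N : GrPoly k} (c : k) (f : M ⟶ N) :
    locMap (c • f) = c • locMap f := by
  refine LinearMap.ext (locZero_ind fun n m hm => ?_)
  rw [LinearMap.smul_apply, locMap_mk, locMap_mk]
  exact Subtype.ext (LocalizedModule.smul'_mk c (GrMod.toLin f m) _).symm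

@[simp] theorem locMap_zero {M N : GrPoly k} : locMap (0 : M ⟶ N) = 0 := by
  have := locMap_smul (0 : k) (0 : M ⟶ N)
  rwa [zero_smul, zero_smul] at this

variable (k) in
/-- The category `𝒞`: its objects are the quadruples `(M, V₀, V₁, φ)` with `M` a finitely generated
graded `k[x]`-module, `V₀` and `V₁` vector spaces and `φ` an isomorphism `(M_x)_0 ≅ V₀ ⊕ V₁`
(equivalently, an isomorphism of graded modules `M_x ≅ (V₀ ⊕ V₁) ⊗ k[x, x⁻¹]`). -/
structure Obj where
  M : GrPoly k
  V₀ : Type u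
  V₁ : Type u
  [addCommGroup₀ : AddCommGroup V₀]
  [module₀ : Module k V₀]
  [addCommGroup₁ : AddCommGroup V₁]
  [module₁ : Module k V₁]
  φ : locZero M ≃ₗ[k] V₀ × V₁

namespace Obj

attribute [instance] addCommGroup₀ module₀ addCommGroup₁ module₁

/-- The triples `(f, g₀, g₁)` of a morphism `f : M → M'` in `gr(k[x])` and linear maps
`gᵢ : Vᵢ → Vᵢ'` such that `(f_x)_0` corresponds to `g₀ ⊕ g₁` under `φ` and `φ'`. -/
def homs (P Q : Obj k) : Submodule k ((P.M ⟶ Q.M) × (P.V₀ →ₗ[k] Q.V₀) × (P.V₁ →ₗ[k] Q.V₁)) where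
  carrier := {f | ∀ z, Q.φ (locMap f.1 z) = (f.2.1 (P.φ z).1, f.2.2 (P.φ z).2)}
  add_mem' {f g} hf hg z := by
    simp [hf z, hg z]
  zero_mem' z := by
    simp only [Prod.fst_zero, Prod.snd_zero, locMap_zero, LinearMap.zero_apply, map_zero]
    rfl
  smul_mem' c f hf z := by
    simp [hf z]

instance : Category (Obj k) where
  Hom P Q := homs P Q
  id P := ⟨(𝟙 P.M, LinearMap.id, LinearMap.id), fun z => by simp⟩
  comp f g := ⟨(f.1.1 ≫ g.1.1, g.1.2.1.comp f.1.2.1, g.1.2.2.comp f.1.2.2), fun z => by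
    simp [g.2 (locMap f.1.1 z), f.2 z]⟩

/-- The restriction functor `𝒞 ⥤ gr(k[x])` on morphisms. -/
def res {P Q : Obj k} (f : P ⟶ Q) : P.M ⟶ Q.M := (Subtype.val (p := (· ∈ homs P Q)) f).1

/-- The component `V₀ → V₀'` of a morphism. -/
def hom₀ {P Q : Obj k} (f : P ⟶ Q) : P.V₀ →ₗ[k] Q.V₀ := (Subtype.val (p := (· ∈ homs P Q)) f).2.1

/-- The component `V₁ → V₁'` of a morphism. -/
def hom₁ {P Q : Obj k} (f : P ⟶ Q) : P.V₁ →ₗ[k] Q.V₁ := (Subtype.val (p := (· ∈ homs P Q)) f).2.2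

theorem hom_comm {P Q : Obj k} (f : P ⟶ Q) (z : locZero P.M) :
    Q.φ (locMap (res f) z) = (hom₀ f (P.φ z).1, hom₁ f (P.φ z).2) :=
  Subtype.property (p := (· ∈ homs P Q)) f z

theorem hom_ext' {P Q : Obj k} {f g : P ⟶ Q} (h : res f = res g) (h₀ : hom₀ f = hom₀ g)
    (h₁ : hom₁ f = hom₁ g) : f = g :=
  Subtype.ext (Prod.ext h (Prod.ext h₀ h₁))

instance : Preadditive (Obj k) where
  homGroup P Q := inferInstanceAs (AddCommGroup (homs P Q))
  add_comp _ _ _ f f' g := hom_ext' (Preadditive.add_comp _ _ _ (res f) (res f') (res g))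
    (LinearMap.ext fun _ => map_add (hom₀ g) _ _) (LinearMap.ext fun _ => map_add (hom₁ g) _ _)
  comp_add _ _ _ f g g' := hom_ext' (Preadditive.comp_add _ _ _ (res f) (res g) (res g')) rfl rfl

instance : Linear k (Obj k) where
  homModule P Q := inferInstanceAs (Module k (homs P Q))
  smul_comp _ _ _ r f g := hom_ext' (Linear.smul_comp _ _ _ r (res f) (res g))
    (LinearMap.ext fun _ => map_smul (hom₀ g) _ _) (LinearMap.ext fun _ => map_smul (hom₁ g) _ _)
  comp_smul _ _ _ f r g := hom_ext' (Linear.comp_smul _ _ _ (res f) r (res g)) rfl rfl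

/-- The isomorphism `((M ⊕ N)_x)_0 ≅ (M_x)_0 ⊕ (N_x)_0`. -/
def locProd (M N : GrPoly k) : locZero (M.prod N) ≃ₗ[k] locZero M × locZero N :=
  LinearEquiv.ofLinearMap
    ((locMap (M.fst N)).prod (locMap (M.snd N)))
    ((locMap (M.inl N)).coprod (locMap (M.inr N)))
    (by
      refine LinearMap.ext fun z => Prod.ext ?_ ?_
      · change locMap (M.fst N) (locMap (M.inl N) z.1 + locMap (M.inr N) z.2) = z.1
        rw [map_add, locMap_locMap, locMap_locMap, GrMod.inl_fst, GrMod.inr_fst]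
        simp
      · change locMap (M.snd N) (locMap (M.inl N) z.1 + locMap (M.inr N) z.2) = z.2
        rw [map_add, locMap_locMap, locMap_locMap, GrMod.inl_snd, GrMod.inr_snd]
        simp)
    (by
      rw [LinearMap.coprod_comp_prod, ← locMap_comp, ← locMap_comp, ← locMap_add, GrMod.total,
        locMap_id])

/-- The direct sum of two objects. -/
def prod (P Q : Obj k) : Obj k where
  M := P.M.prod Q.M
  V₀ := P.V₀ × Q.V₀
  V₁ := P.V₁ × Q.V₁
  φ := (locProd P.M Q.M).trans
    ((P.φ.prodCongr Q.φ).trans (LinearEquiv.prodProdProdComm k P.V₀ P.V₁ Q.V₀ Q.V₁))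

/-- The direct sum, with its injections and projections. -/
def bicone (P Q : Obj k) : BinaryBicone P Q where
  pt := prod P Q
  fst := ⟨(P.M.fst Q.M, LinearMap.fst k _ _, LinearMap.fst k _ _), fun _ => rfl⟩
  snd := ⟨(P.M.snd Q.M, LinearMap.snd k _ _, LinearMap.snd k _ _), fun _ => rfl⟩
  inl := ⟨(P.M.inl Q.M, LinearMap.inl k _ _, LinearMap.inl k _ _), fun z => by
    have h : locProd P.M Q.M (locMap (P.M.inl Q.M) z) = (z, 0) := by
      rw [← LinearEquiv.eq_symm_apply]
      change _ = locMap _ z + locMap _ 0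
      rw [map_zero, add_zero]
    change LinearEquiv.prodProdProdComm k P.V₀ P.V₁ Q.V₀ Q.V₁
      (P.φ.prodCongr Q.φ (locProd P.M Q.M (locMap (P.M.inl Q.M) z))) = _
    rw [h]
    exact Prod.ext (Prod.ext rfl (congrArg (Prod.fst : Q.V₀ × Q.V₁ → _) (map_zero Q.φ)))
      (Prod.ext rfl (congrArg (Prod.snd : Q.V₀ × Q.V₁ → _) (map_zero Q.φ)))⟩
  inr := ⟨(P.M.inr Q.M, LinearMap.inr k _ _, LinearMap.inr k _ _), fun z => by
    have h : locProd P.M Q.M (locMap (P.M.inr Q.M) z) = (0, z) := by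
      rw [← LinearEquiv.eq_symm_apply]
      change _ = locMap _ 0 + locMap _ z
      rw [map_zero, zero_add]
    change LinearEquiv.prodProdProdComm k P.V₀ P.V₁ Q.V₀ Q.V₁
      (P.φ.prodCongr Q.φ (locProd P.M Q.M (locMap (P.M.inr Q.M) z))) = _
    rw [h]
    exact Prod.ext (Prod.ext (congrArg (Prod.fst : P.V₀ × P.V₁ → _) (map_zero P.φ)) rfl)
      (Prod.ext (congrArg (Prod.snd : P.V₀ × P.V₁ → _) (map_zero P.φ)) rfl)⟩
  inl_fst := rfl
  inl_snd := rfl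
  inr_fst := rfl
  inr_snd := rfl

theorem bicone_total (P Q : Obj k) :
    (bicone P Q).fst ≫ (bicone P Q).inl + (bicone P Q).snd ≫ (bicone P Q).inr =
      𝟙 (bicone P Q).pt := by
  refine hom_ext' (GrMod.total P.M Q.M) ?_ ?_
  · refine LinearMap.ext fun x => ?_
    obtain ⟨a, b⟩ := x
    change (a + 0, 0 + b) = (a, b)
    simp
  · refine LinearMap.ext fun x => ?_
    obtain ⟨a, b⟩ := x
    change (a + 0, 0 + b) = (a, b)
    simp

instance : HasBinaryBiproducts (Obj k) where
  has_binary_biproduct P Q := hasBinaryBiproduct_of_total (bicone P Q) (bicone_total P Q)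

end Obj

variable (k) in
/-- The objects of `𝒞` whose underlying `k[x]`-module is `x`-torsion free. -/
def torsionFree : ObjectProperty (Obj k) := fun P =>
  ∀ m : P.M, (X : k[X]) • m = 0 → m = 0

variable (k) in
/-- The full subcategory `ℱ` of `𝒞` of torsion free objects. -/
abbrev TF := (torsionFree k).FullSubcategory

namespace TF

/-- The direct sum in `ℱ`, with its injections and projections. -/
def bicone (P Q : TF k) : BinaryBicone P Q where
  pt := ⟨P.obj.prod Q.obj, fun _ hm => Prod.ext (P.property _ (congrArg Prod.fst hm))
    (Q.property _ (congrArg Prod.snd hm))⟩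
  fst := ObjectProperty.homMk (Obj.bicone P.obj Q.obj).fst
  snd := ObjectProperty.homMk (Obj.bicone P.obj Q.obj).snd
  inl := ObjectProperty.homMk (Obj.bicone P.obj Q.obj).inl
  inr := ObjectProperty.homMk (Obj.bicone P.obj Q.obj).inr
  inl_fst := rfl
  inl_snd := rfl
  inr_fst := rfl
  inr_snd := rfl

instance : HasBinaryBiproducts (TF k) where
  has_binary_biproduct P Q := hasBinaryBiproduct_of_total (bicone P Q)
    (ObjectProperty.hom_ext _ (Obj.bicone_total P.obj Q.obj))

end TF

end Poly

section Singularity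

variable (k : Type u) [Field k]

/-- The graded ring `R_m`: the subring of `k[x] ⊕ k[x]` generated over `k` by `u = (x, x)` and
`v = (x ^ m, 0)`. -/
def R (m : ℕ) : Subalgebra k (k[X] × k[X]) := Algebra.adjoin k {(X, X), (X ^ m, 0)}

/-- The homogeneous part of `R_m` of degree `n`, where `deg x = 1`. -/
def RDeg (m : ℕ) (n : ℤ) : Submodule k (R k m) :=
  ((polyDeg k n).prod (polyDeg k n)).comap (R k m).val.toLinearMap

/-- The category `gr(R_m)`. -/
abbrev GrR (m : ℕ) := GrMod (RDeg k m)

/-- The generator `u = (x, x)` of `R_m`. -/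
def uGen (m : ℕ) : R k m := ⟨(X, X), Algebra.subset_adjoin (Set.mem_insert _ _)⟩

/-- The generator `v = (x ^ m, 0)` of `R_m`. -/
def vGen (m : ℕ) : R k m := ⟨(X ^ m, 0), Algebra.subset_adjoin (Set.mem_insert_of_mem _ rfl)⟩

/-- The diagonal embedding `k[x] → R_m`, with `x ↦ u`. -/
def diag (m : ℕ) : k[X] →ₐ[k] R k m := aeval (uGen k m)

variable {k}

theorem coe_diag (m : ℕ) (p : k[X]) : (diag k m p : k[X] × k[X]) = (p, p) := by
  have h1 : ((AlgHom.fst k k[X] k[X]).comp ((R k m).val.comp (diag k m))) = AlgHom.id k k[X] := by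
    ext; simp [diag, uGen]
  have h2 : ((AlgHom.snd k k[X] k[X]).comp ((R k m).val.comp (diag k m))) = AlgHom.id k k[X] := by
    ext; simp [diag, uGen]
  exact Prod.ext (DFunLike.congr_fun h1 p) (DFunLike.congr_fun h2 p)

theorem mem_R_iff (m : ℕ) (z : k[X] × k[X]) : z ∈ R k m ↔ X ^ m ∣ z.1 - z.2 := by
  constructor
  · intro hz
    induction hz using Algebra.adjoin_induction with
    | mem x hx =>
      rcases hx with rfl | hx
      · simp
      · rw [Set.mem_singleton_iff.1 hx]; simp
    | algebraMap r => simp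
    | add x y _ _ hx hy =>
      have := dvd_add hx hy
      rwa [show x.1 - x.2 + (y.1 - y.2) = (x + y).1 - (x + y).2 by simp; ring] at this
    | mul x y _ _ hx hy =>
      have := dvd_add (hx.mul_right y.1) (hy.mul_left x.2)
      rwa [show (x.1 - x.2) * y.1 + x.2 * (y.1 - y.2) = (x * y).1 - (x * y).2 by
        simp only [Prod.fst_mul, Prod.snd_mul]; ring] at this
  · rintro ⟨h, hh⟩
    have : z = ((diag k m z.2 + diag k m h * vGen k m : R k m) : k[X] × k[X]) := by
      push_cast
      rw [coe_diag, coe_diag]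
      refine Prod.ext ?_ ?_
      · simp only [vGen, Prod.fst_add, Prod.fst_mul]
        rw [mul_comm h, ← hh]; ring
      · simp [vGen]
    rw [this]
    exact Subtype.property _

theorem R_eq (m : ℕ) (z : R k m) : ∃ p q : k[X], z = diag k m p + diag k m q * vGen k m := by
  obtain ⟨h, hh⟩ := (mem_R_iff m z.1).1 z.2
  refine ⟨z.1.2, h, Subtype.ext ?_⟩
  push_cast
  rw [coe_diag, coe_diag]
  refine Prod.ext ?_ ?_
  · simp only [vGen, Prod.fst_add, Prod.fst_mul]
    rw [mul_comm h, ← hh]; ring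
  · simp [vGen]

theorem RDeg_isInternal (m : ℕ) : DirectSum.IsInternal (RDeg k m) := by
  rw [DirectSum.isInternal_submodule_iff_iSupIndep_and_iSup_eq_top]
  constructor
  · intro i
    refine Submodule.disjoint_def.2 fun z hz hz' => Subtype.ext (Prod.ext ?_ ?_)
    · exact GrMod.eq_zero_of_map (d := RDeg k m) polyDeg_iSupIndep
        ((LinearMap.fst k k[X] k[X]).comp (R k m).val.toLinearMap) (fun n x hx => hx.1) hz hz'
    · exact GrMod.eq_zero_of_map (d := RDeg k m) polyDeg_iSupIndep
        ((LinearMap.snd k k[X] k[X]).comp (R k m).val.toLinearMap) (fun n x hx => hx.2) hz hz'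
  · rw [eq_top_iff]
    rintro z -
    obtain ⟨p, q, rfl⟩ := R_eq m z
    have hp : p ∈ iSup (polyDeg k) := polyDeg_iSup (k := k) ▸ Submodule.mem_top
    have hq : q ∈ iSup (polyDeg k) := polyDeg_iSup (k := k) ▸ Submodule.mem_top
    refine add_mem ?_ ?_
    · refine GrMod.mem_iSup_of_map (d' := RDeg k m) (diag k m).toLinearMap (fun n x hx => ?_) hp
      change (diag k m x : k[X] × k[X]) ∈ (polyDeg k n).prod (polyDeg k n)
      rw [coe_diag]
      exact ⟨hx, hx⟩
    · have := GrMod.mem_iSup_of_map (d' := fun n => RDeg k m (n + m))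
        ((LinearMap.mulRight k (vGen k m)).comp (diag k m).toLinearMap) (fun n x hx => ?_) hq
      · exact (Equiv.addRight (m : ℤ)).iSup_comp (g := RDeg k m) ▸ this
      · change ((diag k m x * vGen k m : R k m) : k[X] × k[X]) ∈
          (polyDeg k (n + m)).prod (polyDeg k (n + m))
        push_cast
        rw [coe_diag]
        exact ⟨mul_mem_polyDeg hx (X_pow_mem_polyDeg m), by simp [vGen]⟩

theorem mul_mem_RDeg {m : ℕ} {i j : ℤ} {a b : R k m} (ha : a ∈ RDeg k m i) (hb : b ∈ RDeg k m j) :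
    a * b ∈ RDeg k m (i + j) :=
  ⟨mul_mem_polyDeg ha.1 hb.1, mul_mem_polyDeg ha.2 hb.2⟩

theorem diag_mem_RDeg {m : ℕ} {i : ℤ} {p : k[X]} (hp : p ∈ polyDeg k i) :
    diag k m p ∈ RDeg k m i := by
  change (diag k m p : k[X] × k[X]) ∈ (polyDeg k i).prod (polyDeg k i)
  rw [coe_diag]
  exact ⟨hp, hp⟩

theorem vGen_mem_RDeg (m : ℕ) : vGen k m ∈ RDeg k m m :=
  ⟨X_pow_mem_polyDeg m, zero_mem _⟩

theorem vGen_sq (m : ℕ) : vGen k m * vGen k m = diag k m (X ^ m) * vGen k m := by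
  refine Subtype.ext ?_
  push_cast
  rw [coe_diag]
  exact Prod.ext rfl (by simp [vGen])

theorem diag_finite (m : ℕ) : (diag k m).toRingHom.Finite := by
  let := (diag k m).toRingHom.toAlgebra
  change Module.Finite k[X] (R k m)
  refine Module.finite_def.2 (Submodule.fg_def.2 ⟨{1, vGen k m}, Set.toFinite _, ?_⟩)
  rw [eq_top_iff]
  rintro z -
  obtain ⟨p, q, rfl⟩ := R_eq m z
  refine add_mem ?_ ?_
  · have h : diag k m p = p • (1 : R k m) := (Algebra.smul_def p (1 : R k m)).symm ▸ (mul_one _).symm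
    rw [h]
    exact Submodule.smul_mem _ _ (Submodule.subset_span (by simp))
  · have h : diag k m q * vGen k m = q • vGen k m := (Algebra.smul_def q (vGen k m)).symm
    rw [h]
    exact Submodule.smul_mem _ _ (Submodule.subset_span (by simp))

/-- The restriction of a graded `R_m`-module to `k[x]`, along the diagonal embedding. -/
def restrict {m : ℕ} (P : GrR k m) : GrPoly k where
  carrier := P.carrier
  module := Module.compHom P.carrier (diag k m).toRingHom
  isScalarTower := by
    let := Module.compHom P.carrier (diag k m).toRingHom
    refine ⟨fun c p x => ?_⟩
    change diag k m (c • p) • x = c • diag k m p • x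
    rw [map_smul, smul_assoc]
  deg := P.deg
  isInternal := P.isInternal
  smul_mem ha hx := P.smul_mem (diag_mem_RDeg ha) hx
  finite := by
    let := (diag k m).toRingHom.toAlgebra
    let := Module.compHom P.carrier (diag k m).toRingHom
    have : IsScalarTower k[X] (R k m) P.carrier := ⟨fun p r x => by
      rw [Algebra.smul_def, mul_smul]; rfl⟩
    have : Module.Finite k[X] (R k m) := diag_finite m
    exact Module.Finite.trans (R k m) P.carrier

theorem restrict_smul {m : ℕ} (P : GrR k m) (p : k[X]) (x : P) :
    (HSMul.hSMul p (show restrict P from x) : restrict P) = diag k m p • x := rfl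

/-- Restriction to `k[x]` on morphisms. -/
def restrictMap {m : ℕ} {P Q : GrR k m} (f : P ⟶ Q) : restrict P ⟶ restrict Q :=
  ⟨{ toFun := GrMod.toLin f
     map_add' := map_add _
     map_smul' := fun p x => (GrMod.toLin f).map_smul (diag k m p) x },
    fun _ _ hx => GrMod.toLin_mem f hx⟩

/-- Multiplication by `v` on a graded `R_m`-module, as a `k[x]`-linear map. -/
def vMul {m : ℕ} (P : GrR k m) : restrict P →ₗ[k[X]] restrict P where
  toFun (x : P) := (vGen k m • x : P)
  map_add' (x y : P) := smul_add (vGen k m) x y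
  map_smul' p (x : P) := smul_comm (vGen k m) (diag k m p) x

/-- The action on `(P_x)_0` of the idempotent `(1, 0) = v / x ^ m` of
`(R_m)_x = k[x, x⁻¹] ⊕ k[x, x⁻¹]`. -/
def idem {m : ℕ} (P : GrR k m) : locZero (restrict P) →ₗ[k] locZero (restrict P) :=
  LinearMap.restrict
    ((((LocalizedModule.divBy (xPow k m)).comp
      ((LocalizedModule.map (Submonoid.powers (X : k[X])) (vMul P)).restrictScalars k[X]))
      ).restrictScalars k :
      LocalizedModule (Submonoid.powers (X : k[X])) (restrict P) →ₗ[k]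
        LocalizedModule (Submonoid.powers (X : k[X])) (restrict P)) <| by
    rintro _ ⟨n, p, hp, rfl⟩
    refine ⟨m + n, vMul P p, ?_, ?_⟩
    · rw [Nat.cast_add]
      exact P.smul_mem (vGen_mem_RDeg m) hp
    · change LocalizedModule.divBy (xPow k m) (LocalizedModule.map _ (vMul P) _) = _
      rw [LocalizedModule.map_mk]
      exact congrArg (LocalizedModule.mk _) (Subtype.ext ((pow_add X m n).trans (mul_comm _ _)).symm)

theorem idem_mk {m : ℕ} (P : GrR k m) (n : ℕ) (p : restrict P) (hp : p ∈ (restrict P).deg n) :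
    (idem P (locMk n p hp)).1 = LocalizedModule.mk (vMul P p) (xPow k n * xPow k m) :=
  congrArg (LocalizedModule.divBy (xPow k m)) (LocalizedModule.map_mk _ (vMul P) p _)

theorem idem_idem {m : ℕ} (P : GrR k m) (z : locZero (restrict P)) :
    idem P (idem P z) = idem P z := by
  induction z using locZero_ind with | h n p hp => ?_
  refine Subtype.ext ?_
  have h : (idem P (idem P (locMk n p hp))).1 =
      LocalizedModule.mk (vMul P (vMul P p)) (xPow k n * xPow k m * xPow k m) :=
    (congrArg (fun y => LocalizedModule.divBy (xPow k m) (LocalizedModule.map _ (vMul P) y))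
      (idem_mk P n p hp)).trans
    (congrArg (LocalizedModule.divBy (xPow k m)) (LocalizedModule.map_mk _ (vMul P) _ _))
  rw [h, idem_mk]
  have h2 : vMul P (vMul P p) = (xPow k m) • vMul P p := by
    change vGen k m • vGen k m • (show P from p) = diag k m (X ^ m) • vGen k m • (show P from p)
    rw [smul_smul, smul_smul, vGen_sq]
  rw [h2, LocalizedModule.mk_cancel_common_right]

theorem idem_locMap {m : ℕ} {P Q : GrR k m} (f : P ⟶ Q) (z : locZero (restrict P)) :
    idem Q (locMap (restrictMap f) z) = locMap (restrictMap f) (idem P z) := by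
  induction z using locZero_ind with | h n p hp => ?_
  refine Subtype.ext ?_
  rw [locMap_mk, idem_mk]
  have h : (locMap (restrictMap f) (idem P (locMk n p hp))).1 =
      LocalizedModule.mk (GrMod.toLin (restrictMap f) (vMul P p)) (xPow k n * xPow k m) :=
    (congrArg (LocalizedModule.map _ (GrMod.toLin (restrictMap f))) (idem_mk P n p hp)).trans
      (LocalizedModule.map_mk _ _ _ _)
  rw [h]
  exact congrArg (fun y => LocalizedModule.mk y _)
    ((GrMod.toLin f).map_smul (vGen k m) (show P from p)).symm

/-- The object `U_m(P) = (P, (P_x^0)_0, (P_x^1)_0, id)`, where `P_x = P_x^0 ⊕ P_x^1` is the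
decomposition given by the idempotents `(1, 0)` and `(0, 1) = 1 - (1, 0)` of `(R_m)_x`. -/
def UObj {m : ℕ} (P : GrR k m) : Obj k where
  M := restrict P
  V₀ := LinearMap.range (idem P)
  V₁ := LinearMap.range (LinearMap.id - idem P)
  φ := LinearEquiv.ofLinearMap
    ((idem P).rangeRestrict.prod (LinearMap.id - idem P).rangeRestrict)
    ((LinearMap.range (idem P)).subtype.coprod (LinearMap.range (LinearMap.id - idem P)).subtype)
    (by
      refine LinearMap.ext fun z => ?_
      obtain ⟨⟨_, a, rfl⟩, ⟨_, b, rfl⟩⟩ := z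
      refine Prod.ext (Subtype.ext ?_) (Subtype.ext ?_)
      · change idem P (idem P a + (b - idem P b)) = idem P a
        simp [idem_idem]
      · change idem P a + (b - idem P b) - idem P (idem P a + (b - idem P b)) = b - idem P b
        simp [idem_idem])
    (by
      refine LinearMap.ext fun z => ?_
      change idem P z + (z - idem P z) = z
      abel)

variable (k) in
/-- The functor `U_m : gr(R_m) ⥤ 𝒞`. -/
def U (m : ℕ) : GrR k m ⥤ Obj k where
  obj P := UObj P
  map {P Q} f := ⟨(restrictMap f,
      (locMap (restrictMap f)).restrict (p := LinearMap.range (idem P))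
        (q := LinearMap.range (idem Q)) (by
          rintro _ ⟨z, rfl⟩
          exact ⟨_, idem_locMap f z⟩),
      (locMap (restrictMap f)).restrict (p := LinearMap.range (LinearMap.id - idem P))
        (q := LinearMap.range (LinearMap.id - idem Q)) (by
          rintro _ ⟨z, rfl⟩
          refine ⟨locMap (restrictMap f) z, ?_⟩
          change _ - _ = locMap (restrictMap f) (z - idem P z)
          rw [idem_locMap, map_sub]
          rfl)), fun z => by
      refine Prod.ext (Subtype.ext (idem_locMap f z)) (Subtype.ext ?_)
      have h := map_sub (locMap (restrictMap f)) z (idem P z)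
      exact (h.trans (congrArg (_ - ·) (idem_locMap f z).symm)).symm⟩
  map_id P := by
    have h := locMap_id (restrict P)
    exact Obj.hom_ext' rfl (LinearMap.ext fun z => Subtype.ext (LinearMap.congr_fun h z.1))
      (LinearMap.ext fun z => Subtype.ext (LinearMap.congr_fun h z.1))
  map_comp {P Q S} f g := by
    have h := locMap_comp (restrictMap f) (restrictMap g)
    exact Obj.hom_ext' rfl (LinearMap.ext fun z => Subtype.ext (LinearMap.congr_fun h z.1))
      (LinearMap.ext fun z => Subtype.ext (LinearMap.congr_fun h z.1))

variable (k) in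
/-- `R_m` as a graded module over itself. -/
def regular (m : ℕ) : GrR k m where
  carrier := R k m
  deg := RDeg k m
  isInternal := RDeg_isInternal m
  smul_mem ha hx := mul_mem_RDeg ha hx
  finite := inferInstance

variable (k) in
/-- The `i`-th projection `k[x] ⊕ k[x] → k[x]`, for `i = 0, 1`. -/
def proj (i : ZMod 2) : (k[X] × k[X]) →ₐ[k] k[X] :=
  if i = 0 then AlgHom.fst k k[X] k[X] else AlgHom.snd k k[X] k[X]

theorem proj_mem {i : ZMod 2} {n : ℤ} {z : k[X] × k[X]}
    (hz : z ∈ (polyDeg k n).prod (polyDeg k n)) : proj k i z ∈ polyDeg k n := by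
  unfold proj
  split_ifs
  exacts [hz.1, hz.2]

theorem proj_diag (i : ZMod 2) (p : k[X]) : proj k i (diag k 0 p : k[X] × k[X]) = p := by
  rw [coe_diag]
  unfold proj
  split_ifs <;> rfl

variable (k) in
/-- The `i`-th factor `k[x]` of `R_0 = k[x] ⊕ k[x]`, as a graded `R_0`-module. -/
def factor (i : ZMod 2) : GrR k 0 where
  carrier := k[X]
  module := Module.compHom k[X] ((proj k i).comp (R k 0).val).toRingHom
  isScalarTower := by
    let := Module.compHom k[X] ((proj k i).comp (R k 0).val).toRingHom
    refine ⟨fun c r p => ?_⟩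
    change proj k i (R k 0 |>.val (c • r)) * p = c • (proj k i (R k 0 |>.val r) * p)
    rw [map_smul, map_smul, smul_mul_assoc]
  deg := polyDeg k
  isInternal := polyDeg_isInternal
  smul_mem ha hx := mul_mem_polyDeg (proj_mem ha) hx
  finite := by
    let := Module.compHom k[X] ((proj k i).comp (R k 0).val).toRingHom
    refine Module.finite_def.2 (Submodule.fg_def.2 ⟨{1}, Set.toFinite _, ?_⟩)
    rw [eq_top_iff]
    rintro p -
    have h : p = (diag k 0 p) • (1 : k[X]) := by
      change p = proj k i (diag k 0 p : k[X] × k[X]) * 1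
      rw [proj_diag, mul_one]
    rw [h]
    exact Submodule.smul_mem _ _ (Submodule.subset_span rfl)

variable (k) in
/-- The torsion free object `F_{ma} = U_m(R_m(a))`. -/
def F (m : ℕ) (a : ℤ) : TF k where
  obj := (U k m).obj ((regular k m).shift a)
  property z hz := by
    have h : diag k m X * (show R k m from z) = 0 := hz
    have h1 := congrArg Subtype.val h
    rw [MulMemClass.coe_mul, coe_diag] at h1
    have h2 : X * (show R k m from z).1.1 = 0 := congrArg Prod.fst h1
    have h3 : X * (show R k m from z).1.2 = 0 := congrArg Prod.snd h1
    exact Subtype.ext (Prod.ext ((mul_eq_zero.1 h2).resolve_left X_ne_zero)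
      ((mul_eq_zero.1 h3).resolve_left X_ne_zero))

variable (k) in
/-- The torsion free object `F^i_{0a}`, the image under `U_0` of the `i`-th factor of `R_0` shifted
by `a`. -/
def F₀ (i : ZMod 2) (a : ℤ) : TF k where
  obj := (U k 0).obj ((factor k i).shift a)
  property z hz := by
    have h : proj k i (diag k 0 X : k[X] × k[X]) * (show k[X] from z) = 0 := hz
    rw [proj_diag] at h
    exact (mul_eq_zero.1 h).resolve_left X_ne_zero

/-- The `k[x]`-linear map underlying a morphism of `ℱ`. -/
def TF.lin {P Q : TF k} (f : P ⟶ Q) : P.obj.M →ₗ[k[X]] Q.obj.M := GrMod.toLin (Obj.res f.hom)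

/-- An element of `F_{ma}`, seen as an element of `R_m ⊆ k[x] ⊕ k[x]`. -/
def toPair {m : ℕ} {a : ℤ} (z : (F k m a).obj.M) : k[X] × k[X] := (show R k m from z).1

/-- An element of `F^i_{0a}`, seen as an element of `k[x]`. -/
def toPoly {i : ZMod 2} {a : ℤ} (z : (F₀ k i a).obj.M) : k[X] := z

end Singularity

section AuslanderReiten

variable {𝒜 : Type*} [Category 𝒜] [Preadditive 𝒜]

/-- `0 ⟶ A ⟶ B ⟶ C ⟶ 0` is an almost split sequence: a short exact sequence (`f` is a kernel of
`g` and `g` is a cokernel of `f`) which does not split, such that every map to `C` which is not a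
split epimorphism factors through `g` and every map from `A` which is not a split monomorphism
factors through `f`. -/
structure IsAlmostSplit {A B C : 𝒜} (f : A ⟶ B) (g : B ⟶ C) : Prop where
  zero : f ≫ g = 0
  isKernel : Nonempty (IsLimit (KernelFork.ofι f zero))
  isCokernel : Nonempty (IsColimit (CokernelCofork.ofπ g zero))
  not_isSplitMono : ¬ IsSplitMono f
  not_isSplitEpi : ¬ IsSplitEpi g
  exists_lift : ∀ (Y : 𝒜) (h : Y ⟶ C), ¬ IsSplitEpi h → ∃ l : Y ⟶ B, l ≫ g = h
  exists_desc : ∀ (Y : 𝒜) (h : A ⟶ Y), ¬ IsSplitMono h → ∃ l : B ⟶ Y, f ≫ l = h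

variable (k : Type*) [Field k] [Linear k 𝒜]

theorem isIso_sub_aux {X : 𝒜} {u w : X ⟶ X} (hu : IsIso u) (hw : IsIso (𝟙 X - w ≫ inv u)) :
    IsIso (u - w) := by
  have : u - w = (𝟙 X - w ≫ inv u) ≫ u := by simp [Preadditive.sub_comp]
  rw [this]
  infer_instance

/-- The radical `rad(X, Y)` of the category: the maps `f : X ⟶ Y` such that `1 - g f` is invertible
for every `g : Y ⟶ X`. -/
def rad (X Y : 𝒜) : Submodule k (X ⟶ Y) where
  carrier := {f | ∀ g : Y ⟶ X, IsIso (𝟙 X - f ≫ g)}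
  add_mem' {f f'} hf hf' g := by
    have hu := hf g
    have := isIso_sub_aux (w := f' ≫ g) hu (by
      rw [Category.assoc]; exact hf' _)
    rwa [Preadditive.add_comp, ← sub_sub]
  zero_mem' g := by
    rw [Limits.zero_comp, sub_zero]; infer_instance
  smul_mem' c f hf g := by
    have := hf (c • g)
    rwa [Linear.comp_smul, ← Linear.smul_comp] at this

/-- The square of the radical: the span of the composites of two maps in the radical. -/
def radSq (X Y : 𝒜) : Submodule k (X ⟶ Y) :=
  Submodule.span k {h | ∃ (Z : 𝒜) (f : X ⟶ Z) (g : Z ⟶ Y), f ∈ rad k X Z ∧ g ∈ rad k Z Y ∧ f ≫ g = h}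

/-- The space `rad(X, Y) / rad²(X, Y)` of irreducible maps; for indecomposable `X` and `Y` its
dimension is the number of arrows from `X` to `Y` in the Auslander–Reiten quiver. -/
abbrev Irr (X Y : 𝒜) := rad k X Y ⧸ (radSq k X Y).submoduleOf (rad k X Y)

/-- The quiver `Γ`, with translation `τ` and with vertices labelled by objects of `𝒜` through `L`,
is the Auslander–Reiten quiver of `𝒜`: its vertices correspond to the isomorphism classes of
indecomposable objects, the arrows from `p` to `q` index a basis of the space of irreducible maps
from `L p` to `L q`, and for every `p` there is an almost split sequence starting in `L (τ p)` and
ending in `L p`. -/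
structure IsARQuiver [HasBinaryBiproducts 𝒜] (Γ : Type*) [Quiver Γ] (τ : Γ → Γ) (L : Γ → 𝒜) :
    Prop where
  indecomposable_iff : ∀ X : 𝒜, Indecomposable X ↔ ∃ p, Nonempty (X ≅ L p)
  eq_of_iso : ∀ p q, Nonempty (L p ≅ L q) → p = q
  irr_basis : ∀ p q, Nonempty (Module.Basis (p ⟶ q) k (Irr k (L p) (L q)))
  almostSplit : ∀ p, ∃ (E : 𝒜) (f : L (τ p) ⟶ E) (g : E ⟶ L p), IsAlmostSplit f g

end AuslanderReiten

section TranslationQuiver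

/-- The vertices of the graph `D_∞`: an infinite ray `node 0 — node 1 — node 2 — ⋯`, together with
two further vertices `fork 0` and `fork 1`, each joined to `node 0`. -/
inductive DInfty
  | fork (i : ZMod 2)
  | node (m : ℕ)

/-- The edges of `D_∞`, oriented towards the fork. -/
inductive DInfty.Hom : DInfty → DInfty → Type
  | fork (i : ZMod 2) : DInfty.Hom (.node 0) (.fork i)
  | step (m : ℕ) : DInfty.Hom (.node (m + 1)) (.node m)

instance : Quiver DInfty := ⟨DInfty.Hom⟩

/-- The vertices of the translation quiver `ℤΔ`. -/
structure ZQuiver (Δ : Type) where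
  n : ℤ
  v : Δ

/-- The arrows of `ℤΔ`: every arrow `v ⟶ w` of `Δ` gives arrows `(n, v) ⟶ (n, w)` and
`(n, w) ⟶ (n + 1, v)`, for all `n`. -/
inductive ZQuiver.Hom {Δ : Type} [Quiver.{0} Δ] : ZQuiver Δ → ZQuiver Δ → Type
  | level (n : ℤ) {v w : Δ} (α : v ⟶ w) : ZQuiver.Hom ⟨n, v⟩ ⟨n, w⟩
  | next (n : ℤ) {v w : Δ} (α : v ⟶ w) : ZQuiver.Hom ⟨n, w⟩ ⟨n + 1, v⟩

instance {Δ : Type} [Quiver.{0} Δ] : Quiver (ZQuiver Δ) := ⟨ZQuiver.Hom⟩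

/-- The translation `τ (n, v) = (n - 1, v)` of `ℤΔ`. -/
def ZQuiver.τ {Δ : Type} (p : ZQuiver Δ) : ZQuiver Δ := ⟨p.n - 1, p.v⟩

/-- The labelling of the vertices of `ℤD_∞` by torsion free objects: `(a, node m)` is labelled by
`F_{m+1,a}` and `(a, fork j)` by `F^{j+a}_{0a}`, where `j + a` is taken modulo `2`. -/
def label (k : Type u) [Field k] : ZQuiver DInfty → TF k
  | ⟨a, .node m⟩ => F k (m + 1) a
  | ⟨a, .fork j⟩ => F₀ k (j + a) a

end TranslationQuiver

end

end ZDInf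

/-! For an object `Y` of `𝒞` let `V` be the degree zero part of its localization. Dividing an
element of degree `n` by `x ^ n` (`dehom`) maps the degree `n` part of `Y` onto a subspace of `V`
(`stage`), injectively if `Y` is torsion free. These subspaces increase with `n` and exhaust `V`,
and `φ` adds a projection `pr₀` of `V`. A torsion free object is thus a filtered space with a
decomposition into two summands, and the problem becomes linear algebra in `V`.

Maps out of and into the standard objects are easy to describe. A map `F_{ma} → Y` is an element `y`
of degree `-a` together with an element `y'` of degree `-a + m` whose fraction is `pr₀ y`
(`homFromF`). A map `Y → F_{ma}` is a functional `l` on `V`, the difference of the two components at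
`x = 1`, such that `l` kills the stage `-a + m - 1` and `l ∘ pr₀` kills the stage `-a - 1`
(`functionalF_ext`, `exists_functionalF_eq`). For `F^i_{0a}` one has a vector fixed by `pr i`,
respectively a functional invariant under `pr i` that kills the stage `-a - 1`.

A composite `F_{m+1,a} → Y → F_{m+1,a}` is the identity as soon as `l (pr₀ y) = 1`. If a map out of
`F_{m+1,a}` is not a split monomorphism, then no admissible functional separates, so `pr₀ y` lies in
the sum of the stage `-a + m` and `pr₀` of the stage `-a - 1` (`exists_of_not_isSplitMono_F`); the
two terms of such a decomposition give the maps on the two summands of the middle term. If a map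
into `F_{m+1,a}` is not a split epimorphism, then its functional vanishes on the intersection of
`pr₀` of the stage `-a` with the stage `-a + m + 1`, and it can be written as a sum of functionals
of maps to the two summands (`exists_of_not_isSplitEpi_F`). With exactness this gives the almost
split sequences in `𝒞`, and those in `ℱ` follow because all terms lie in `ℱ`.

The same criterion classifies. In the lowest degree of a torsion free `X` the term from the stage
`-a - 1` is absent. If no standard object splits off, a lift of `pr₀ y` can be moved down degree by
degree until `y = 0` (`deg_eq_bot_of_forall_not_isSplitMono`). So a nonzero `X` has a standard
object as a split subobject, and, since idempotents split, an indecomposable `X` is isomorphic to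
it. Conversely the endomorphisms of the standard objects are scalars, which makes them
indecomposable.

Between nonisomorphic objects with scalar endomorphisms all maps are radical, and every radical map
out of the first term of an almost split sequence factors through the middle term. Hence the
irreducible maps out of an object form a one-dimensional space for each summand of the middle term
and vanish for the other labels (`IsAlmostSplit.nonempty_basis_irr`,
`IsAlmostSplit.subsingleton_irr`). The middle terms match the arrows of `ℤD_∞`.

The projectives over `R_m` are treated separately: `R_m(a)` and `S_i(a)` represent the elements of
degree `-a` fixed by an idempotent, and lifting along a map to a one-dimensional module makes them
split off any projective that starts in degree `-a` (`GrMod.IsUniversal.nonempty_iso`). -/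

namespace ZDInf

noncomputable section

/-! ### Graded modules: homogeneous components, submodules and quotients. -/

namespace GrMod

section Components

variable {k : Type u} [Field k] {A : Type u} [CommRing A] [Algebra k A] {𝒜 : ℤ → Submodule k A}

theorem iSup_deg (M : GrMod 𝒜) : iSup M.deg = ⊤ :=
  ((DirectSum.isInternal_submodule_iff_iSupIndep_and_iSup_eq_top _).1 M.isInternal).2

@[elab_as_elim]
theorem deg_induction {M : GrMod 𝒜} {p : M → Prop} (x : M) (hom : ∀ n, ∀ x ∈ M.deg n, p x)
    (zero : p 0) (add : ∀ x y, p x → p y → p (x + y)) : p x :=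
  Submodule.iSup_induction M.deg (motive := p) (M.iSup_deg ▸ Submodule.mem_top) hom zero add

theorem linearMap_ext {M : GrMod 𝒜} {N : Type*} [AddCommGroup N] [Module k N] {f g : M →ₗ[k] N}
    (h : ∀ n, ∀ x ∈ M.deg n, f x = g x) : f = g := by
  ext x
  induction x using deg_induction with
  | hom n x hx => exact h n x hx
  | zero => simp
  | add x y hx hy => simp [hx, hy]

theorem hom_ext_deg {M N : GrMod 𝒜} {f g : M ⟶ N}
    (h : ∀ n, ∀ x ∈ M.deg n, toLin f x = toLin g x) : f = g := by
  ext x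
  exact LinearMap.congr_fun (linearMap_ext (f := (toLin f).restrictScalars k)
    (g := (toLin g).restrictScalars k) h) x

/-- The decomposition of a graded module into its homogeneous parts. -/
def decomp (M : GrMod 𝒜) : (DirectSum ℤ fun n => M.deg n) ≃ₗ[k] M :=
  LinearEquiv.ofBijective (DirectSum.coeLinearMap M.deg) M.isInternal

theorem decomp_symm_of_mem {M : GrMod 𝒜} {n : ℤ} {x : M} (hx : x ∈ M.deg n) :
    M.decomp.symm x = DirectSum.lof k ℤ (fun n => M.deg n) n ⟨x, hx⟩ := by
  rw [LinearEquiv.symm_apply_eq]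
  exact (DirectSum.coeLinearMap_lof (A := M.deg) n ⟨x, hx⟩).symm

/-- The linear map which is given by `f n` on the homogeneous part of degree `n`. -/
def liftDeg (M : GrMod 𝒜) {N : Type*} [AddCommGroup N] [Module k N] (f : ∀ n, M.deg n →ₗ[k] N) :
    M →ₗ[k] N :=
  (DirectSum.toModule k ℤ N f).comp M.decomp.symm.toLinearMap

theorem liftDeg_of_mem {M : GrMod 𝒜} {N : Type*} [AddCommGroup N] [Module k N]
    (f : ∀ n, M.deg n →ₗ[k] N) {n : ℤ} {x : M} (hx : x ∈ M.deg n) :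
    M.liftDeg f x = f n ⟨x, hx⟩ := by
  rw [liftDeg, LinearMap.comp_apply, LinearEquiv.coe_coe, decomp_symm_of_mem hx,
    DirectSum.toModule_lof]

/-- The homogeneous component of degree `n`. -/
def component (M : GrMod 𝒜) (n : ℤ) : M →ₗ[k] M :=
  M.liftDeg fun m => if m = n then (M.deg m).subtype else 0

theorem component_self {M : GrMod 𝒜} {n : ℤ} {x : M} (hx : x ∈ M.deg n) :
    M.component n x = x := by
  rw [component, liftDeg_of_mem _ hx, if_pos rfl]; rfl

theorem component_of_ne {M : GrMod 𝒜} {m n : ℤ} (h : m ≠ n) {x : M} (hx : x ∈ M.deg m) :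
    M.component n x = 0 := by
  rw [component, liftDeg_of_mem _ hx, if_neg h]; rfl

theorem component_mem {M : GrMod 𝒜} (n : ℤ) (x : M) : M.component n x ∈ M.deg n := by
  induction x using deg_induction with
  | hom m x hx =>
    by_cases h : m = n
    · subst h; rwa [component_self hx]
    · rw [component_of_ne h hx]; exact zero_mem _
  | zero => rw [map_zero]; exact zero_mem _
  | add x y hx hy => rw [map_add]; exact add_mem hx hy

theorem exists_eq_sum (M : GrMod 𝒜) (x : M) : ∃ s : Finset ℤ, x = ∑ n ∈ s, M.component n x := by
  -- Allowing all larger finite sets lets the sets of two summands be merged.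
  suffices h : ∃ s : Finset ℤ, ∀ t, s ⊆ t → x = ∑ n ∈ t, M.component n x from
    h.imp fun s hs => hs s subset_rfl
  classical
  induction x using deg_induction with
  | hom m x hx =>
    refine ⟨{m}, fun t ht => ?_⟩
    rw [Finset.sum_eq_single_of_mem m (ht (by simp)) fun n _ hn => component_of_ne hn.symm hx,
      component_self hx]
  | zero => exact ⟨∅, fun t _ => by simp⟩
  | add x y hx hy =>
    obtain ⟨s, hs⟩ := hx
    obtain ⟨s', hs'⟩ := hy
    refine ⟨s ∪ s', fun t ht => ?_⟩
    simp_rw [map_add, Finset.sum_add_distrib]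
    rw [← hs t (Finset.subset_union_left.trans ht), ← hs' t (Finset.subset_union_right.trans ht)]

theorem component_map {M N : GrMod 𝒜} (f : M →ₗ[k] N) (hf : ∀ n, ∀ x ∈ M.deg n, f x ∈ N.deg n)
    (n : ℤ) (x : M) : N.component n (f x) = f (M.component n x) := by
  induction x using deg_induction with
  | hom m x hx =>
    by_cases h : m = n
    · subst h; rw [component_self hx, component_self (hf _ _ hx)]
    · rw [component_of_ne h hx, component_of_ne h (hf _ _ hx), map_zero]
  | zero => simp
  | add x y hx hy => simp [hx, hy]

theorem component_toLin {M N : GrMod 𝒜} (f : M ⟶ N) (n : ℤ) (x : M) :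
    N.component n (toLin f x) = toLin f (M.component n x) :=
  component_map ((toLin f).restrictScalars k) (fun _ _ hx => toLin_mem f hx) n x

theorem isInternal_of_projections {V : Type*} [AddCommGroup V] [Module k V]
    {d : ℤ → Submodule k V} (c : ℤ → V →ₗ[k] V) (h : ∀ n, ∀ x ∈ d n, c n x = x)
    (h' : ∀ m n, m ≠ n → ∀ x ∈ d m, c n x = 0) (hd : iSup d = ⊤) : DirectSum.IsInternal d := by
  rw [DirectSum.isInternal_submodule_iff_iSupIndep_and_iSup_eq_top]
  refine ⟨fun n => Submodule.disjoint_def.2 fun x hx hx' => ?_, hd⟩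
  have : (⨆ j, ⨆ _ : j ≠ n, d j) ≤ LinearMap.ker (c n) :=
    iSup₂_le fun j hj x hx => h' j n hj x hx
  rw [← h n x hx]
  exact this hx'

/-- A homogeneous submodule, as a graded module. -/
def ofSubmodule (M : GrMod 𝒜) (N : Submodule A M) (hN : ∀ x ∈ N, ∀ n, M.component n x ∈ N)
    (hfin : Module.Finite A N) : GrMod 𝒜 where
  carrier := N
  deg n := (M.deg n).comap (N.subtype.restrictScalars k)
  isInternal := by
    refine isInternal_of_projections (fun n => ((M.component n).comp
      (N.subtype.restrictScalars k)).codRestrict (N.restrictScalars k) fun x => hN _ x.2 n)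
      (fun n x hx => Subtype.ext (component_self hx))
      (fun m n hmn x hx => Subtype.ext (component_of_ne hmn hx)) ?_
    rw [eq_top_iff]
    rintro x -
    obtain ⟨s, hs⟩ := M.exists_eq_sum x.1
    have : x = ∑ n ∈ s, (⟨M.component n x.1, hN _ x.2 n⟩ : N) := by
      refine Subtype.ext ?_
      rw [AddSubmonoidClass.coe_finsetSum]
      exact hs
    rw [this]
    exact Submodule.sum_mem _ fun n _ => Submodule.mem_iSup_of_mem n (component_mem (M := M) n x.1)
  smul_mem ha hx := M.smul_mem ha hx
  finite := hfin

/-- The quotient by a homogeneous submodule, as a graded module. -/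
def quotient (M : GrMod 𝒜) (N : Submodule A M) (hN : ∀ x ∈ N, ∀ n, M.component n x ∈ N) :
    GrMod 𝒜 where
  carrier := M ⧸ N
  deg n := (M.deg n).map (N.mkQ.restrictScalars k)
  isInternal := by
    refine isInternal_of_projections (fun n => (N.restrictScalars k).mapQ (N.restrictScalars k)
      (M.component n) fun x hx => hN x hx n) ?_ ?_ ?_
    · rintro n _ ⟨x, hx, rfl⟩
      exact congrArg N.mkQ (component_self hx)
    · rintro m n hmn _ ⟨x, hx, rfl⟩
      exact (congrArg N.mkQ (component_of_ne hmn hx)).trans (map_zero _)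
    · rw [← Submodule.map_iSup, iSup_deg, Submodule.map_top, LinearMap.range_eq_top]
      exact N.mkQ_surjective
  smul_mem := by
    rintro i j a _ ha ⟨x, hx, rfl⟩
    exact ⟨a • x, M.smul_mem ha hx, map_smul N.mkQ a x⟩
  finite := inferInstance

/-- A linear map of degree zero, as a morphism. -/
def homMk {M N : GrMod 𝒜} (f : M →ₗ[A] N) (hf : ∀ n, ∀ x ∈ M.deg n, f x ∈ N.deg n) : M ⟶ N :=
  ⟨f, hf⟩

@[simp] theorem toLin_homMk {M N : GrMod 𝒜} (f : M →ₗ[A] N)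
    (hf : ∀ n, ∀ x ∈ M.deg n, f x ∈ N.deg n) : toLin (homMk f hf) = f := rfl

/-- The quotient by the image is again a finitely generated graded module, and an epimorphism cannot
distinguish the projection onto it from zero. -/
theorem surjective_of_epi {M N : GrMod 𝒜} (f : M ⟶ N) [Epi f] :
    Function.Surjective (toLin f) := by
  have hN : ∀ x ∈ LinearMap.range (toLin f), ∀ n, N.component n x ∈ LinearMap.range (toLin f) := by
    rintro _ ⟨x, rfl⟩ n
    exact ⟨_, (component_toLin f n x).symm⟩
  let π : N ⟶ N.quotient _ hN := homMk (LinearMap.range (toLin f)).mkQ fun n x hx => ⟨x, hx, rfl⟩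
  have h : f ≫ π = f ≫ 0 := by
    ext x
    exact (Submodule.Quotient.mk_eq_zero _).2 ⟨x, rfl⟩
  have h' : π = 0 := (cancel_epi f).1 h
  rw [← LinearMap.range_eq_top, eq_top_iff]
  rintro y -
  exact (Submodule.Quotient.mk_eq_zero _).1 (LinearMap.congr_fun (congrArg toLin h') y)

theorem epi_of_surjective {M N : GrMod 𝒜} (f : M ⟶ N) (hf : Function.Surjective (toLin f)) :
    Epi f where
  left_cancellation g h e := by
    ext y
    obtain ⟨x, rfl⟩ := hf y
    exact LinearMap.congr_fun (congrArg toLin e) x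

/-- The image of an idempotent is a homogeneous submodule, and it is finitely generated as a
quotient of the module. -/
instance : IsIdempotentComplete (GrMod 𝒜) where
  idempotents_split M p hp := by
    have hN : ∀ x ∈ LinearMap.range (toLin p), ∀ n, M.component n x ∈ LinearMap.range (toLin p) := by
      rintro _ ⟨x, rfl⟩ n
      exact ⟨_, (component_toLin p n x).symm⟩
    refine ⟨M.ofSubmodule _ hN inferInstance,
      homMk (LinearMap.range (toLin p)).subtype fun n x hx => hx,
      homMk (toLin p).rangeRestrict fun n x hx => toLin_mem p hx, ?_, rfl⟩
    ext ⟨_, x, rfl⟩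
    exact Subtype.ext (LinearMap.congr_fun (congrArg toLin hp) x)

/-- A graded linear map which is surjective is so in every degree. -/
theorem exists_mem_deg_of_surjective {M N : GrMod 𝒜} {f : M ⟶ N}
    (hf : Function.Surjective (toLin f)) {n : ℤ} {y : N} (hy : y ∈ N.deg n) :
    ∃ x ∈ M.deg n, toLin f x = y := by
  obtain ⟨x, rfl⟩ := hf y
  exact ⟨_, component_mem n x, by rw [← component_toLin, component_self hy]⟩

theorem mem_deg_of_injective {M N : GrMod 𝒜} {f : M ⟶ N}
    (hf : Function.Injective (toLin f)) {n : ℤ} {x : M} (hx : toLin f x ∈ N.deg n) :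
    x ∈ M.deg n := by
  rw [← hf ((component_toLin f n x).symm.trans (component_self hx))]
  exact component_mem n x

end Components

end GrMod

/-! ### Linear categories: bricks, the radical, and irreducible maps from almost split sequences. -/

section LinearCategories

variable {𝒜 : Type*} [Category 𝒜] [Preadditive 𝒜]

/-- The complementary idempotent splits off an object `K` with `X ≅ B ⊞ K`, and `K` must vanish
since `B` does not. No local endomorphism ring is needed. -/
theorem isIso_of_isSplitMono_of_indecomposable [HasBinaryBiproducts 𝒜] [IsIdempotentComplete 𝒜]
    {B X : 𝒜} (hX : Indecomposable X) (hB : ¬ IsZero B) (s : B ⟶ X) [IsSplitMono s] : IsIso s := by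
  obtain ⟨K, i, e, hi, he⟩ := IsIdempotentComplete.idempotents_split X (𝟙 X - retraction s ≫ s)
    (by simp [Preadditive.sub_comp, Preadditive.comp_sub])
  have hsmono : Mono i := ⟨fun a b h => by
    have := congrArg (· ≫ e) h
    simpa [hi] using this⟩
  have heepi : Epi e := ⟨fun a b h => by
    have := congrArg (i ≫ ·) h
    simpa [reassoc_of% hi] using this⟩
  have hse : s ≫ e = 0 := by
    rw [← cancel_mono i, Category.assoc, he]
    simp [Preadditive.comp_sub]
  have hir : i ≫ retraction s = 0 := by
    rw [← cancel_epi e, reassoc_of% he]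
    simp [Preadditive.sub_comp]
  have hK : IsZero K := by
    refine (hX.2 B K ⟨biprod.lift (retraction s) e, biprod.desc s i, ?_, ?_⟩).resolve_left hB
    · rw [biprod.lift_desc, he]; abel
    · apply biprod.hom_ext' <;> apply biprod.hom_ext <;> simp [hi, hse, hir]
  refine ⟨retraction s, IsSplitMono.id s, ?_⟩
  rw [hK.eq_zero_of_src i, Limits.comp_zero, eq_comm, sub_eq_zero] at he
  exact he.symm

theorem IsAlmostSplit.of_eq {A A' B C : 𝒜} (h : A = A') {f : A ⟶ B} {g : B ⟶ C}
    (hfg : IsAlmostSplit f g) : ∃ f' : A' ⟶ B, IsAlmostSplit f' g := by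
  subst h; exact ⟨f, hfg⟩

theorem nonempty_isLimit_kernelFork {A B C : 𝒜} {f : A ⟶ B} {g : B ⟶ C} (w : f ≫ g = 0)
    (hf : Mono f) (h : ∀ (Y : 𝒜) (l : Y ⟶ B), l ≫ g = 0 → ∃ t, t ≫ f = l) :
    Nonempty (IsLimit (KernelFork.ofι f w)) :=
  ⟨KernelFork.IsLimit.ofι' f w fun {Y} l hl => ⟨(h Y l hl).choose, (h Y l hl).choose_spec⟩⟩

theorem nonempty_isColimit_cokernelCofork {A B C : 𝒜} {f : A ⟶ B} {g : B ⟶ C} (w : f ≫ g = 0)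
    (hg : Epi g) (h : ∀ (Y : 𝒜) (l : B ⟶ Y), f ≫ l = 0 → ∃ t, g ≫ t = l) :
    Nonempty (IsColimit (CokernelCofork.ofπ g w)) :=
  ⟨CokernelCofork.IsColimit.ofπ' g w fun {Y} l hl => ⟨(h Y l hl).choose, (h Y l hl).choose_spec⟩⟩

/-- An almost split sequence whose terms belong to a full subcategory is almost split there. -/
theorem IsAlmostSplit.of_map_ι {P : ObjectProperty 𝒜} {A B C : P.FullSubcategory} {f : A ⟶ B}
    {g : B ⟶ C} (h : IsAlmostSplit (P.ι.map f) (P.ι.map g)) : IsAlmostSplit f g where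
  zero := P.ι.map_injective (by rw [P.ι.map_comp, h.zero, P.ι.map_zero])
  isKernel := by
    obtain ⟨hk⟩ := h.isKernel
    have : Mono (P.ι.map f) := mono_of_isLimit_fork hk
    refine nonempty_isLimit_kernelFork _ (P.ι.mono_of_mono_map this) fun Y l hl => ?_
    obtain ⟨t, ht⟩ := KernelFork.IsLimit.lift' hk (P.ι.map l)
      (by rw [← P.ι.map_comp, hl, P.ι.map_zero])
    exact ⟨ObjectProperty.homMk t, P.ι.map_injective ht⟩
  isCokernel := by
    obtain ⟨hk⟩ := h.isCokernel
    have : Epi (P.ι.map g) := epi_of_isColimit_cofork hk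
    refine nonempty_isColimit_cokernelCofork _ (P.ι.epi_of_epi_map this) fun Y l hl => ?_
    obtain ⟨t, ht⟩ := CokernelCofork.IsColimit.desc' hk (P.ι.map l)
      (by rw [← P.ι.map_comp, hl, P.ι.map_zero])
    exact ⟨ObjectProperty.homMk t, P.ι.map_injective ht⟩
  not_isSplitMono hf := h.not_isSplitMono inferInstance
  not_isSplitEpi hg := h.not_isSplitEpi inferInstance
  exists_lift Y l hl := by
    obtain ⟨m, hm⟩ := h.exists_lift _ (P.ι.map l) fun hs => hl
      (IsSplitEpi.mk' ⟨ObjectProperty.homMk (section_ (P.ι.map l)),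
        P.ι.map_injective (IsSplitEpi.id (P.ι.map l))⟩)
    exact ⟨ObjectProperty.homMk m, P.ι.map_injective hm⟩
  exists_desc Y l hl := by
    obtain ⟨m, hm⟩ := h.exists_desc _ (P.ι.map l) fun hs => hl
      (IsSplitMono.mk' ⟨ObjectProperty.homMk (retraction (P.ι.map l)),
        P.ι.map_injective (IsSplitMono.id (P.ι.map l))⟩)
    exact ⟨ObjectProperty.homMk m, P.ι.map_injective hm⟩

variable (k : Type*) [Field k] [Linear k 𝒜]

/-- An object is a brick if it is nonzero and its endomorphisms are the scalars. -/
structure IsBrick (X : 𝒜) : Prop where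
  id_ne_zero : 𝟙 X ≠ 0
  exists_smul : ∀ f : X ⟶ X, ∃ c : k, f = c • 𝟙 X

variable {k}

theorem IsBrick.not_isZero {X : 𝒜} (hX : IsBrick k X) : ¬ IsZero X := fun h =>
  hX.id_ne_zero (h.eq_of_src _ _)

theorem IsBrick.of_iso {X Y : 𝒜} (hX : IsBrick k X) (e : X ≅ Y) : IsBrick k Y where
  id_ne_zero h := hX.id_ne_zero <| by
    have := congrArg (fun t => e.hom ≫ t ≫ e.inv) h
    simpa using this
  exists_smul f := by
    obtain ⟨c, hc⟩ := hX.exists_smul (e.hom ≫ f ≫ e.inv)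
    refine ⟨c, ?_⟩
    have := congrArg (fun t => e.inv ≫ t ≫ e.hom) hc
    simpa using this

/-- The projection onto one summand is an endomorphism, hence a scalar `c`. The first summand
vanishes if `c = 0`, the second one otherwise. -/
theorem IsBrick.indecomposable [HasBinaryBiproducts 𝒜] {X : 𝒜} (hX : IsBrick k X) :
    Indecomposable X := by
  refine ⟨hX.not_isZero, fun Y Z e => ?_⟩
  obtain ⟨c, hc⟩ := hX.exists_smul (e.hom ≫ biprod.fst ≫ biprod.inl ≫ e.inv)
  have h : (biprod.fst ≫ biprod.inl : Y ⊞ Z ⟶ Y ⊞ Z) = c • 𝟙 _ := by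
    have := congrArg (fun t => e.inv ≫ t ≫ e.hom) hc
    simpa using this
  by_cases h0 : c = 0
  · left
    rw [IsZero.iff_id_eq_zero]
    have := congrArg (fun t => biprod.inl ≫ t ≫ biprod.fst) h
    simpa [h0] using this
  · right
    rw [IsZero.iff_id_eq_zero]
    have := congrArg (fun t => c⁻¹ • (biprod.inr ≫ t ≫ biprod.snd)) h
    simpa [h0, smul_smul] using this.symm

theorem comp_mem_rad {X Y Z : 𝒜} {f : X ⟶ Y} (g : Y ⟶ Z) (hf : f ∈ rad k X Y) :
    f ≫ g ∈ rad k X Z := fun h => by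
  rw [Category.assoc]; exact hf _

/-- The inverse of `1 - gf` is `1 + g(1 - fg)⁻¹f`. This makes `rad`, defined by a condition on one
side, a two-sided ideal. -/
theorem mem_rad_of_isIso_symm {X Y : 𝒜} {f : X ⟶ Y} {g : Y ⟶ X} (h : IsIso (𝟙 X - f ≫ g)) :
    IsIso (𝟙 Y - g ≫ f) := by
  refine ⟨𝟙 Y + g ≫ inv (𝟙 X - f ≫ g) ≫ f, ?_, ?_⟩
  · have h1 : (𝟙 Y - g ≫ f) ≫ g = g ≫ (𝟙 X - f ≫ g) := by
      simp [Preadditive.sub_comp, Preadditive.comp_sub]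
    rw [Preadditive.comp_add, reassoc_of% h1, IsIso.hom_inv_id_assoc]
    simp
  · have h1 : f ≫ (𝟙 Y - g ≫ f) = (𝟙 X - f ≫ g) ≫ f := by
      simp [Preadditive.sub_comp, Preadditive.comp_sub]
    rw [Preadditive.add_comp, Category.assoc, Category.assoc, h1, IsIso.inv_hom_id_assoc]
    simp

theorem rad_comp_mem {X Y Z : 𝒜} (g : X ⟶ Y) {f : Y ⟶ Z} (hf : f ∈ rad k Y Z) :
    g ≫ f ∈ rad k X Z := fun h => by
  rw [Category.assoc]
  refine mem_rad_of_isIso_symm ?_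
  rw [Category.assoc]
  exact hf _

/-- The composite with any map back is a scalar. If it were nonzero, rescaling the map back would
give a retraction; so it is zero. -/
theorem IsBrick.mem_rad {X Y : 𝒜} (hX : IsBrick k X) {f : X ⟶ Y}
    (hf : ¬ IsSplitMono f) : f ∈ rad k X Y := fun g => by
  obtain ⟨c, hc⟩ := hX.exists_smul (f ≫ g)
  by_cases h0 : c = 0
  · rw [hc, h0, zero_smul, sub_zero]; infer_instance
  · exact absurd (IsSplitMono.mk' ⟨c⁻¹ • g, by rw [Linear.comp_smul, hc, smul_smul,
      inv_mul_cancel₀ h0, one_smul]⟩) hf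

theorem not_isSplitMono_of_mem_rad {X Y : 𝒜} (hX : 𝟙 X ≠ 0) {f : X ⟶ Y} (hf : f ∈ rad k X Y) :
    ¬ IsSplitMono f := fun h => hX <| by
  have := hf (retraction f)
  rw [IsSplitMono.id, sub_self] at this
  exact (cancel_epi (0 : X ⟶ X)).1 (by simp)

/-- The idempotent of `Y` given by the retraction is a scalar `c` with `c f = f`, and `f ≠ 0` forces
`c = 1`. -/
theorem IsBrick.isIso_of_isSplitMono {X Y : 𝒜} (hX : IsBrick k X) (hY : IsBrick k Y) (f : X ⟶ Y)
    [IsSplitMono f] : IsIso f := by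
  obtain ⟨c, hc⟩ := hY.exists_smul (retraction f ≫ f)
  have hf : f = c • f := by
    have := congrArg (f ≫ ·) hc
    simpa using this
  have h1 : c = 1 := by
    by_contra h
    have h2 : (1 - c) • f = 0 := by rw [sub_smul, one_smul, ← hf, sub_self]
    have h3 := (smul_eq_zero_iff_right (sub_ne_zero.2 (Ne.symm h))).1 h2
    exact hX.id_ne_zero ((IsSplitMono.id f).symm.trans ((congrArg (· ≫ retraction f) h3).trans
      zero_comp))
  exact ⟨retraction f, IsSplitMono.id f, by rw [hc, h1, one_smul]⟩

theorem IsBrick.mem_rad_of_not_iso {X Y : 𝒜} (hX : IsBrick k X) (hY : IsBrick k Y)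
    (h : IsEmpty (X ≅ Y)) (f : X ⟶ Y) : f ∈ rad k X Y :=
  hX.mem_rad fun _ => have := hX.isIso_of_isSplitMono hY f; h.elim (asIso f)

theorem mem_rad_biprod [HasBinaryBiproducts 𝒜] {A B Y : 𝒜} {l : A ⊞ B ⟶ Y}
    (hA : biprod.inl ≫ l ∈ rad k A Y) (hB : biprod.inr ≫ l ∈ rad k B Y) : l ∈ rad k (A ⊞ B) Y := by
  have : l = biprod.fst ≫ biprod.inl ≫ l + biprod.snd ≫ biprod.inr ≫ l := by
    rw [← Category.assoc, ← Category.assoc biprod.snd, ← Preadditive.add_comp, biprod.total,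
      Category.id_comp]
  rw [this]
  exact add_mem (rad_comp_mem _ hA) (rad_comp_mem _ hB)

theorem mem_rad_of_iso {A B Y : 𝒜} (e : A ≅ B) {l : A ⟶ Y} (h : e.inv ≫ l ∈ rad k B Y) :
    l ∈ rad k A Y := by
  rw [← e.hom_inv_id_assoc l]
  exact rad_comp_mem _ h

theorem comp_mem_radSq {X Y Z : 𝒜} {f : X ⟶ Y} {g : Y ⟶ Z} (hf : f ∈ rad k X Y)
    (hg : g ∈ rad k Y Z) : f ≫ g ∈ radSq k X Z :=
  Submodule.subset_span ⟨Y, f, g, hf, hg, rfl⟩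

variable {X E C : 𝒜} {f : X ⟶ E} {g : E ⟶ C}

/-- A radical map out of `X` is not a split monomorphism, so it factors through `f`; both factors
are then radical. -/
theorem IsAlmostSplit.subsingleton_irr (h : IsAlmostSplit f g) (hX : IsBrick k X) {Y : 𝒜}
    (hY : ∀ l : E ⟶ Y, l ∈ rad k E Y) : Subsingleton (Irr k X Y) := by
  rw [Submodule.Quotient.subsingleton_iff, eq_top_iff]
  rintro ⟨t, ht⟩ -
  obtain ⟨l, rfl⟩ := h.exists_desc Y t (not_isSplitMono_of_mem_rad hX.id_ne_zero ht)
  exact comp_mem_radSq (hX.mem_rad h.not_isSplitMono) (hY l)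

/-- Otherwise `f ≫ p = f ≫ φ` with `φ` radical, and `p - φ` factors through the cokernel `g`.
Restricted along `i`, this factors the automorphism `1 - iφ` of `Y` through `C`, so `Y` would be a
split subobject of `C`. -/
theorem IsAlmostSplit.comp_notMem_radSq (h : IsAlmostSplit f g) (hX : IsBrick k X) {Y : 𝒜}
    (hYC : ∀ t : Y ⟶ C, ¬ IsSplitMono t) {i : Y ⟶ E} {p : E ⟶ Y} (hip : i ≫ p = 𝟙 Y) :
    f ≫ p ∉ radSq k X Y := by
  intro hp
  have key : ∃ φ : E ⟶ Y, φ ∈ rad k E Y ∧ f ≫ φ = f ≫ p := by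
    refine Submodule.span_induction (p := fun t _ => ∃ φ : E ⟶ Y, φ ∈ rad k E Y ∧ f ≫ φ = t)
      ?_ ⟨0, zero_mem _, comp_zero⟩ ?_ ?_ hp
    · rintro _ ⟨Z, a, b, ha, hb, rfl⟩
      -- The first factor of a generator of the radical square extends along `f`; the second factor
      -- keeps the extension radical.
      obtain ⟨l, rfl⟩ := h.exists_desc Z a (not_isSplitMono_of_mem_rad hX.id_ne_zero ha)
      exact ⟨l ≫ b, rad_comp_mem _ hb, (Category.assoc _ _ _).symm⟩
    · rintro _ _ _ _ ⟨φ, hφ, rfl⟩ ⟨ψ, hψ, rfl⟩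
      exact ⟨φ + ψ, add_mem hφ hψ, Preadditive.comp_add _ _ _ _ _ _⟩
    · rintro c _ _ ⟨φ, hφ, rfl⟩
      exact ⟨c • φ, Submodule.smul_mem _ c hφ, Linear.comp_smul _ _ _ _ _ _⟩
  obtain ⟨φ, hφ, hφp⟩ := key
  obtain ⟨c, hc⟩ : ∃ c : C ⟶ Y, g ≫ c = p - φ := by
    obtain ⟨hcok⟩ := h.isCokernel
    obtain ⟨c, hc⟩ := CokernelCofork.IsColimit.desc' hcok (p - φ)
      (by rw [Preadditive.comp_sub, hφp, sub_self])
    exact ⟨c, hc⟩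
  have h1 : (i ≫ g) ≫ c = 𝟙 Y - i ≫ φ := by
    rw [Category.assoc, hc, Preadditive.comp_sub, hip]
  have h2 : IsIso (𝟙 Y - i ≫ φ) := by
    have := rad_comp_mem (k := k) i hφ (𝟙 Y)
    rwa [Category.comp_id] at this
  exact hYC (i ≫ g) (IsSplitMono.mk' ⟨c ≫ inv (𝟙 Y - i ≫ φ), by
    rw [← Category.assoc, h1, IsIso.hom_inv_id]⟩)

theorem IsAlmostSplit.nonempty_basis_irr (h : IsAlmostSplit f g) (hX : IsBrick k X) {Y : 𝒜}
    (hYb : IsBrick k Y) (hYC : ∀ t : Y ⟶ C, ¬ IsSplitMono t) {i : Y ⟶ E} {p : E ⟶ Y}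
    (hip : i ≫ p = 𝟙 Y) (hY : ∀ l : E ⟶ Y, i ≫ l = 0 → l ∈ rad k E Y) (J : Type*) [Unique J] :
    Nonempty (Module.Basis J k (Irr k X Y)) := by
  have hf := hX.mem_rad h.not_isSplitMono
  let b : Irr k X Y := Submodule.Quotient.mk ⟨f ≫ p, comp_mem_rad p hf⟩
  have hb : b ≠ 0 := fun h0 =>
    h.comp_notMem_radSq hX hYC hip
      ((Submodule.Quotient.mk_eq_zero ((radSq k X Y).submoduleOf (rad k X Y))).1 h0)
  have hspan : ∀ t : Irr k X Y, ∃ c : k, c • b = t := by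
    intro t
    obtain ⟨⟨t, ht⟩, rfl⟩ := Submodule.Quotient.mk_surjective _ t
    obtain ⟨l, rfl⟩ := h.exists_desc Y t (not_isSplitMono_of_mem_rad hX.id_ne_zero ht)
    -- This scalar is the coordinate: `c p - l` vanishes on the chosen copy of `Y`, hence is
    -- radical, and composing it with `f` lands in the radical square.
    obtain ⟨c, hc⟩ := hYb.exists_smul (i ≫ l)
    refine ⟨c, ?_⟩
    rw [← Submodule.Quotient.mk_smul, Submodule.Quotient.eq]
    have h1 : c • p - l ∈ rad k E Y := by
      refine hY _ ?_
      rw [Preadditive.comp_sub, Linear.comp_smul, hip, hc, sub_self]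
    have h2 := comp_mem_radSq hf h1
    rw [Preadditive.comp_sub, Linear.comp_smul] at h2
    exact h2
  refine ⟨Module.Basis.mk (v := fun _ : J => b) ?_ ?_⟩
  · exact LinearIndependent.of_subsingleton default hb
  · rintro t -
    obtain ⟨c, rfl⟩ := hspan t
    exact Submodule.smul_mem _ c (Submodule.subset_span ⟨default, rfl⟩)

end LinearCategories

/-! ### Separating functionals, and projective modules through universal elements. -/

theorem exists_dual_eq_one {k V : Type*} [Field k] [AddCommGroup V] [Module k V]
    {W : Submodule k V} {v : V} (hv : v ∉ W) : ∃ l : V →ₗ[k] k, l v = 1 ∧ ∀ w ∈ W, l w = 0 := by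
  obtain ⟨f, hf, hfW⟩ := Submodule.exists_le_ker_of_notMem hv
  exact ⟨(f v)⁻¹ • f, inv_mul_cancel₀ hf, fun w hw => by simp [LinearMap.mem_ker.1 (hfW hw)]⟩

namespace GrMod

section Representable

variable {k : Type u} [Field k] {A : Type u} [CommRing A] [Algebra k A] {𝒜 : ℤ → Submodule k A}

/-- The one-dimensional graded module in degree `d` on which `A` acts through `ε`. -/
def simple (ε : A →ₐ[k] k) (hε : ∀ n ≠ 0, ∀ a ∈ 𝒜 n, ε a = 0) (d : ℤ) : GrMod 𝒜 where
  carrier := k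
  module := Module.compHom k ε.toRingHom
  isScalarTower := by
    let := Module.compHom k ε.toRingHom
    refine ⟨fun c a x => ?_⟩
    change ε (c • a) * x = c * (ε a * x)
    rw [map_smul, smul_eq_mul, mul_assoc]
  deg n := if n = d then ⊤ else ⊥
  isInternal := by
    refine isInternal_of_projections (fun n => if n = d then LinearMap.id else 0)
      (fun n x hx => ?_) (fun m n hmn x hx => ?_) ?_
    · split_ifs at hx ⊢ with h
      · rfl
      · exact ((Submodule.mem_bot k).1 hx).symm
    · split_ifs at hx ⊢ with h h'
      · exact absurd (h'.trans h.symm) hmn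
      · exact (Submodule.mem_bot k).1 hx
      · rfl
      · rfl
    · rw [eq_top_iff]
      exact le_iSup_of_le d (by rw [if_pos rfl])
  smul_mem {i j a x} ha hx := by
    change ε a * x ∈ _
    split_ifs at hx ⊢ with h h' h'
    · trivial
    · rw [(Submodule.mem_bot k).1 hx, mul_zero]; exact zero_mem _
    · rw [hε i (by omega) a ha, zero_mul]; exact zero_mem _
    · rw [(Submodule.mem_bot k).1 hx, mul_zero]; exact zero_mem _
  finite := by
    let := Module.compHom k ε.toRingHom
    refine Module.finite_def.2 (Submodule.fg_def.2 ⟨{1}, Set.toFinite _, ?_⟩)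
    rw [eq_top_iff]
    rintro x -
    have h : x = (algebraMap k A x) • (1 : k) := by
      change x = ε (algebraMap k A x) * 1
      rw [AlgHom.commutes, mul_one]; rfl
    rw [h]
    exact Submodule.smul_mem _ _ (Submodule.subset_span rfl)

/-- The element `q` of degree `d` of `Q` is the universal element of degree `d` fixed by `e`, and
it spans the space of these elements of `Q`. -/
structure IsUniversal (Q : GrMod 𝒜) (e : A) (d : ℤ) (q : Q) : Prop where
  mem : q ∈ Q.deg d
  smul_eq : e • q = q
  ne_zero : q ≠ 0
  exists_smul : ∀ x ∈ Q.deg d, e • x = x → ∃ c : k, x = c • q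
  exists_hom : ∀ (P : GrMod 𝒜), ∀ p ∈ P.deg d, e • p = p → ∃ f : Q ⟶ P, toLin f q = p
  hom_ext : ∀ (P : GrMod 𝒜) (f g : Q ⟶ P), toLin f q = toLin g q → f = g

namespace IsUniversal

variable {Q : GrMod 𝒜} {e : A} {d : ℤ} {q : Q}

theorem isBrick (h : IsUniversal Q e d q) : IsBrick k Q where
  id_ne_zero h0 := h.ne_zero (LinearMap.congr_fun (congrArg toLin h0) q)
  exists_smul f := by
    obtain ⟨c, hc⟩ := h.exists_smul (toLin f q) (toLin_mem f h.mem)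
      (by rw [← map_smul, h.smul_eq])
    exact ⟨c, h.hom_ext _ _ _ hc⟩

theorem projective (h : IsUniversal Q e d q) (he : e ∈ 𝒜 0) (he2 : e * e = e) : Projective Q where
  factors {E X} f p hp := by
    obtain ⟨y, hy, hyq⟩ := exists_mem_deg_of_surjective (surjective_of_epi p) (toLin_mem f h.mem)
    -- Multiplying the preimage by `e` makes it fixed by `e`; its image does not change, being fixed
    -- already.
    obtain ⟨l, hl⟩ := h.exists_hom E (e • y) (by simpa using E.smul_mem he hy)
      (by rw [smul_smul, he2])
    exact ⟨l, h.hom_ext _ _ _ (by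
      rw [toLin_comp, LinearMap.comp_apply, hl, map_smul, hyq, ← map_smul, h.smul_eq])⟩

/-- Both `P` and `Q` map to the one-dimensional module in degree `d`, by `t` and by the epimorphism
`π`. Projectivity of `P` lifts `t` to `r : P ⟶ Q`, and universality gives `s : Q ⟶ P` through `p`.
Since `t p = 1`, the composite `s ≫ r` fixes `q`, so `Q` splits off the indecomposable `P`. -/
theorem nonempty_iso (h : IsUniversal Q e d q) (hA : iSup 𝒜 = ⊤) (hneg : ∀ n < 0, 𝒜 n = ⊥)
    (ε : A →ₐ[k] k) (hε : ∀ n ≠ 0, ∀ a ∈ 𝒜 n, ε a = 0) (he1 : ε e = 1)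
    (he : ∀ a ∈ 𝒜 0, e * a = ε a • e) (P : GrMod 𝒜) (hP : Projective P) (hP' : Indecomposable P)
    (hPd : ∀ n < d, P.deg n = ⊥) {p : P} (hp : p ∈ P.deg d) (hep : e • p = p) (hp0 : p ≠ 0) :
    Nonempty (P ≅ Q) := by
  obtain ⟨l, hl, -⟩ := exists_dual_eq_one (k := k) (W := (⊥ : Submodule k P)) (v := p)
    (by simpa using hp0)
  -- This is the linearity of `t`. In degree `d` only the degree zero part of `A` contributes: its
  -- negative part vanishes, and its positive part would act on elements of `P` below `d`.
  have key : ∀ (a : A) (x : P), l (e • P.component d (a • x)) = ε a * l (e • P.component d x) := by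
    intro a x
    induction x using deg_induction with
    | zero => simp
    | add x y hx hy => simp only [smul_add, map_add, hx, hy, mul_add]
    | hom j x hx =>
      refine Submodule.iSup_induction 𝒜
        (motive := fun a => l (e • P.component d (a • x)) = ε a * l (e • P.component d x))
        (hA ▸ Submodule.mem_top : a ∈ iSup 𝒜) (fun i a ha => ?_) (by simp) (fun a b ha hb => ?_)
      · have hax := P.smul_mem ha hx
        by_cases hij : i + j = d
        · rw [component_self (hij ▸ hax)]
          rcases lt_trichotomy i 0 with hi | rfl | hi
          · rw [hneg i hi] at ha
            rw [(Submodule.mem_bot k).1 ha]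
            simp
          · rw [zero_add] at hij
            subst hij
            rw [component_self hx, smul_smul, he a ha, smul_assoc, map_smul, smul_eq_mul]
          · rw [hPd j (by omega)] at hx
            rw [(Submodule.mem_bot k).1 hx]
            simp
        · rw [component_of_ne hij hax]
          by_cases hj : j = d
          · rw [hε i (by omega) a ha]; simp
          · rw [component_of_ne hj hx]; simp
      · simp only [add_smul, map_add, smul_add, ha, hb, add_mul]
  let t : P ⟶ simple ε hε d := homMk
    { toFun := fun x => l (e • P.component d x)
      map_add' := fun x y => by rw [map_add, smul_add, map_add]; rfl
      map_smul' := key } fun n x hx => by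
        change l (e • P.component d x) ∈ ((if n = d then ⊤ else ⊥ : Submodule k k))
        split_ifs with hn
        · trivial
        · rw [component_of_ne hn hx]; simp
  obtain ⟨π, hπ⟩ := h.exists_hom (simple ε hε d) (1 : k)
    (show (1 : k) ∈ ((if d = d then ⊤ else ⊥ : Submodule k k)) by rw [if_pos rfl]; trivial)
    (show ε e * 1 = (1 : k) by rw [he1, mul_one])
  have hπe : Epi π := epi_of_surjective π fun (c : k) => ⟨c • q, by
    change (toLin π).restrictScalars k (c • q) = c
    rw [map_smul]
    change c * (show k from toLin π q) = c
    rw [hπ]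
    exact mul_one c⟩
  obtain ⟨r, hr⟩ := hP.factors t π
  obtain ⟨c, hc⟩ := h.exists_smul (toLin r p) (toLin_mem r hp) (by rw [← map_smul, hep])
  have hc1 : c = 1 := by
    have h1 : toLin t p = c • toLin π q := by
      rw [← hr, toLin_comp, LinearMap.comp_apply, hc]
      exact map_smul ((toLin π).restrictScalars k) c q
    have h2 : toLin t p = (1 : k) := by
      change l (e • P.component d p) = 1
      rw [component_self hp, hep, hl]
    rw [h2, hπ] at h1
    exact (h1.trans (mul_one c)).symm
  obtain ⟨s, hs⟩ := h.exists_hom P p hp hep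
  have : IsSplitMono s := IsSplitMono.mk' ⟨r, h.hom_ext _ _ _ (by
    rw [toLin_comp, LinearMap.comp_apply, hs, hc, hc1, one_smul]; rfl)⟩
  have := isIso_of_isSplitMono_of_indecomposable hP' h.isBrick.not_isZero s
  exact ⟨(asIso s).symm⟩

end IsUniversal

end Representable

end GrMod

/-! ### Indecomposable projectives over `R_m`. -/

section Projectives

variable {k : Type u} [Field k]

theorem polyDeg_eq_bot {n : ℤ} (hn : n < 0) : polyDeg k n = ⊥ := by
  rw [eq_bot_iff]
  intro p hp
  ext i
  by_contra h
  have := hp i h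
  omega

theorem eq_monomial_of_mem_polyDeg {i : ℕ} {p : k[X]} (hp : p ∈ polyDeg k i) :
    p = monomial i (p.coeff i) := by
  ext j
  rw [coeff_monomial]
  split_ifs with h
  · rw [h]
  · by_contra h'
    exact h (by exact_mod_cast (hp j h').symm)

theorem eq_C_of_mem_polyDeg_zero {p : k[X]} (hp : p ∈ polyDeg k 0) : p = C (p.coeff 0) :=
  eq_monomial_of_mem_polyDeg (i := 0) hp

theorem coeff_zero_of_mem_polyDeg {n : ℤ} (hn : n ≠ 0) {p : k[X]} (hp : p ∈ polyDeg k n) :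
    p.coeff 0 = 0 := by
  by_contra h
  exact hn (hp 0 h).symm

theorem RDeg_eq_bot (m : ℕ) {n : ℤ} (hn : n < 0) : RDeg k m n = ⊥ := by
  rw [eq_bot_iff]
  intro z hz
  have h1 := hz.1
  have h2 := hz.2
  rw [polyDeg_eq_bot hn] at h1 h2
  exact Subtype.ext (Prod.ext h1 h2)

theorem iSup_RDeg (m : ℕ) : iSup (RDeg k m) = ⊤ :=
  ((DirectSum.isInternal_submodule_iff_iSupIndep_and_iSup_eq_top _).1 (RDeg_isInternal m)).2

variable (k) in
/-- The augmentation of `R_m` given by the constant term of the `i`-th component. -/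
def augmentation (m : ℕ) (i : ZMod 2) : R k m →ₐ[k] k :=
  (Polynomial.aeval (0 : k)).comp ((proj k i).comp (R k m).val)

theorem augmentation_apply (m : ℕ) (i : ZMod 2) (z : R k m) :
    augmentation k m i z = (proj k i z).coeff 0 := by
  rw [coeff_zero_eq_aeval_zero]; rfl

theorem augmentation_of_ne (m : ℕ) (i : ZMod 2) : ∀ n ≠ 0, ∀ z ∈ RDeg k m n,
    augmentation k m i z = 0 := fun n hn z hz => by
  rw [augmentation_apply]
  exact coeff_zero_of_mem_polyDeg hn (proj_mem hz)

/-- A positive power of `x` divides the difference of the two components, so their constant terms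
agree. For `R_0` this fails, which is why that case is separate. -/
theorem eq_smul_one_of_mem_RDeg_zero {m : ℕ} {z : R k (m + 1)} (hz : z ∈ RDeg k (m + 1) 0) :
    z = (proj k 0 z).coeff 0 • (1 : R k (m + 1)) := by
  obtain ⟨h, hh⟩ := (mem_R_iff (m + 1) z.1).1 z.2
  have h1 := eq_C_of_mem_polyDeg_zero hz.1
  have h2 := eq_C_of_mem_polyDeg_zero hz.2
  have h3 : z.1.1.coeff 0 = z.1.2.coeff 0 := by
    have := congrArg (coeff · 0) hh
    simp only [coeff_sub, pow_succ', mul_assoc, coeff_X_mul_zero] at this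
    exact sub_eq_zero.1 this
  refine Subtype.ext (Prod.ext ?_ ?_)
  · change z.1.1 = z.1.1.coeff 0 • 1
    rw [smul_eq_C_mul, mul_one]; exact h1
  · change z.1.2 = z.1.1.coeff 0 • 1
    rw [smul_eq_C_mul, mul_one, h3]; exact h2

theorem regular_isUniversal (m : ℕ) (a : ℤ) :
    GrMod.IsUniversal ((regular k (m + 1)).shift a) 1 (-a) (1 : R k (m + 1)) where
  mem := by
    change (1 : R k (m + 1)) ∈ RDeg k (m + 1) (-a + a)
    rw [neg_add_cancel]
    exact ⟨monomial_mem_polyDeg 0 1, monomial_mem_polyDeg 0 1⟩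
  smul_eq := one_smul _ _
  ne_zero := (one_ne_zero : (1 : R k (m + 1)) ≠ 0)
  exists_smul x hx _ := by
    change (show R k (m + 1) from x) ∈ RDeg k (m + 1) (-a + a) at hx
    rw [neg_add_cancel] at hx
    exact ⟨_, eq_smul_one_of_mem_RDeg_zero hx⟩
  exists_hom P p hp _ := ⟨GrMod.homMk (LinearMap.toSpanSingleton (R k (m + 1)) P p) fun n x hx => by
    have := P.smul_mem hx hp
    rwa [add_neg_cancel_right] at this, one_smul _ _⟩
  hom_ext P f g h := by
    ext x
    have hx : x = (show R k (m + 1) from x) • (show (regular k (m + 1)).shift a from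
      (1 : R k (m + 1))) := (mul_one (show R k (m + 1) from x)).symm
    rw [hx, map_smul, map_smul]
    exact congrArg _ h

variable (k) in
/-- The idempotent of `R_0 = k[x] ⊕ k[x]` which is the unit of the `i`-th factor. -/
def idemR (i : ZMod 2) : R k 0 :=
  ⟨if i = 0 then (1, 0) else (0, 1), (mem_R_iff 0 _).2 (by rw [pow_zero]; exact one_dvd _)⟩

theorem proj_idemR (i j : ZMod 2) : proj k j (idemR k i) = if i = j then 1 else 0 := by
  have h : ∀ j : ZMod 2, j = 0 ∨ j = 1 := by decide
  have h1 : (1 : ZMod 2) ≠ 0 := by decide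
  obtain rfl | rfl := h i <;> obtain rfl | rfl := h j <;> simp [proj, idemR, h1, h1.symm]

theorem proj_mul {m : ℕ} (i : ZMod 2) (r s : R k m) :
    proj k i ((r * s : R k m) : k[X] × k[X]) = proj k i r * proj k i s :=
  map_mul (proj k i) (r : k[X] × k[X]) s

theorem R_ext {m : ℕ} {z w : R k m} (h : ∀ i, proj k i z = proj k i w) : z = w :=
  Subtype.ext (Prod.ext (h 0) (h 1))

theorem idemR_mem (i : ZMod 2) : idemR k i ∈ RDeg k 0 0 := by
  have h1 : (1 : k[X]) ∈ polyDeg k 0 := monomial_mem_polyDeg 0 1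
  change (if i = 0 then (1, 0) else (0, 1) : k[X] × k[X]) ∈ (polyDeg k 0).prod (polyDeg k 0)
  split_ifs
  exacts [⟨h1, zero_mem _⟩, ⟨zero_mem _, h1⟩]

theorem idemR_mul (i : ZMod 2) (z : R k 0) (hz : z ∈ RDeg k 0 0) :
    idemR k i * z = augmentation k 0 i z • idemR k i := by
  refine R_ext fun j => ?_
  have h : proj k j z = C ((proj k j z).coeff 0) := eq_C_of_mem_polyDeg_zero (proj_mem hz)
  change proj k j ((idemR k i : k[X] × k[X]) * z) =
    proj k j (augmentation k 0 i z • (idemR k i : k[X] × k[X]))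
  rw [map_mul, map_smul, proj_idemR, augmentation_apply]
  split_ifs with hij
  · subst hij
    rw [one_mul, smul_eq_C_mul, mul_one, ← h]
  · simp

theorem idemR_mul_self (i : ZMod 2) : idemR k i * idemR k i = idemR k i := by
  refine R_ext fun j => ?_
  rw [proj_mul, proj_idemR]
  split_ifs <;> simp

theorem factor_smul (i : ZMod 2) (a : ℤ) (r : R k 0) (p : k[X]) :
    (r • (show (factor k i).shift a from p) : (factor k i).shift a) = proj k i r * p := rfl

theorem factor_isUniversal (i : ZMod 2) (a : ℤ) :
    GrMod.IsUniversal ((factor k i).shift a) (idemR k i) (-a) (1 : k[X]) where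
  mem := by
    change (1 : k[X]) ∈ polyDeg k (-a + a)
    rw [neg_add_cancel]
    exact monomial_mem_polyDeg 0 1
  smul_eq := by
    rw [factor_smul, proj_idemR, if_pos rfl, one_mul]
  ne_zero := (one_ne_zero : (1 : k[X]) ≠ 0)
  exists_smul x hx _ := by
    change (show k[X] from x) ∈ polyDeg k (-a + a) at hx
    rw [neg_add_cancel] at hx
    refine ⟨(show k[X] from x).coeff 0, (eq_C_of_mem_polyDeg_zero hx).trans ?_⟩
    exact (mul_one _).symm.trans (smul_eq_C_mul (p := (1 : k[X])) _).symm
  exists_hom P p hp hep := by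
    -- As `p` is fixed by the idempotent, `R_0` acts on it only through the `i`-th component; this
    -- gives the `R_0`-linearity of the map below.
    have hmul : ∀ r s : R k 0, proj k i r = proj k i s → r • p = s • p := fun r s h => by
      rw [← hep, smul_smul, smul_smul]
      congr 1
      refine R_ext fun j => ?_
      rw [proj_mul, proj_mul, proj_idemR]
      split_ifs with hij
      · rw [← hij, h]
      · rw [mul_zero, mul_zero]
    refine ⟨GrMod.homMk
      { toFun := fun x => diag k 0 (show k[X] from x) • p
        map_add' := fun (x y : k[X]) => by
          change diag k 0 (x + y) • p = diag k 0 x • p + diag k 0 y • p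
          rw [map_add, add_smul]
        map_smul' := fun r (x : k[X]) => ?_ } fun n x hx => ?_, ?_⟩
    · change diag k 0 (proj k i r * x) • p = r • diag k 0 x • p
      rw [smul_smul]
      refine hmul _ _ ?_
      rw [proj_mul, proj_diag, proj_diag]
    · have := P.smul_mem (diag_mem_RDeg (m := 0) (show (show k[X] from x) ∈ polyDeg k (n + a) from hx)) hp
      rwa [add_neg_cancel_right] at this
    · change diag k 0 (1 : k[X]) • p = p
      rw [map_one, one_smul]
  hom_ext P f g h := by
    ext x
    have hx : x = diag k 0 (show k[X] from x) • (show (factor k i).shift a from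
      (1 : k[X])) := by
      rw [factor_smul, proj_diag, mul_one]
    rw [hx, map_smul, map_smul]
    exact congrArg _ h

theorem StartsAt.of_iso {m : ℕ} {P Q : GrR k m} (e : P ≅ Q) {d : ℤ} (hQ : Q.StartsAt d) :
    P.StartsAt d := by
  have h : ∀ n, P.deg n = ⊥ ↔ Q.deg n = ⊥ := fun n => by
    have key : ∀ {P Q : GrR k m} (e : P ≅ Q), Q.deg n = ⊥ → P.deg n = ⊥ := fun {P Q} e hQ => by
      rw [eq_bot_iff] at hQ ⊢
      intro x hx
      have h1 : GrMod.toLin e.hom x = 0 := hQ (GrMod.toLin_mem e.hom hx)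
      have h2 := LinearMap.congr_fun (congrArg GrMod.toLin e.hom_inv_id) x
      rw [GrMod.toLin_comp, LinearMap.comp_apply, h1, map_zero] at h2
      exact h2.symm
    exact ⟨key e.symm, key e⟩
  exact ⟨fun h' => hQ.1 ((h d).1 h'), fun n hn => (h n).2 (hQ.2 n hn)⟩

theorem GrMod.IsUniversal.nonempty_iso_of_augmentation {m : ℕ} {Q : GrR k m} {e : R k m} {d : ℤ}
    {q : Q} (h : IsUniversal Q e d q) (i : ZMod 2) (he1 : augmentation k m i e = 1)
    (he : ∀ z ∈ RDeg k m 0, e * z = augmentation k m i z • e) (P : GrR k m) (hP : Projective P)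
    (hP' : Indecomposable P) (hPd : ∀ n < d, P.deg n = ⊥) {p : P} (hp : p ∈ P.deg d)
    (hep : e • p = p) (hp0 : p ≠ 0) : Nonempty (P ≅ Q) :=
  h.nonempty_iso (iSup_RDeg m) (fun _ hn => RDeg_eq_bot m hn) (augmentation k m i)
    (augmentation_of_ne m i) he1 he P hP hP' hPd hp hep hp0

theorem projective_indecomposable_iff_regular (m : ℕ) (a : ℤ) (P : GrR k (m + 1)) :
    (Projective P ∧ Indecomposable P ∧ P.StartsAt (-a)) ↔
      Nonempty (P ≅ (regular k (m + 1)).shift a) := by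
  have hU := regular_isUniversal (k := k) m a
  constructor
  · rintro ⟨hP, hP', hPa, hPa'⟩
    obtain ⟨p, hp, hp0⟩ := Submodule.exists_mem_ne_zero_of_ne_bot hPa
    refine hU.nonempty_iso_of_augmentation 0 (map_one _) (fun z hz => ?_) P hP hP' hPa' hp
      (one_smul _ _) hp0
    rw [one_mul, augmentation_apply]
    exact eq_smul_one_of_mem_RDeg_zero hz
  · rintro ⟨e⟩
    refine ⟨(hU.projective ⟨monomial_mem_polyDeg 0 1, monomial_mem_polyDeg 0 1⟩
      (one_mul 1)).of_iso e.symm, (hU.isBrick.of_iso e.symm).indecomposable,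
      StartsAt.of_iso e ⟨?_, fun n hn => RDeg_eq_bot (k := k) (m + 1) (n := n + a) (by omega)⟩⟩
    exact (Submodule.ne_bot_iff _).2 ⟨_, hU.mem, hU.ne_zero⟩

theorem factor_startsAt (i : ZMod 2) (a : ℤ) : ((factor k i).shift a).StartsAt (-a) :=
  ⟨(Submodule.ne_bot_iff _).2 ⟨_, (factor_isUniversal i a).mem, (factor_isUniversal i a).ne_zero⟩,
    fun n hn => polyDeg_eq_bot (k := k) (n := n + a) (by omega)⟩

theorem projective_indecomposable_iff_factor (a : ℤ) (P : GrR k 0) :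
    (Projective P ∧ Indecomposable P ∧ P.StartsAt (-a)) ↔
      ∃ i : ZMod 2, Nonempty (P ≅ (factor k i).shift a) := by
  constructor
  · rintro ⟨hP, hP', hPa, hPa'⟩
    obtain ⟨p, hp, hp0⟩ := Submodule.exists_mem_ne_zero_of_ne_bot hPa
    have hsum : idemR k 0 + idemR k 1 = 1 := by
      refine Subtype.ext (Prod.ext ?_ ?_) <;> simp [idemR]
    -- The two idempotents sum to `1`, so one of them does not kill the lowest element. This one
    -- decides the factor.
    have hi : ∃ i, idemR k i • p ≠ 0 := by
      by_contra! h
      exact hp0 (by rw [← one_smul (R k 0) p, ← hsum, add_smul, h, h, add_zero])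
    obtain ⟨i, hi⟩ := hi
    have h1 : augmentation k 0 i (idemR k i) = 1 := by
      rw [augmentation_apply, proj_idemR, if_pos rfl, coeff_one_zero]
    refine ⟨i, (factor_isUniversal i a).nonempty_iso_of_augmentation i h1 (idemR_mul i) P hP hP'
      hPa' (p := idemR k i • p) ?_ ?_ hi⟩
    · simpa using P.smul_mem (idemR_mem i) hp
    · rw [smul_smul, idemR_mul_self]
  · rintro ⟨i, ⟨e⟩⟩
    have hU := factor_isUniversal (k := k) i a
    exact ⟨(hU.projective (idemR_mem i) (idemR_mul_self i)).of_iso e.symm,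
      (hU.isBrick.of_iso e.symm).indecomposable, StartsAt.of_iso e (factor_startsAt i a)⟩

end Projectives

/-! ### Dehomogenization: graded modules as filtered vector spaces. -/

section Dehomogenization

variable {k : Type u} [Field k]

theorem map_smul_of_map_X_smul {M N : Type*} [AddCommGroup M] [Module k M] [Module k[X] M]
    [IsScalarTower k k[X] M] [AddCommGroup N] [Module k N] [Module k[X] N]
    [IsScalarTower k k[X] N] (f : M →ₗ[k] N) (h : ∀ m, f ((X : k[X]) • m) = (X : k[X]) • f m)
    (p : k[X]) (m : M) : f (p • m) = p • f m := by
  induction p using Polynomial.induction_on' with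
  | add p q hp hq => rw [add_smul, add_smul, map_add, hp, hq]
  | monomial n c =>
    rw [← C_mul_X_pow_eq_monomial, ← smul_eq_C_mul, smul_assoc, smul_assoc, map_smul]
    congr 1
    induction n with
    | zero => simp
    | succ n ih => rw [pow_succ', mul_smul, mul_smul, h, ih]

theorem locMk_congr {M : GrPoly k} {n : ℕ} {x y : M} (h : x = y) (hx : x ∈ M.deg n)
    (hy : y ∈ M.deg n) : locMk n x hx = locMk n y hy := by
  subst h; rfl

theorem locMk_add {M : GrPoly k} {n : ℕ} {x y : M} (hx : x ∈ M.deg n) (hy : y ∈ M.deg n) :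
    locMk n (x + y) (add_mem hx hy) = locMk n x hx + locMk n y hy := by
  refine Subtype.ext ?_
  change LocalizedModule.mk _ _ = LocalizedModule.mk _ _ + LocalizedModule.mk _ _
  rw [LocalizedModule.mk_add_mk, ← smul_add, LocalizedModule.mk_cancel_common_left]

theorem locMk_smul {M : GrPoly k} {n : ℕ} {x : M} (c : k) (hx : x ∈ M.deg n) :
    locMk n (c • x) ((M.deg n).smul_mem c hx) = c • locMk n x hx :=
  Subtype.ext (LocalizedModule.smul'_mk c x _).symm

theorem X_pow_smul_mem {M : GrPoly k} {n : ℤ} {x : M} (hx : x ∈ M.deg n) {m : ℤ} (j : ℕ)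
    (h : n + j = m) : (X ^ j : k[X]) • x ∈ M.deg m := by
  rw [← h, add_comm]
  exact M.smul_mem (X_pow_mem_polyDeg j) hx

theorem X_smul_mem {M : GrPoly k} {n : ℤ} {x : M} (hx : x ∈ M.deg n) {m : ℤ}
    (h : n + 1 = m) : (X : k[X]) • x ∈ M.deg m := by
  rw [← h, add_comm]
  exact M.smul_mem X_mem_polyDeg hx

theorem locMk_X_pow_smul {M : GrPoly k} {n m : ℕ} {x : M} (hx : x ∈ M.deg n) (j : ℕ)
    (h : n + j = m) :
    locMk m ((X ^ j : k[X]) • x) (X_pow_smul_mem hx j (by exact_mod_cast h)) = locMk n x hx := by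
  subst h
  refine Subtype.ext ?_
  change LocalizedModule.mk _ _ = LocalizedModule.mk _ _
  have : xPow k (n + j) = xPow k j * xPow k n := Subtype.ext ((pow_add _ _ _).trans (mul_comm _ _))
  rw [this]
  exact LocalizedModule.mk_cancel_common_left (xPow k j) _ _

/-- The dehomogenization `M → (M_x)_0`, which sends `m` of degree `n` to `m / x ^ n`. -/
def dehom (M : GrPoly k) : M →ₗ[k] locZero M :=
  M.liftDeg fun n =>
    -- An element of negative degree is first moved to degree zero by a power of `x`, since the
    -- fractions have natural exponents.
    { toFun := fun x => locMk n.toNat ((X ^ (-n).toNat : k[X]) • x.1)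
        (X_pow_smul_mem x.2 _ (by omega))
      map_add' := fun x y => by
        rw [← locMk_add]
        exact locMk_congr (smul_add _ _ _) _ _
      map_smul' := fun c x => by
        rw [RingHom.id_apply, ← locMk_smul]
        exact locMk_congr (smul_comm _ _ _) _ _ }

theorem dehom_of_mem {M : GrPoly k} {n : ℤ} {x : M} (hx : x ∈ M.deg n) :
    dehom M x = locMk n.toNat ((X ^ (-n).toNat : k[X]) • x) (X_pow_smul_mem hx _ (by omega)) :=
  GrMod.liftDeg_of_mem _ hx

theorem dehom_natCast {M : GrPoly k} {n : ℕ} {x : M} (hx : x ∈ M.deg n) :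
    dehom M x = locMk n x hx := by
  rw [dehom_of_mem hx]
  exact locMk_congr (by simp) _ _

theorem dehom_X_smul {M : GrPoly k} (x : M) : dehom M ((X : k[X]) • x) = dehom M x := by
  induction x using GrMod.deg_induction with
  | zero => simp
  | add x y hx hy => rw [smul_add, map_add, map_add, hx, hy]
  | hom n x hx =>
    rw [dehom_of_mem hx, dehom_of_mem (X_smul_mem hx rfl)]
    rcases le_or_gt 0 n with hn | hn
    · have h1 : (-n).toNat = 0 := by omega
      have h2 : (-(n + 1)).toNat = 0 := by omega
      rw [← locMk_X_pow_smul (n := n.toNat) (m := (n + 1).toNat) _ 1 (by omega)]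
      exact locMk_congr (by rw [h1, h2]; simp) _ _
    · have h1 : (-n).toNat = (-(n + 1)).toNat + 1 := by omega
      rw [← locMk_X_pow_smul (n := n.toNat) (m := (n + 1).toNat) _ 0 (by omega)]
      exact locMk_congr (by simp [h1, pow_succ, mul_smul]) _ _

theorem dehom_X_pow_smul {M : GrPoly k} (j : ℕ) (x : M) :
    dehom M ((X ^ j : k[X]) • x) = dehom M x := by
  induction j with
  | zero => simp
  | succ j ih => rw [pow_succ', mul_smul, dehom_X_smul, ih]

/-- Forming `m / x ^ n` amounts to setting `x = 1`. -/
theorem dehom_smul {M : GrPoly k} (p : k[X]) (x : M) :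
    dehom M (p • x) = p.eval 1 • dehom M x := by
  induction p using Polynomial.induction_on' with
  | add p q hp hq => rw [add_smul, map_add, hp, hq, eval_add, add_smul]
  | monomial n c =>
    rw [← C_mul_X_pow_eq_monomial, ← smul_eq_C_mul, smul_assoc, map_smul, dehom_X_pow_smul]
    simp

theorem locMap_dehom {M N : GrPoly k} (f : M ⟶ N) (x : M) :
    locMap f (dehom M x) = dehom N (GrMod.toLin f x) := by
  induction x using GrMod.deg_induction with
  | zero => simp
  | add x y hx hy => simp only [map_add, hx, hy]
  | hom n x hx =>
    rw [dehom_of_mem hx, dehom_of_mem (GrMod.toLin_mem f hx), locMap_mk]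
    exact locMk_congr (map_smul _ _ _) _ _

theorem exists_dehom_eq {M : GrPoly k} (z : locZero M) (N : ℕ) :
    ∃ n : ℕ, N ≤ n ∧ ∃ x ∈ M.deg n, dehom M x = z := by
  induction z using locZero_ind with | h n m hm => ?_
  refine ⟨n + N, by omega, _, X_pow_smul_mem hm N rfl, ?_⟩
  rw [dehom_X_pow_smul, dehom_natCast hm]

theorem dehom_surjective (M : GrPoly k) : Function.Surjective (dehom M) := fun z =>
  let ⟨_, _, x, _, h⟩ := exists_dehom_eq z 0
  ⟨x, h⟩

theorem locZero_linearMap_ext {M : GrPoly k} {N : Type*} [AddCommGroup N] [Module k N]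
    {f g : locZero M →ₗ[k] N} (h : ∀ n, ∀ x ∈ M.deg n, f (dehom M x) = g (dehom M x)) : f = g :=
  LinearMap.ext fun z => let ⟨_, _, x, hx, hz⟩ := exists_dehom_eq z 0
    hz ▸ h _ x hx

/-- A fraction vanishes only if a power of `x` kills its numerator. Homogeneity matters: `(x - 1) m`
always dehomogenizes to zero. -/
theorem eq_zero_of_dehom_eq_zero {M : GrPoly k} (hM : ∀ m : M, (X : k[X]) • m = 0 → m = 0) {n : ℤ}
    {x : M} (hx : x ∈ M.deg n) (h : dehom M x = 0) : x = 0 := by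
  have hpow : ∀ (j : ℕ) (y : M), (X ^ j : k[X]) • y = 0 → y = 0 := fun j => by
    induction j with
    | zero => simp
    | succ j ih =>
      intro y hy
      rw [pow_succ', mul_smul] at hy
      exact ih y (hM _ hy)
  rw [dehom_of_mem hx] at h
  have h1 := congrArg Subtype.val h
  obtain ⟨⟨_, j, rfl⟩, hj⟩ := LocalizedModule.mk_eq.1 (h1.trans (LocalizedModule.zero_mk 1).symm)
  rw [one_smul, smul_zero, smul_zero] at hj
  exact hpow _ _ (hpow j _ hj)

/-- The subspace of `(M_x)_0` of the fractions `m / x ^ n` with `m` in `M` of degree `n`. -/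
def stage (M : GrPoly k) (n : ℤ) : Submodule k (locZero M) := (M.deg n).map (dehom M)

theorem dehom_mem_stage {M : GrPoly k} {n : ℤ} {x : M} (hx : x ∈ M.deg n) :
    dehom M x ∈ stage M n := ⟨x, hx, rfl⟩

theorem stage_mono (M : GrPoly k) : Monotone (stage M) := by
  rintro m n hmn _ ⟨x, hx, rfl⟩
  exact ⟨_, X_pow_smul_mem hx (n - m).toNat (by omega), dehom_X_pow_smul _ _⟩

/-- The functional `m / x ^ n ↦ θ(m)(1)` on `(M_x)_0`. -/
def evalOne {M : GrPoly k} (θ : M →ₗ[k[X]] k[X]) : locZero M →ₗ[k] k where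
  toFun z := z.1.liftOn (fun p => (θ p.1).eval 1) <| by
    rintro ⟨m, s⟩ ⟨m', s'⟩ ⟨t, ht⟩
    have h1 : ∀ s : Submonoid.powers (X : k[X]), (s : k[X]).eval 1 = 1 := by
      rintro ⟨_, j, rfl⟩; simp
    have := congrArg (fun x => (θ x).eval 1) ht
    simpa [Submonoid.smul_def, h1] using this
  map_add' z w := by
    induction z using locZero_ind with | h n m hm => ?_
    induction w using locZero_ind with | h n' m' hm' => ?_
    change LocalizedModule.liftOn (LocalizedModule.mk _ _ + LocalizedModule.mk _ _) _ _ = _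
    rw [LocalizedModule.mk_add_mk]
    change (θ ((X ^ n' : k[X]) • m + (X ^ n : k[X]) • m')).eval 1 = (θ m).eval 1 + (θ m').eval 1
    simp
  map_smul' c z := by
    induction z using locZero_ind with | h n m hm => ?_
    change LocalizedModule.liftOn (c • LocalizedModule.mk _ _) _ _ = _
    rw [LocalizedModule.smul'_mk]
    change (θ (c • m)).eval 1 = c * (θ m).eval 1
    rw [LinearMap.map_smul_of_tower, eval_smul, smul_eq_mul]

theorem evalOne_dehom {M : GrPoly k} (θ : M →ₗ[k[X]] k[X]) (x : M) :
    evalOne θ (dehom M x) = (θ x).eval 1 := by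
  induction x using GrMod.deg_induction with
  | zero => simp
  | add x y hx hy => simp only [map_add, hx, hy, eval_add]
  | hom n x hx =>
    rw [dehom_of_mem hx]
    change (θ _).eval 1 = _
    simp

/-- The homogenization of a functional `μ` on `(M_x)_0`: the map which sends `m` of degree `n` to
`μ(m / x ^ n) x ^ (n + a)`. -/
def homogenize (M : GrPoly k) (μ : locZero M →ₗ[k] k) (a : ℤ) (hμ : ∀ z ∈ stage M (-a - 1), μ z = 0) :
    M →ₗ[k[X]] k[X] :=
  let f : M →ₗ[k] k[X] := M.liftDeg fun n =>
    ((monomial (n + a).toNat).comp (μ.comp (dehom M))).comp (M.deg n).subtype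
  { f with
    map_smul' := map_smul_of_map_X_smul f fun x => by
      induction x using GrMod.deg_induction with
      | zero => simp
      | add x y hx hy => simp only [map_add, smul_add, hx, hy]
      | hom n x hx =>
        rw [GrMod.liftDeg_of_mem _ hx, GrMod.liftDeg_of_mem _ (X_smul_mem hx rfl)]
        change monomial _ (μ (dehom M ((X : k[X]) • x))) = (X : k[X]) * monomial _ (μ (dehom M x))
        rw [dehom_X_smul, X_mul_monomial]
        -- Below degree `-a` the exponent is truncated to zero and compatibility with `x` could
        -- fail; there `μ` vanishes by `hμ`.
        rcases lt_or_ge n (-a) with h | h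
        · rw [hμ _ (stage_mono M (by omega : n ≤ -a - 1) (dehom_mem_stage hx))]
          simp
        · rw [show (n + 1 + a).toNat = (n + a).toNat + 1 by omega] }

theorem homogenize_of_mem {M : GrPoly k} {μ : locZero M →ₗ[k] k} {a : ℤ}
    (hμ : ∀ z ∈ stage M (-a - 1), μ z = 0) {n : ℤ} {x : M} (hx : x ∈ M.deg n) :
    homogenize M μ a hμ x = monomial (n + a).toNat (μ (dehom M x)) :=
  GrMod.liftDeg_of_mem _ hx

theorem homogenize_mem {M : GrPoly k} {μ : locZero M →ₗ[k] k} {a : ℤ}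
    (hμ : ∀ z ∈ stage M (-a - 1), μ z = 0) {n : ℤ} {x : M} (hx : x ∈ M.deg n) :
    homogenize M μ a hμ x ∈ polyDeg k (n + a) := by
  rw [homogenize_of_mem hμ hx]
  rcases lt_or_ge n (-a) with h | h
  · rw [hμ _ (stage_mono M (by omega : n ≤ -a - 1) (dehom_mem_stage hx)), map_zero]
    exact zero_mem _
  · have := monomial_mem_polyDeg (n + a).toNat (μ (dehom M x))
    rwa [Int.toNat_of_nonneg (by omega)] at this

theorem evalOne_homogenize {M : GrPoly k} {μ : locZero M →ₗ[k] k} {a : ℤ}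
    (hμ : ∀ z ∈ stage M (-a - 1), μ z = 0) (x : M) :
    (homogenize M μ a hμ x).eval 1 = μ (dehom M x) := by
  induction x using GrMod.deg_induction with
  | zero => simp
  | add x y hx hy => simp only [map_add, eval_add, hx, hy]
  | hom n x hx => rw [homogenize_of_mem hμ hx]; simp

/-- The elements without components below `-j` form an ascending chain of submodules, which
stabilizes because `M` is noetherian. Every homogeneous element lies in some member of the chain. -/
theorem exists_deg_eq_bot (M : GrPoly k) : ∃ b : ℤ, ∀ n < b, M.deg n = ⊥ := by
  let N : ℕ →o Submodule k[X] M :=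
    { toFun := fun j =>
        { carrier := {x | ∀ n : ℤ, n < -j → M.component n x = 0}
          add_mem' := fun hx hy n hn => by rw [map_add, hx n hn, hy n hn, add_zero]
          zero_mem' := fun n _ => map_zero _
          smul_mem' := fun p x hx => by
            have hX : ∀ (x : M) (n : ℤ), M.component n ((X : k[X]) • x) =
                (X : k[X]) • M.component (n - 1) x := fun x n => by
              induction x using GrMod.deg_induction with
              | zero => simp
              | add x y hx hy => simp only [map_add, smul_add, hx, hy]
              | hom m x hx =>
                by_cases h : m = n - 1
                · rw [GrMod.component_self (X_smul_mem hx (by omega)), ← h,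
                    GrMod.component_self hx]
                · rw [GrMod.component_of_ne h hx, GrMod.component_of_ne (m := m + 1) (by omega)
                    (X_smul_mem hx rfl), smul_zero]
            have key : ∀ (i : ℕ) (n : ℤ), n < -j → M.component n ((X ^ i : k[X]) • x) = 0 := by
              intro i
              induction i with
              | zero => simpa using hx
              | succ i ih =>
                intro n hn
                rw [pow_succ', mul_smul, hX, ih (n - 1) (by omega), smul_zero]
            intro n hn
            induction p using Polynomial.induction_on' with
            | add p q hp hq => rw [add_smul, map_add, hp, hq, add_zero]
            | monomial i c =>
              rw [← C_mul_X_pow_eq_monomial, ← smul_eq_C_mul, smul_assoc, map_smul, key i n hn,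
                smul_zero] }
      monotone' := fun i j hij x hx n hn => hx n (by omega) }
  obtain ⟨j, hj⟩ := monotone_stabilizes_iff_noetherian.2 (inferInstanceAs (IsNoetherian k[X] M)) N
  refine ⟨-j, fun n hn => ?_⟩
  rw [eq_bot_iff]
  intro x hx
  have h1 : x ∈ N (max j (-n).toNat) := fun n' hn' => by
    refine GrMod.component_of_ne (m := n) ?_ hx
    rintro rfl
    have := le_max_right j (-n).toNat
    omega
  rw [← hj _ (le_max_left _ _)] at h1
  rw [Submodule.mem_bot, ← GrMod.component_self hx]
  exact h1 n hn

end Dehomogenization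

/-! ### The category `𝒞`: projections, exactness, splitting of idempotents. -/

section Objects

variable {k : Type u} [Field k]

theorem zmod_two_cases (i : ZMod 2) : i = 0 ∨ i = 1 := by revert i; decide

namespace Obj

/-- The projection of `(M_x)_0` onto the subspace corresponding to `V₀` under `φ`. -/
def pr₀ (P : Obj k) : locZero P.M →ₗ[k] locZero P.M :=
  P.φ.symm.toLinearMap ∘ₗ (LinearMap.inl k P.V₀ P.V₁ ∘ₗ LinearMap.fst k P.V₀ P.V₁) ∘ₗ
    P.φ.toLinearMap

/-- The projection of `(M_x)_0` onto the subspace corresponding to `V_i` under `φ`. -/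
def pr (P : Obj k) (i : ZMod 2) : locZero P.M →ₗ[k] locZero P.M :=
  if i = 0 then P.pr₀ else LinearMap.id - P.pr₀

theorem φ_pr₀ (P : Obj k) (z : locZero P.M) : P.φ (P.pr₀ z) = ((P.φ z).1, 0) :=
  P.φ.apply_symm_apply _

theorem pr₀_pr₀ (P : Obj k) (z : locZero P.M) : P.pr₀ (P.pr₀ z) = P.pr₀ z :=
  P.φ.injective (by rw [φ_pr₀, φ_pr₀])

theorem pr_zero (P : Obj k) (z : locZero P.M) : P.pr 0 z = P.pr₀ z := rfl

theorem pr_one (P : Obj k) (z : locZero P.M) : P.pr 1 z = z - P.pr₀ z := by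
  rw [pr, if_neg (by decide)]; rfl

theorem pr_pr (P : Obj k) (i j : ZMod 2) (z : locZero P.M) :
    P.pr i (P.pr j z) = if i = j then P.pr i z else 0 := by
  have h1 : (1 : ZMod 2) ≠ 0 := by decide
  obtain rfl | rfl := zmod_two_cases i <;> obtain rfl | rfl := zmod_two_cases j <;>
    simp [pr_zero, pr_one, pr₀_pr₀, h1, h1.symm]

theorem pr_self (P : Obj k) (i : ZMod 2) (z : locZero P.M) : P.pr i (P.pr i z) = P.pr i z := by
  rw [pr_pr, if_pos rfl]

theorem pr_add (P : Obj k) (i : ZMod 2) (z : locZero P.M) : P.pr i z + P.pr (1 - i) z = z := by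
  obtain rfl | rfl := zmod_two_cases i
  · rw [sub_zero, pr_zero, pr_one]; abel
  · rw [sub_self, pr_zero, pr_one]; abel

theorem locMap_pr₀ {P Q : Obj k} (f : P ⟶ Q) (z : locZero P.M) :
    locMap (res f) (P.pr₀ z) = Q.pr₀ (locMap (res f) z) := by
  apply Q.φ.injective
  rw [hom_comm, φ_pr₀, φ_pr₀, hom_comm, map_zero]

theorem locMap_pr {P Q : Obj k} (f : P ⟶ Q) (i : ZMod 2) (z : locZero P.M) :
    locMap (res f) (P.pr i z) = Q.pr i (locMap (res f) z) := by
  obtain rfl | rfl := zmod_two_cases i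
  · exact locMap_pr₀ f z
  · rw [pr_one, pr_one, map_sub, locMap_pr₀]

/-- The morphism given by a morphism of graded modules which respects the decompositions. -/
def homMk {P Q : Obj k} (f : P.M ⟶ Q.M) (h : ∀ z, locMap f (P.pr₀ z) = Q.pr₀ (locMap f z)) :
    P ⟶ Q :=
  ⟨(f, LinearMap.fst k _ _ ∘ₗ Q.φ.toLinearMap ∘ₗ locMap f ∘ₗ P.φ.symm.toLinearMap ∘ₗ
      LinearMap.inl k _ _,
    LinearMap.snd k _ _ ∘ₗ Q.φ.toLinearMap ∘ₗ locMap f ∘ₗ P.φ.symm.toLinearMap ∘ₗ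
      LinearMap.inr k _ _), fun z => by
    have h0 : P.φ.symm ((P.φ z).1, 0) = P.pr₀ z := rfl
    have h1 : P.φ.symm (0, (P.φ z).2) = z - P.pr₀ z := by
      apply P.φ.injective
      rw [LinearEquiv.apply_symm_apply, map_sub, φ_pr₀]
      simp [Prod.ext_iff]
    refine Prod.ext ?_ ?_
    · change _ = (Q.φ (locMap f (P.φ.symm ((P.φ z).1, 0)))).1
      rw [h0, h, φ_pr₀]
    · change _ = (Q.φ (locMap f (P.φ.symm (0, (P.φ z).2)))).2
      rw [h1, map_sub, h, map_sub, φ_pr₀]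
      simp⟩

/-- As `φ` is bijective, the linear components are read off from the map on the localization. A
morphism of `𝒞` is thus a graded map commuting with the projections. -/
theorem res_injective {P Q : Obj k} {f g : P ⟶ Q} (h : res f = res g) : f = g := by
  refine hom_ext' h (LinearMap.ext fun v => ?_) (LinearMap.ext fun v => ?_)
  · have h1 := hom_comm f (P.φ.symm (v, 0))
    rw [h, hom_comm g, LinearEquiv.apply_symm_apply] at h1
    exact (congrArg Prod.fst h1).symm
  · have h1 := hom_comm f (P.φ.symm (0, v))
    rw [h, hom_comm g, LinearEquiv.apply_symm_apply] at h1
    exact (congrArg Prod.snd h1).symm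

/-- The `k[x]`-linear map underlying a morphism of `𝒞`. -/
def lin {P Q : Obj k} (f : P ⟶ Q) : P.M →ₗ[k[X]] Q.M := GrMod.toLin (res f)

theorem lin_mem {P Q : Obj k} (f : P ⟶ Q) {n : ℤ} {x : P.M} (hx : x ∈ P.M.deg n) :
    lin f x ∈ Q.M.deg n := GrMod.toLin_mem (res f) hx

@[ext] theorem hom_ext {P Q : Obj k} {f g : P ⟶ Q} (h : ∀ x, lin f x = lin g x) : f = g :=
  res_injective (GrMod.hom_ext h)

theorem hom_ext_deg {P Q : Obj k} {f g : P ⟶ Q} (h : ∀ n, ∀ x ∈ P.M.deg n, lin f x = lin g x) :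
    f = g := res_injective (GrMod.hom_ext_deg h)

@[simp] theorem lin_id_apply {P : Obj k} (x : P.M) : lin (𝟙 P) x = x := rfl
@[simp] theorem lin_comp_apply {P Q S : Obj k} (f : P ⟶ Q) (g : Q ⟶ S) (x : P.M) :
    lin (f ≫ g) x = lin g (lin f x) := rfl
@[simp] theorem lin_zero_apply {P Q : Obj k} (x : P.M) : lin (0 : P ⟶ Q) x = 0 := rfl
@[simp] theorem lin_add_apply {P Q : Obj k} (f g : P ⟶ Q) (x : P.M) :
    lin (f + g) x = lin f x + lin g x := rfl
@[simp] theorem lin_neg_apply {P Q : Obj k} (f : P ⟶ Q) (x : P.M) :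
    lin (-f) x = -lin f x := by
  rw [eq_neg_iff_add_eq_zero, ← lin_add_apply, neg_add_cancel, lin_zero_apply]

theorem locMap_res_dehom {P Q : Obj k} (f : P ⟶ Q) (x : P.M) :
    locMap (res f) (dehom P.M x) = dehom Q.M (lin f x) := locMap_dehom _ _

theorem locMap_injective {M N : GrPoly k} (f : M ⟶ N) (hf : Function.Injective (GrMod.toLin f)) :
    Function.Injective (locMap f) := fun _ _ h =>
  Subtype.ext (IsLocalizedModule.map_injective (Submonoid.powers (X : k[X]))
    (LocalizedModule.mkLinearMap _ _) (LocalizedModule.mkLinearMap _ _) (GrMod.toLin f) hf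
    (congrArg Subtype.val h))

/-- Exactness of a sequence of objects of `𝒞` can be checked on the underlying modules. -/
theorem exists_lift_of_exact {A B C Y : Obj k} {f : A ⟶ B} {g : B ⟶ C}
    (hf : Function.Injective (lin f)) (hfg : ∀ y, lin g y = 0 → ∃ x, lin f x = y) (l : Y ⟶ B)
    (hl : l ≫ g = 0) : ∃ t : Y ⟶ A, t ≫ f = l := by
  have h1 : ∀ y, lin l y ∈ LinearMap.range (lin f) := fun y =>
    hfg _ (by rw [← lin_comp_apply, hl]; rfl)
  let e := LinearEquiv.ofInjective (lin f) hf
  let t : Y.M →ₗ[k[X]] A.M := e.symm.toLinearMap ∘ₗ (lin l).codRestrict _ h1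
  have ht : ∀ y, lin f (t y) = lin l y := fun y =>
    congrArg Subtype.val (e.apply_symm_apply ((lin l).codRestrict _ h1 y))
  let t' : Y.M ⟶ A.M := GrMod.homMk t fun n y hy => GrMod.mem_deg_of_injective hf (by
    change lin f (t y) ∈ _
    rw [ht]
    exact lin_mem l hy)
  have ht' : t' ≫ res f = res l := GrMod.hom_ext ht
  refine ⟨homMk t' fun z => locMap_injective (res f) hf ?_, res_injective ht'⟩
  rw [locMap_pr₀, locMap_locMap, locMap_locMap, ht', locMap_pr₀]

/-- The module map descends to the quotient. It respects the projections because the localization of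
`g` is surjective, so this can be checked on `B`. -/
theorem exists_desc_of_exact {A B C Y : Obj k} {f : A ⟶ B} {g : B ⟶ C}
    (hg : Function.Surjective (lin g)) (hfg : ∀ y, lin g y = 0 → ∃ x, lin f x = y) (l : B ⟶ Y)
    (hl : f ≫ l = 0) : ∃ t : C ⟶ Y, g ≫ t = l := by
  have h1 : LinearMap.ker (lin g) ≤ LinearMap.ker (lin l) := fun y hy => by
    obtain ⟨x, rfl⟩ := hfg y hy
    rw [LinearMap.mem_ker, ← lin_comp_apply, hl]; rfl
  let e := (lin g).quotKerEquivOfSurjective hg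
  let t : C.M →ₗ[k[X]] Y.M := (Submodule.liftQ _ (lin l) h1) ∘ₗ e.symm.toLinearMap
  have ht : ∀ y, t (lin g y) = lin l y := fun y => by
    have : e.symm (lin g y) = Submodule.Quotient.mk y := (LinearEquiv.symm_apply_eq _).2 rfl
    change Submodule.liftQ _ (lin l) h1 (e.symm (lin g y)) = _
    rw [this]; rfl
  let t' : C.M ⟶ Y.M := GrMod.homMk t fun n y hy => by
    obtain ⟨x, hx, rfl⟩ := GrMod.exists_mem_deg_of_surjective hg hy
    change t (lin g x) ∈ _
    rw [ht]
    exact lin_mem l hx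
  have ht' : res g ≫ t' = res l := GrMod.hom_ext ht
  have hgs : Function.Surjective (locMap (res g)) := fun z => by
    obtain ⟨y, rfl⟩ := dehom_surjective _ z
    obtain ⟨x, rfl⟩ := hg y
    exact ⟨_, locMap_res_dehom g x⟩
  refine ⟨homMk t' fun z => ?_, res_injective ht'⟩
  obtain ⟨w, rfl⟩ := hgs z
  rw [← locMap_pr₀, locMap_locMap, locMap_locMap, ht', locMap_pr₀]

theorem isAlmostSplit_of_exact {A B C : Obj k} {f : A ⟶ B} {g : B ⟶ C} (w : f ≫ g = 0)
    (hf : Function.Injective (lin f)) (hg : Function.Surjective (lin g))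
    (hfg : ∀ y, lin g y = 0 → ∃ x, lin f x = y) (hs : ¬ IsSplitEpi g)
    (hl : ∀ (Y : Obj k) (h : Y ⟶ C), ¬ IsSplitEpi h → ∃ l : Y ⟶ B, l ≫ g = h)
    (hd : ∀ (Y : Obj k) (h : A ⟶ Y), ¬ IsSplitMono h → ∃ l : B ⟶ Y, f ≫ l = h) :
    IsAlmostSplit f g := by
  have hmono : Mono f := ⟨fun a b h => hom_ext fun x => hf
    (by rw [← lin_comp_apply, h, lin_comp_apply])⟩
  have hepi : Epi g := ⟨fun a b h => hom_ext fun x => by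
    obtain ⟨y, rfl⟩ := hg x
    rw [← lin_comp_apply, h, lin_comp_apply]⟩
  refine
    { zero := w
      isKernel := nonempty_isLimit_kernelFork w hmono fun Y l => exists_lift_of_exact hf hfg l
      isCokernel := nonempty_isColimit_cokernelCofork w hepi fun Y l =>
        exists_desc_of_exact hg hfg l
      not_isSplitMono := fun h => hs ?_
      not_isSplitEpi := hs
      exists_lift := hl
      exists_desc := hd }
  -- A retraction of `f` yields a section of `g`: the complementary idempotent kills `f`, hence
  -- descends along `g`.
  obtain ⟨s, hs⟩ := exists_desc_of_exact hg hfg (𝟙 B - retraction f ≫ f)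
    (by simp [Preadditive.comp_sub])
  refine IsSplitEpi.mk' ⟨s, ?_⟩
  rw [← cancel_epi g, ← Category.assoc, hs, Preadditive.sub_comp, Category.assoc, w]
  simp

/-- Split the idempotent on the module and take the ranges of its linear components; `hom_comm`
identifies the localization of the first with the sum of the latter. -/
instance : IsIdempotentComplete (Obj k) where
  idempotents_split P p hp := by
    obtain ⟨M, i, r, hir, hri⟩ := IsIdempotentComplete.idempotents_split P.M (res p)
      (congrArg res hp)
    let K : Obj k :=
      { M := M
        V₀ := LinearMap.range (hom₀ p)
        V₁ := LinearMap.range (hom₁ p)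
        φ := LinearEquiv.ofLinearMap
          (((hom₀ p).rangeRestrict ∘ₗ LinearMap.fst k _ _ ∘ₗ P.φ.toLinearMap ∘ₗ locMap i).prod
            ((hom₁ p).rangeRestrict ∘ₗ LinearMap.snd k _ _ ∘ₗ P.φ.toLinearMap ∘ₗ locMap i))
          (locMap r ∘ₗ P.φ.symm.toLinearMap ∘ₗ
            ((LinearMap.range (hom₀ p)).subtype.prodMap (LinearMap.range (hom₁ p)).subtype))
          (by
            refine LinearMap.ext fun z => ?_
            obtain ⟨⟨_, a, rfl⟩, ⟨_, b, rfl⟩⟩ := z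
            have h0 : hom₀ p (hom₀ p a) = hom₀ p a := LinearMap.congr_fun (congrArg hom₀ hp) a
            have h1 : hom₁ p (hom₁ p b) = hom₁ p b := LinearMap.congr_fun (congrArg hom₁ hp) b
            have h2 : P.φ (locMap i (locMap r (P.φ.symm (hom₀ p a, hom₁ p b)))) =
                (hom₀ p a, hom₁ p b) := by
              rw [locMap_locMap, hri, hom_comm, LinearEquiv.apply_symm_apply]
              exact Prod.ext h0 h1
            refine Prod.ext (Subtype.ext ?_) (Subtype.ext ?_)
            · change hom₀ p (P.φ (locMap i (locMap r (P.φ.symm (hom₀ p a, hom₁ p b))))).1 = _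
              rw [h2]
              exact h0
            · change hom₁ p (P.φ (locMap i (locMap r (P.φ.symm (hom₀ p a, hom₁ p b))))).2 = _
              rw [h2]
              exact h1)
          (by
            refine LinearMap.ext fun z => ?_
            change locMap r (P.φ.symm (hom₀ p (P.φ (locMap i z)).1, hom₁ p (P.φ (locMap i z)).2)) = z
            rw [← hom_comm, LinearEquiv.symm_apply_apply, ← hri, locMap_locMap, locMap_locMap]
            have : i ≫ (r ≫ i) ≫ r = 𝟙 M := by
              rw [Category.assoc, hir, Category.comp_id, hir]
            rw [this, locMap_id]; rfl) }
    have hiK : ∀ z, P.φ (locMap i z) = ((K.φ z).1.1, (K.φ z).2.1) := fun z => by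
      change _ = (hom₀ p (P.φ (locMap i z)).1, hom₁ p (P.φ (locMap i z)).2)
      rw [← hom_comm, locMap_locMap, ← hri, reassoc_of% hir]
    have hi : ∀ z, locMap i (K.pr₀ z) = P.pr₀ (locMap i z) := fun z => P.φ.injective <| by
      rw [hiK, φ_pr₀, φ_pr₀, hiK]; rfl
    have hinj : Function.Injective (locMap i) := fun z w h => by
      have := congrArg (locMap r) h
      rwa [locMap_locMap, locMap_locMap, hir, locMap_id] at this
    refine ⟨K, homMk i hi, homMk r fun z => hinj ?_, res_injective hir, res_injective hri⟩
    rw [hi, locMap_locMap, locMap_locMap, hri, locMap_pr₀]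

end Obj

instance : IsIdempotentComplete (TF k) where
  idempotents_split P p hp := by
    obtain ⟨K, i, e, h1, h2⟩ := IsIdempotentComplete.idempotents_split P.obj p.hom
      (congrArg InducedCategory.Hom.hom hp)
    have hK : torsionFree k K := fun x hx => by
      have h3 : Obj.lin i x = 0 := P.property _ (by rw [← map_smul, hx, map_zero])
      have h4 : Obj.lin e (Obj.lin i x) = x := by rw [← Obj.lin_comp_apply, h1]; rfl
      rw [← h4, h3, map_zero]
    exact ⟨⟨K, hK⟩, ObjectProperty.homMk i, ObjectProperty.homMk e,
      ObjectProperty.hom_ext _ h1, ObjectProperty.hom_ext _ h2⟩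

end Objects

/-! ### The objects `F_{ma}`: maps out of them and into them. -/

section StandardObjects

variable {k : Type u} [Field k]

/-- The projection is the action of `v / x ^ m`, and division by `x ^ m` is invisible after
dehomogenizing. Negative degrees are reduced to degree zero by a power of `x`. -/
theorem UObj_pr₀_dehom {m : ℕ} (P : GrR k m) (x : restrict P) :
    ((U k m).obj P).pr₀ (dehom (restrict P) x) = dehom (restrict P) (vMul P x) := by
  have h0 : ∀ z, ((U k m).obj P).pr₀ z = idem P z := fun z => by
    change idem P z + (0 : LinearMap.range (LinearMap.id - idem P)).1 = idem P z
    rw [ZeroMemClass.coe_zero, add_zero]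
  have h1 : ∀ (n : ℕ) (y : restrict P) (hy : y ∈ (restrict P).deg n),
      idem P (dehom (restrict P) y) = dehom (restrict P) (vMul P y) := by
    intro n y hy
    have hv : vMul P y ∈ (restrict P).deg (n + m : ℕ) := by
      rw [add_comm, Nat.cast_add]
      exact P.smul_mem (vGen_mem_RDeg m) hy
    refine Subtype.ext ?_
    rw [dehom_natCast hy, dehom_natCast hv, idem_mk]
    exact congrArg (LocalizedModule.mk _) (Subtype.ext (pow_add X n m).symm)
  refine (h0 _).trans ?_
  induction x using GrMod.deg_induction with
  | zero => simp only [map_zero]; rfl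
  | add x y hx hy => simp only [map_add, hx, hy]; rfl
  | hom n x hx =>
    have h2 := h1 _ _ (X_pow_smul_mem hx (m := (n.toNat : ℤ)) (-n).toNat (by omega))
    rwa [dehom_X_pow_smul, map_smul, dehom_X_pow_smul] at h2

section Pairs

variable {m : ℕ} {a : ℤ}

theorem toPair_injective : Function.Injective (toPair : (F k m a).obj.M → k[X] × k[X]) :=
  Subtype.val_injective

theorem toPair_add (z w : (F k m a).obj.M) : toPair (z + w) = toPair z + toPair w := rfl
theorem toPair_neg (z : (F k m a).obj.M) : toPair (-z) = -toPair z := rfl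
theorem toPair_zero : toPair (0 : (F k m a).obj.M) = 0 := rfl
theorem toPair_scalar (c : k) (z : (F k m a).obj.M) : toPair (c • z) = c • toPair z := rfl

theorem toPair_smul (p : k[X]) (z : (F k m a).obj.M) : toPair (p • z) = (p, p) * toPair z := by
  rw [← coe_diag m p]; rfl

theorem dvd_toPair (z : (F k m a).obj.M) : X ^ m ∣ (toPair z).1 - (toPair z).2 :=
  (mem_R_iff m _).1 (show R k m from z).2

/-- The element of `F_{ma}` given by an element of `R_m ⊆ k[x] ⊕ k[x]`. -/
def ofPair (w : k[X] × k[X]) (hw : X ^ m ∣ w.1 - w.2) : (F k m a).obj.M :=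
  (⟨w, (mem_R_iff m w).2 hw⟩ : R k m)

@[simp] theorem toPair_ofPair (w : k[X] × k[X]) (hw : X ^ m ∣ w.1 - w.2) :
    toPair (ofPair (a := a) w hw) = w := rfl

theorem mem_deg_F {n : ℤ} {z : (F k m a).obj.M} :
    z ∈ (F k m a).obj.M.deg n ↔
      (toPair z).1 ∈ polyDeg k (n + a) ∧ (toPair z).2 ∈ polyDeg k (n + a) := Iff.rfl

theorem eq_zero_of_mem_polyDeg_of_eval {p : k[X]} {n : ℤ} (hp : p ∈ polyDeg k n)
    (h : p.eval 1 = 0) : p = 0 := by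
  rcases lt_or_ge n 0 with hn | hn
  · rw [polyDeg_eq_bot hn] at hp
    exact hp
  · lift n to ℕ using hn
    rw [eq_monomial_of_mem_polyDeg hp] at h ⊢
    rw [eval_monomial, one_pow, mul_one] at h
    rw [h, map_zero]

/-- The `i`-th component of the elements of `F_{ma}`. -/
def compF (m : ℕ) (a : ℤ) (i : ZMod 2) : (F k m a).obj.M →ₗ[k[X]] k[X] where
  toFun z := proj k i (toPair z)
  map_add' z w := by rw [toPair_add, map_add]
  map_smul' p z := by
    rw [toPair_smul, map_mul]
    congr 1
    unfold proj
    split_ifs <;> rfl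

/-- The value at `x = 1` of the `i`-th component. -/
def evF (m : ℕ) (a : ℤ) (i : ZMod 2) : locZero (F k m a).obj.M →ₗ[k] k := evalOne (compF m a i)

theorem evF_dehom (i : ZMod 2) (z : (F k m a).obj.M) :
    evF m a i (dehom _ z) = (proj k i (toPair z)).eval 1 := evalOne_dehom _ _

theorem proj_zero (z : k[X] × k[X]) : proj k 0 z = z.1 := rfl

theorem proj_one (z : k[X] × k[X]) : proj k 1 z = z.2 := by
  rw [proj, if_neg (by decide)]; rfl

theorem F_pr₀_dehom (z : (F k m a).obj.M) : ∃ w : (F k m a).obj.M,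
    toPair w = (X ^ m * (toPair z).1, 0) ∧
      (F k m a).obj.pr₀ (dehom _ z) = dehom (F k m a).obj.M w :=
  ⟨(vGen k m * (show R k m from z) : R k m), Prod.ext rfl (zero_mul _), UObj_pr₀_dehom _ _⟩

theorem evF_pr (i j : ZMod 2) (w : locZero (F k m a).obj.M) :
    evF m a i ((F k m a).obj.pr j w) = if i = j then evF m a i w else 0 := by
  have h1 : (1 : ZMod 2) ≠ 0 := by decide
  obtain ⟨z, rfl⟩ := dehom_surjective _ w
  obtain ⟨v, hv, hz⟩ := F_pr₀_dehom z
  obtain rfl | rfl := zmod_two_cases i <;> obtain rfl | rfl := zmod_two_cases j <;>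
    simp [Obj.pr_zero, Obj.pr_one, hz, evF_dehom, hv, proj_zero, proj_one, h1, h1.symm]

/-- Homogeneous components are monomials, determined by their value at `1`; so the two evaluations
are coordinates on the localization. -/
theorem locZero_F_ext {w w' : locZero (F k m a).obj.M} (h : ∀ i, evF m a i w = evF m a i w') :
    w = w' := by
  rw [← sub_eq_zero]
  obtain ⟨n, -, z, hz, hw⟩ := exists_dehom_eq (w - w') 0
  have h1 : ∀ i, (proj k i (toPair z)).eval 1 = 0 := fun i => by
    rw [← evF_dehom, hw, map_sub, h, sub_self]
  have h2 : z = 0 := by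
    refine toPair_injective (Prod.ext ?_ ?_)
    · exact eq_zero_of_mem_polyDeg_of_eval (mem_deg_F.1 hz).1 (h1 0)
    · exact eq_zero_of_mem_polyDeg_of_eval (mem_deg_F.1 hz).2 (proj_one (toPair z) ▸ h1 1)
  rw [← hw, h2, map_zero]

variable (k) in
/-- `F_{ma}` is a free `k[x]`-module on `1` and `(x ^ m, 0)`. -/
def basisF (m : ℕ) (a : ℤ) : (k[X] × k[X]) ≃ₗ[k[X]] (F k m a).obj.M :=
  LinearEquiv.ofBijective
    { toFun := fun p => ofPair (p.1 + p.2 * X ^ m, p.1) (by simp)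
      map_add' := fun p q => toPair_injective (by
        rw [toPair_add, toPair_ofPair, toPair_ofPair, toPair_ofPair]
        refine Prod.ext ?_ rfl
        simp only [Prod.fst_add, Prod.snd_add]
        ring)
      map_smul' := fun r p => toPair_injective (by
        rw [toPair_ofPair, RingHom.id_apply, toPair_smul, toPair_ofPair]
        refine Prod.ext ?_ rfl
        simp only [Prod.smul_fst, Prod.smul_snd, smul_eq_mul, Prod.fst_mul]
        ring) }
    ⟨by
      rw [← LinearMap.ker_eq_bot, LinearMap.ker_eq_bot']
      intro p hp
      have h1 : (p.1 + p.2 * X ^ m, p.1) = ((0, 0) : k[X] × k[X]) := congrArg toPair hp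
      rw [Prod.mk.injEq] at h1
      obtain ⟨h2, h3⟩ := h1
      rw [h3, zero_add, mul_eq_zero] at h2
      exact Prod.ext h3 (h2.resolve_right (pow_ne_zero _ X_ne_zero)), fun z => by
      obtain ⟨q, hq⟩ := dvd_toPair z
      refine ⟨((toPair z).2, q), toPair_injective (Prod.ext ?_ rfl)⟩
      change (toPair z).2 + q * X ^ m = (toPair z).1
      rw [mul_comm, ← hq]
      ring⟩

theorem toPair_basisF (p : k[X] × k[X]) :
    toPair (basisF k m a p) = (p.1 + p.2 * X ^ m, p.1) := rfl

end Pairs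

section MapsFromF

variable (m : ℕ) (a : ℤ) {Y : Obj k}

/-- The map `F_{ma} → Y` which sends `1` to `y` and `(x ^ m, 0)` to `y'`. -/
def homFromF (y y' : Y.M) (hy : y ∈ Y.M.deg (-a)) (hy' : y' ∈ Y.M.deg (-a + m))
    (h : Y.pr₀ (dehom _ y) = dehom _ y') : (F k m a).obj ⟶ Y :=
  Obj.homMk
    (GrMod.homMk ((((LinearMap.toSpanSingleton k[X] Y.M y).coprod
      (LinearMap.toSpanSingleton k[X] Y.M y'))) ∘ₗ (basisF k m a).symm.toLinearMap) <| by
      intro n z hz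
      obtain ⟨⟨p, q⟩, rfl⟩ := (basisF k m a).surjective z
      rw [mem_deg_F, toPair_basisF] at hz
      -- The difference of the two components is `q x ^ m`, so `q` is homogeneous of degree smaller
      -- by `m`.
      have hq : q ∈ polyDeg k (n + a - m) := fun i hi => by
        have h1 := sub_mem hz.1 hz.2
        rw [add_sub_cancel_left] at h1
        have := h1 (i + m) (by rwa [coeff_mul_X_pow])
        push_cast at this
        omega
      rw [LinearMap.comp_apply, LinearEquiv.coe_coe, LinearEquiv.symm_apply_apply]
      refine add_mem ?_ ?_
      · have := Y.M.smul_mem hz.2 hy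
        rwa [add_neg_cancel_right] at this
      · have := Y.M.smul_mem hq hy'
        rwa [show n + a - m + (-a + m) = n by ring] at this) <| by
    intro w
    obtain ⟨z, rfl⟩ := dehom_surjective _ w
    obtain ⟨v, hv, hz⟩ := F_pr₀_dehom z
    obtain ⟨⟨p, q⟩, rfl⟩ := (basisF k m a).surjective z
    -- Since `v² = x ^ m v`, the generator `v` sends `p + q v` to `(p + q x ^ m) v`.
    have hv' : v = basisF k m a (0, p + q * X ^ m) := toPair_injective <| by
      rw [hv, toPair_basisF, toPair_basisF]
      simp [mul_comm]
    rw [hz, locMap_dehom, locMap_dehom, GrMod.toLin_homMk, hv', LinearMap.comp_apply,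
      LinearMap.comp_apply, LinearEquiv.coe_coe, LinearEquiv.symm_apply_apply,
      LinearEquiv.symm_apply_apply]
    change dehom Y.M ((0 : k[X]) • y + (p + q * X ^ m) • y') = Y.pr₀ (dehom Y.M (p • y + q • y'))
    simp only [map_add, dehom_smul, map_smul, ← h, Y.pr₀_pr₀]
    simp [add_smul]

variable {m a}

theorem lin_homFromF (y y' : Y.M) (hy : y ∈ Y.M.deg (-a)) (hy' : y' ∈ Y.M.deg (-a + m))
    (h : Y.pr₀ (dehom _ y) = dehom _ y') (p q : k[X]) :
    Obj.lin (homFromF m a y y' hy hy' h) (basisF k m a (p, q)) = p • y + q • y' := by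
  change (LinearMap.coprod _ _) ((basisF k m a).symm (basisF k m a (p, q))) = _
  rw [LinearEquiv.symm_apply_apply]; rfl

theorem homFromF_ext {f g : (F k m a).obj ⟶ Y}
    (h : Obj.lin f (basisF k m a (1, 0)) = Obj.lin g (basisF k m a (1, 0)))
    (h' : Obj.lin f (basisF k m a (0, 1)) = Obj.lin g (basisF k m a (0, 1))) : f = g := by
  ext z
  obtain ⟨⟨p, q⟩, rfl⟩ := (basisF k m a).surjective z
  have : ((p, q) : k[X] × k[X]) = p • (1, 0) + q • (0, 1) := by simp
  rw [this, map_add, map_smul, map_smul, map_add, map_smul, map_smul, map_add, map_smul, map_smul,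
    h, h']

theorem basisF_fst_mem : basisF k m a (1, 0) ∈ (F k m a).obj.M.deg (-a) := by
  rw [mem_deg_F, toPair_basisF, neg_add_cancel]
  simp only [zero_mul, add_zero]
  exact ⟨monomial_mem_polyDeg 0 1, monomial_mem_polyDeg 0 1⟩

theorem basisF_snd_mem : basisF k m a (0, 1) ∈ (F k m a).obj.M.deg (-a + m) := by
  rw [mem_deg_F, toPair_basisF, neg_add_cancel_comm]
  simp only [zero_add, one_mul]
  exact ⟨X_pow_mem_polyDeg m, zero_mem _⟩

theorem pr₀_dehom_basisF :
    (F k m a).obj.pr₀ (dehom _ (basisF k m a (1, 0))) = dehom _ (basisF k m a (0, 1)) := by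
  obtain ⟨v, hv, hz⟩ := F_pr₀_dehom (basisF k m a (1, 0))
  rw [hz]
  congr 1
  refine toPair_injective ?_
  rw [hv, toPair_basisF, toPair_basisF]
  simp

theorem pr₀_dehom_lin (f : (F k m a).obj ⟶ Y) :
    Y.pr₀ (dehom _ (Obj.lin f (basisF k m a (1, 0)))) =
      dehom _ (Obj.lin f (basisF k m a (0, 1))) := by
  rw [← Obj.locMap_res_dehom, ← Obj.locMap_pr₀, pr₀_dehom_basisF, Obj.locMap_res_dehom]

theorem dehom_injOn (hY : torsionFree k Y) {n : ℤ} {x y : Y.M} (hx : x ∈ Y.M.deg n)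
    (hy : y ∈ Y.M.deg n) (h : dehom _ x = dehom _ y) : x = y := by
  rw [← sub_eq_zero] at h ⊢
  rw [← map_sub] at h
  exact eq_zero_of_dehom_eq_zero hY (sub_mem hx hy) h

/-- The image of `(x ^ m, 0)` has the same fraction as `pr₀` of the image of `1`, and in a torsion
free object the fraction determines an element of given degree. -/
theorem homFromF_ext_of_torsionFree (hY : torsionFree k Y) {f g : (F k m a).obj ⟶ Y}
    (h : Obj.lin f (basisF k m a (1, 0)) = Obj.lin g (basisF k m a (1, 0))) : f = g :=
  homFromF_ext h <| dehom_injOn hY (Obj.lin_mem f basisF_snd_mem) (Obj.lin_mem g basisF_snd_mem) <| by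
    rw [← pr₀_dehom_lin, ← pr₀_dehom_lin, h]

end MapsFromF

section MapsToF

variable {m : ℕ} {a : ℤ} {Y : Obj k}

/-- The functional on `(Y_x)_0` attached to a map `Y → F_{ma}`, whose value is the difference of the
two components at `x = 1`. -/
def functionalF (f : Y ⟶ (F k m a).obj) : locZero Y.M →ₗ[k] k :=
  (evF m a 0 - evF m a 1) ∘ₗ locMap (Obj.res f)

theorem functionalF_pr₀ (f : Y ⟶ (F k m a).obj) (z : locZero Y.M) :
    functionalF f (Y.pr₀ z) = evF m a 0 (locMap (Obj.res f) z) := by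
  change evF (k := k) m a 0 _ - evF m a 1 _ = _
  rw [Obj.locMap_pr₀, ← Obj.pr_zero, evF_pr, evF_pr, if_pos rfl, if_neg (by decide), sub_zero]

theorem evF_one_locMap (f : Y ⟶ (F k m a).obj) (z : locZero Y.M) :
    evF m a 1 (locMap (Obj.res f) z) = functionalF f (Y.pr₀ z) - functionalF f z := by
  rw [functionalF_pr₀]
  change _ = evF m a 0 _ - (evF (k := k) m a 0 _ - evF m a 1 _)
  abel

/-- Both components can be recovered: the first is `l (pr₀ z)`, the second `l (pr₀ z) - l z`. -/
theorem functionalF_ext {f g : Y ⟶ (F k m a).obj} (h : functionalF f = functionalF g) : f = g := by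
  refine Obj.hom_ext_deg fun n x hx => dehom_injOn (F k m a).property (Obj.lin_mem f hx)
    (Obj.lin_mem g hx) (locZero_F_ext fun i => ?_)
  rw [← Obj.locMap_res_dehom, ← Obj.locMap_res_dehom]
  obtain rfl | rfl := zmod_two_cases i
  · rw [← functionalF_pr₀, h, functionalF_pr₀]
  · rw [evF_one_locMap, h, ← evF_one_locMap]

/-- In degree `-a + m - 1` the components are homogeneous of degree `m - 1`, while their difference
is divisible by `x ^ m`. -/
theorem functionalF_eq_zero_of_mem (f : Y ⟶ (F k m a).obj) {z : locZero Y.M}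
    (hz : z ∈ stage Y.M (-a + m - 1)) : functionalF f z = 0 := by
  obtain ⟨y, hy, rfl⟩ := hz
  change evF (k := k) m a 0 _ - evF m a 1 _ = _
  rw [Obj.locMap_res_dehom, evF_dehom, evF_dehom, proj_zero, proj_one, ← eval_sub]
  have h1 := (mem_deg_F (z := Obj.lin f y)).1 (Obj.lin_mem f hy)
  obtain ⟨q, hq⟩ := dvd_toPair (Obj.lin f y)
  have h2 : (toPair (Obj.lin f y)).1 - (toPair (Obj.lin f y)).2 = 0 := by
    rw [hq]
    by_contra h0
    obtain ⟨i, hi⟩ : ∃ i, q.coeff i ≠ 0 := by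
      by_contra! h
      have hq0 : q = 0 := Polynomial.ext (by simpa using h)
      exact h0 (by rw [hq0, mul_zero])
    have h3 := sub_mem h1.1 h1.2
    rw [hq] at h3
    have := h3 (i + m) (by rwa [coeff_X_pow_mul])
    push_cast at this
    omega
  rw [h2, eval_zero]

theorem functionalF_pr₀_eq_zero_of_mem (f : Y ⟶ (F k m a).obj) {z : locZero Y.M}
    (hz : z ∈ stage Y.M (-a - 1)) : functionalF f (Y.pr₀ z) = 0 := by
  obtain ⟨y, hy, rfl⟩ := hz
  have h1 := (mem_deg_F (z := Obj.lin f y)).1 (Obj.lin_mem f hy)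
  rw [functionalF_pr₀, Obj.locMap_res_dehom, evF_dehom, proj_zero]
  have h2 := h1.1
  rw [polyDeg_eq_bot (n := -a - 1 + a) (by omega)] at h2
  rw [(Submodule.mem_bot k).1 h2, eval_zero]

variable (m a)

/-- The components are the homogenizations of `l ∘ pr₀` and `l ∘ pr₀ - l`. In degree `n` they differ
by `l` times `x ^ (n + a)`, which is divisible by `x ^ m` because `l` vanishes when `n + a < m`. -/
theorem exists_functionalF_eq (l : locZero Y.M →ₗ[k] k)
    (hl : ∀ z ∈ stage Y.M (-a + m - 1), l z = 0) (hl' : ∀ z ∈ stage Y.M (-a - 1), l (Y.pr₀ z) = 0) :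
    ∃ f : Y ⟶ (F k m a).obj, functionalF f = l := by
  have hl1 : ∀ z ∈ stage Y.M (-a - 1), (l ∘ₗ Y.pr₀ - l) z = 0 := fun z hz => by
    rw [LinearMap.sub_apply, LinearMap.comp_apply, hl' z hz,
      hl z (stage_mono _ (by omega) hz), sub_zero]
  let θ₀ := homogenize Y.M (l ∘ₗ Y.pr₀) a hl'
  let θ₁ := homogenize Y.M (l ∘ₗ Y.pr₀ - l) a hl1
  have hdvd : ∀ y, X ^ m ∣ θ₀ y - θ₁ y := fun y => by
    induction y using GrMod.deg_induction with
    | zero => simp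
    | add x y hx hy =>
      rw [map_add, map_add, add_sub_add_comm]
      exact dvd_add hx hy
    | hom n y hy =>
      rw [homogenize_of_mem hl' hy, homogenize_of_mem hl1 hy, ← map_sub, LinearMap.sub_apply,
        sub_sub_cancel]
      rcases lt_or_ge n (-a + m) with h | h
      · rw [hl _ (stage_mono _ (by omega) (dehom_mem_stage hy)), map_zero]
        exact dvd_zero _
      · rw [X_pow_dvd_iff]
        intro d hd
        rw [coeff_monomial, if_neg (by omega)]
  let f : Y.M ⟶ (F k m a).obj.M := GrMod.homMk
    { toFun := fun y => ofPair (θ₀ y, θ₁ y) (hdvd y)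
      map_add' := fun x y => toPair_injective (by
        rw [toPair_add, toPair_ofPair, map_add, map_add]; rfl)
      map_smul' := fun p y => toPair_injective (by
        rw [RingHom.id_apply, toPair_smul, toPair_ofPair, map_smul, map_smul]; rfl) }
    fun n y hy => mem_deg_F.2 ⟨homogenize_mem hl' hy, homogenize_mem hl1 hy⟩
  have hf0 : ∀ z, evF m a 0 (locMap f z) = l (Y.pr₀ z) := fun z => by
    obtain ⟨y, rfl⟩ := dehom_surjective _ z
    rw [locMap_dehom, evF_dehom]
    exact evalOne_homogenize hl' y
  have hf1 : ∀ z, evF m a 1 (locMap f z) = l (Y.pr₀ z) - l z := fun z => by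
    obtain ⟨y, rfl⟩ := dehom_surjective _ z
    rw [locMap_dehom, evF_dehom, proj_one]
    exact evalOne_homogenize hl1 y
  refine ⟨Obj.homMk f fun z => locZero_F_ext fun i => ?_, LinearMap.ext fun z => ?_⟩
  · rw [← Obj.pr_zero (F k m a).obj, evF_pr]
    obtain rfl | rfl := zmod_two_cases i
    · rw [if_pos rfl, hf0, hf0, Obj.pr₀_pr₀]
    · rw [if_neg (by decide), hf1, Obj.pr₀_pr₀, sub_self]
  · change evF m a 0 (locMap f z) - evF m a 1 (locMap f z) = _
    rw [hf0, hf1, sub_sub_cancel]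

end MapsToF

end StandardObjects

/-! ### The objects `F^i_{0a}`: maps out of them and into them. -/

section Factors

variable {k : Type u} [Field k] {i : ZMod 2} {a : ℤ}

theorem toPoly_smul (p : k[X]) (z : (F₀ k i a).obj.M) : toPoly (p • z) = p * toPoly z := by
  change proj k i (diag k 0 p) * toPoly z = _
  rw [proj_diag]

theorem mem_deg_F₀ {n : ℤ} {z : (F₀ k i a).obj.M} :
    z ∈ (F₀ k i a).obj.M.deg n ↔ toPoly z ∈ polyDeg k (n + a) := Iff.rfl

/-- The element of `F^i_{0a}` given by a polynomial. -/
def ofPoly (p : k[X]) : (F₀ k i a).obj.M := p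

@[simp] theorem toPoly_ofPoly (p : k[X]) : toPoly (ofPoly p : (F₀ k i a).obj.M) = p := rfl

theorem eq_smul_ofPoly (z : (F₀ k i a).obj.M) : z = toPoly z • (ofPoly 1 : (F₀ k i a).obj.M) :=
  ((toPoly_smul _ _).trans (mul_one _)).symm

variable (k i a) in
/-- The value of the elements of `F^i_{0a}` at `x = 1`. -/
def evF₀ : locZero (F₀ k i a).obj.M →ₗ[k] k :=
  evalOne
    { toFun := fun z => toPoly z
      map_add' := fun _ _ => rfl
      map_smul' := toPoly_smul }

theorem evF₀_dehom (z : (F₀ k i a).obj.M) : evF₀ k i a (dehom _ z) = (toPoly z).eval 1 :=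
  evalOne_dehom _ _

theorem F₀_pr₀ (w : locZero (F₀ k i a).obj.M) :
    (F₀ k i a).obj.pr₀ w = if i = 0 then w else 0 := by
  obtain ⟨z, rfl⟩ := dehom_surjective _ w
  refine (UObj_pr₀_dehom ((factor k i).shift a) z).trans ?_
  have h : vMul ((factor k i).shift a) z =
      (ofPoly (proj k i (vGen k 0) * toPoly z) : (F₀ k i a).obj.M) := rfl
  have h' : proj k i (vGen k 0) = if i = 0 then 1 else 0 := by
    unfold proj vGen
    split_ifs <;> simp
  refine (congrArg (dehom (F₀ k i a).obj.M) h).trans ?_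
  rw [h']
  split_ifs
  · rw [one_mul]; rfl
  · rw [zero_mul]; exact map_zero _

theorem F₀_pr (j : ZMod 2) (w : locZero (F₀ k i a).obj.M) :
    (F₀ k i a).obj.pr j w = if i = j then w else 0 := by
  have h1 : (1 : ZMod 2) ≠ 0 := by decide
  obtain rfl | rfl := zmod_two_cases i <;> obtain rfl | rfl := zmod_two_cases j <;>
    simp [Obj.pr_zero, Obj.pr_one, F₀_pr₀, h1, h1.symm]

theorem locZero_F₀_ext {w w' : locZero (F₀ k i a).obj.M} (h : evF₀ k i a w = evF₀ k i a w') :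
    w = w' := by
  rw [← sub_eq_zero]
  obtain ⟨n, -, z, hz, hw⟩ := exists_dehom_eq (w - w') 0
  have h1 : (toPoly z).eval 1 = 0 := by rw [← evF₀_dehom, hw, map_sub, h, sub_self]
  have h2 : z = 0 := eq_zero_of_mem_polyDeg_of_eval (mem_deg_F₀.1 hz) h1
  rw [← hw, h2, map_zero]

theorem ofPoly_one_mem : ofPoly 1 ∈ (F₀ k i a).obj.M.deg (-a) := by
  rw [mem_deg_F₀, neg_add_cancel]
  exact monomial_mem_polyDeg 0 1

section Maps

variable {Y : Obj k}

theorem pr₀_eq_of_pr_eq {z : locZero Y.M} (h : Y.pr i z = z) :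
    Y.pr₀ z = if i = 0 then z else 0 := by
  rw [← h, ← Obj.pr_zero, Obj.pr_pr]
  obtain rfl | rfl := zmod_two_cases i
  · simp
  · rw [if_neg (by decide), if_neg (by decide)]

variable (i a) in
/-- The map `F^i_{0a} → Y` which sends `1` to `y`. -/
def homFromF₀ (y : Y.M) (hy : y ∈ Y.M.deg (-a)) (h : Y.pr i (dehom _ y) = dehom _ y) :
    (F₀ k i a).obj ⟶ Y :=
  Obj.homMk
    (GrMod.homMk
      { toFun := fun z => toPoly z • y
        map_add' := fun z w => add_smul (toPoly z) (toPoly w) y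
        map_smul' := fun p z => by rw [toPoly_smul, mul_smul]; rfl } fun n z hz => by
      have := Y.M.smul_mem (mem_deg_F₀.1 hz) hy
      rwa [add_neg_cancel_right] at this) fun w => by
    obtain ⟨z, rfl⟩ := dehom_surjective _ w
    have h1 : Y.pr i (dehom _ (toPoly z • y)) = dehom _ (toPoly z • y) := by
      rw [dehom_smul, map_smul, h]
    have h2 := pr₀_eq_of_pr_eq h1
    rw [F₀_pr₀]
    split_ifs at h2 ⊢ with hi
    · rw [locMap_dehom]
      exact h2.symm
    · rw [map_zero, locMap_dehom]
      exact h2.symm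

theorem lin_homFromF₀ (y : Y.M) (hy : y ∈ Y.M.deg (-a)) (h : Y.pr i (dehom _ y) = dehom _ y)
    (z : (F₀ k i a).obj.M) : Obj.lin (homFromF₀ i a y hy h) z = toPoly z • y := rfl

theorem homFromF₀_ext {f g : (F₀ k i a).obj ⟶ Y}
    (h : Obj.lin f (ofPoly 1) = Obj.lin g (ofPoly 1)) : f = g := by
  ext z
  rw [eq_smul_ofPoly z, map_smul, map_smul, h]

theorem pr_dehom_lin_ofPoly (f : (F₀ k i a).obj ⟶ Y) :
    Y.pr i (dehom _ (Obj.lin f (ofPoly 1))) = dehom _ (Obj.lin f (ofPoly 1)) := by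
  rw [← Obj.locMap_res_dehom, ← Obj.locMap_pr, F₀_pr, if_pos rfl]

/-- The functional on `(Y_x)_0` attached to a map `Y → F^i_{0a}`, given by its value at `x = 1`. -/
def functionalF₀ (f : Y ⟶ (F₀ k i a).obj) : locZero Y.M →ₗ[k] k :=
  evF₀ k i a ∘ₗ locMap (Obj.res f)

theorem functionalF₀_ext {f g : Y ⟶ (F₀ k i a).obj} (h : functionalF₀ f = functionalF₀ g) :
    f = g := by
  refine Obj.hom_ext_deg fun n x hx => dehom_injOn (F₀ k i a).property (Obj.lin_mem f hx)
    (Obj.lin_mem g hx) (locZero_F₀_ext ?_)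
  rw [← Obj.locMap_res_dehom, ← Obj.locMap_res_dehom]
  exact LinearMap.congr_fun h _

theorem functionalF₀_pr (f : Y ⟶ (F₀ k i a).obj) (z : locZero Y.M) :
    functionalF₀ f (Y.pr i z) = functionalF₀ f z := by
  change evF₀ k i a _ = evF₀ k i a _
  rw [Obj.locMap_pr, F₀_pr, if_pos rfl]

theorem functionalF₀_eq_zero_of_mem (f : Y ⟶ (F₀ k i a).obj) {z : locZero Y.M}
    (hz : z ∈ stage Y.M (-a - 1)) : functionalF₀ f z = 0 := by
  obtain ⟨y, hy, rfl⟩ := hz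
  change evF₀ k i a _ = _
  have h1 := (mem_deg_F₀ (z := Obj.lin f y)).1 (Obj.lin_mem f hy)
  rw [polyDeg_eq_bot (n := -a - 1 + a) (by omega)] at h1
  rw [Obj.locMap_res_dehom, evF₀_dehom, (Submodule.mem_bot k).1 h1, eval_zero]

variable (i a) in
theorem exists_functionalF₀_eq (l : locZero Y.M →ₗ[k] k) (hl : ∀ z, l (Y.pr i z) = l z)
    (hl' : ∀ z ∈ stage Y.M (-a - 1), l z = 0) :
    ∃ f : Y ⟶ (F₀ k i a).obj, functionalF₀ f = l := by
  let f : Y.M ⟶ (F₀ k i a).obj.M := GrMod.homMk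
    { toFun := fun y => ofPoly (homogenize Y.M l a hl' y)
      map_add' := fun x y => map_add (homogenize Y.M l a hl') x y
      map_smul' := fun p y =>
        (map_smul (homogenize Y.M l a hl') p y).trans (toPoly_smul (i := i) (a := a) p _).symm }
    fun n y hy => mem_deg_F₀.2 (homogenize_mem hl' hy)
  have hf : ∀ z, evF₀ k i a (locMap f z) = l z := fun z => by
    obtain ⟨y, rfl⟩ := dehom_surjective _ z
    rw [locMap_dehom, evF₀_dehom]
    exact evalOne_homogenize hl' y
  refine ⟨Obj.homMk f fun z => locZero_F₀_ext ?_, LinearMap.ext hf⟩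
  rw [F₀_pr₀, hf, ← hl, ← Obj.pr_zero, Obj.pr_pr]
  split_ifs with hi
  · rw [hf, hl]
  · rw [map_zero, map_zero]

end Maps

end Factors

/-- The zero functional on `P` and `l` on `Q` agree on the intersection, so they glue on the sum and
extend to the whole space. -/
theorem exists_dual_of_inf {k V : Type*} [Field k] [AddCommGroup V] [Module k V]
    (P Q : Submodule k V) (l : V →ₗ[k] k) (h : ∀ v ∈ P, v ∈ Q → l v = 0) :
    ∃ l' : V →ₗ[k] k, (∀ v ∈ P, l' v = 0) ∧ ∀ v ∈ Q, l' v = l v := by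
  obtain ⟨g, hg⟩ := LinearMap.exists_extend (p := P.map Q.mkQ) (V' := V ⧸ Q) (Submodule.subtype _)
  let f₁ : V →ₗ.[k] k := ⟨P, 0⟩
  let f₂ : V →ₗ.[k] k := ⟨Q, l.domRestrict Q⟩
  have hf : ∀ (x : f₁.domain) (y : f₂.domain), (x : V) = y → f₁ x = f₂ y := fun x y hxy =>
    (h x x.2 (hxy ▸ y.2)).symm.trans (congrArg l hxy)
  obtain ⟨l', hl'⟩ := LinearMap.exists_extend (f₁.sup f₂ hf).toFun
  refine ⟨l', fun v hv => ?_, fun v hv => ?_⟩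
  · have h1 := (LinearPMap.left_le_sup f₁ f₂ hf).2 (x := ⟨v, hv⟩)
      (y := ⟨v, (LinearPMap.left_le_sup f₁ f₂ hf).1 hv⟩) rfl
    exact (LinearMap.congr_fun hl' ⟨v, (LinearPMap.left_le_sup f₁ f₂ hf).1 hv⟩).trans h1.symm
  · have h1 := (LinearPMap.right_le_sup f₁ f₂ hf).2 (x := ⟨v, hv⟩)
      (y := ⟨v, (LinearPMap.right_le_sup f₁ f₂ hf).1 hv⟩) rfl
    exact (LinearMap.congr_fun hl' ⟨v, (LinearPMap.right_le_sup f₁ f₂ hf).1 hv⟩).trans h1.symm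

/-! ### The almost split sequences ending in `F_{m+1,a}`. -/

section AlmostSplit

variable {k : Type u} [Field k]

section Arrows

variable (k)

/-- The inclusion `F_{m+1,a} → F_{ma}`. -/
def inclF (m : ℕ) (a : ℤ) : (F k (m + 1) a).obj ⟶ (F k m a).obj :=
  homFromF (m + 1) a (basisF k m a (1, 0)) ((X : k[X]) • basisF k m a (0, 1)) basisF_fst_mem
    (X_smul_mem basisF_snd_mem (by push_cast; ring)) (by rw [pr₀_dehom_basisF, dehom_X_smul])

/-- The multiplication by `x`, as a map `F_{ma} → F_{m+1,a+1}`. -/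
def mulXF (m : ℕ) (a b : ℤ) (h : b = a + 1) : (F k m a).obj ⟶ (F k (m + 1) b).obj :=
  homFromF m a ((X : k[X]) • basisF k (m + 1) b (1, 0)) (basisF k (m + 1) b (0, 1))
    (X_smul_mem basisF_fst_mem (by rw [h]; ring))
    (by convert basisF_snd_mem (k := k) (m := m + 1) (a := b) using 2; rw [h]; push_cast; ring)
    (by rw [dehom_X_smul, pr₀_dehom_basisF])

variable {k}

theorem toPair_inclF (m : ℕ) (a : ℤ) (z : (F k (m + 1) a).obj.M) :
    toPair (Obj.lin (inclF k m a) z) = toPair z := by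
  obtain ⟨⟨p, q⟩, rfl⟩ := (basisF k (m + 1) a).surjective z
  rw [inclF, lin_homFromF, toPair_add, toPair_smul, toPair_smul, toPair_smul, toPair_basisF,
    toPair_basisF, toPair_basisF]
  refine Prod.ext ?_ ?_
  · simp only [Prod.fst_add, Prod.fst_mul]; ring
  · simp only [Prod.snd_add, Prod.snd_mul]; ring

theorem toPair_mulXF (m : ℕ) (a b : ℤ) (h : b = a + 1) (z : (F k m a).obj.M) :
    toPair (Obj.lin (mulXF k m a b h) z) = (X, X) * toPair z := by
  obtain ⟨⟨p, q⟩, rfl⟩ := (basisF k m a).surjective z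
  rw [mulXF, lin_homFromF, toPair_add, toPair_smul, toPair_smul, toPair_smul, toPair_basisF,
    toPair_basisF, toPair_basisF]
  refine Prod.ext ?_ ?_
  · simp only [Prod.fst_add, Prod.fst_mul]; ring
  · simp only [Prod.snd_add, Prod.snd_mul]; ring

/-- Functionals only see the value at `x = 1`, and `p` has value `1` there. So neither the
inclusions nor the multiplications by `x` change a functional. -/
theorem functionalF_comp_of_toPair {Y : Obj k} {m n : ℕ} {a b : ℤ} {p : k[X]}
    (hp : p.eval 1 = 1) (f : (F k m a).obj ⟶ (F k n b).obj)
    (hf : ∀ z, toPair (Obj.lin f z) = (p, p) * toPair z) (h : Y ⟶ (F k m a).obj) :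
    functionalF (h ≫ f) = functionalF h := by
  refine locZero_linearMap_ext fun n x hx => ?_
  change evF (k := k) _ _ 0 (locMap (Obj.res (h ≫ f)) _) - evF (k := k) _ _ 1 _ =
    evF (k := k) _ _ 0 _ - evF (k := k) _ _ 1 _
  simp only [Obj.locMap_res_dehom, evF_dehom, Obj.lin_comp_apply, hf, proj_zero, proj_one,
    Prod.fst_mul, Prod.snd_mul, eval_mul, hp, one_mul]

theorem functionalF_comp_inclF {Y : Obj k} {m : ℕ} {a : ℤ} (h : Y ⟶ (F k (m + 1) a).obj) :
    functionalF (h ≫ inclF k m a) = functionalF h :=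
  functionalF_comp_of_toPair (p := 1) eval_one _
    (fun z => (toPair_inclF m a z).trans (one_mul (toPair z)).symm) h

theorem functionalF_comp_mulXF {Y : Obj k} {m : ℕ} {a b : ℤ} (hb : b = a + 1)
    (h : Y ⟶ (F k m a).obj) : functionalF (h ≫ mulXF k m a b hb) = functionalF h :=
  functionalF_comp_of_toPair eval_X _ (toPair_mulXF m a b hb) h

theorem functionalF_add {Y : Obj k} {m : ℕ} {a : ℤ} (f g : Y ⟶ (F k m a).obj) :
    functionalF (f + g) = functionalF f + functionalF g := by
  have h : Obj.res (f + g) = Obj.res f + Obj.res g := rfl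
  rw [functionalF, h, locMap_add, LinearMap.comp_add]; rfl

end Arrows

section Sections

variable {m : ℕ} {a : ℤ} {Y : Obj k}

/-- The first component has value `1` by assumption. So has the second, because the functional kills
fractions of degree `-a`, the index `m + 1` being positive. -/
theorem lin_eq_basisF (h : Y ⟶ (F k (m + 1) a).obj) {y : Y.M} (hy : y ∈ Y.M.deg (-a))
    (hl : functionalF h (Y.pr₀ (dehom _ y)) = 1) : Obj.lin h y = basisF k (m + 1) a (1, 0) := by
  refine dehom_injOn (F k (m + 1) a).property (Obj.lin_mem h hy) basisF_fst_mem
    (locZero_F_ext fun i => ?_)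
  rw [← Obj.locMap_res_dehom, evF_dehom, toPair_basisF]
  obtain rfl | rfl := zmod_two_cases i
  · rw [← functionalF_pr₀, hl]
    simp [proj_zero]
  · rw [evF_one_locMap, hl, functionalF_eq_zero_of_mem h
      (stage_mono _ (by push_cast; omega) (dehom_mem_stage hy))]
    simp [proj_one]

/-- If there were no such decomposition, a functional would be `1` on the left side and kill both
subspaces; it defines a retraction. The elements `y₁` and `y₂` serve below as data for maps from
`F_{m,a}` and `F_{m+2,a+1}`. -/
theorem exists_of_not_isSplitMono_F (h : (F k (m + 1) a).obj ⟶ Y) (hh : ¬ IsSplitMono h) :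
    ∃ y₁ ∈ Y.M.deg (-a + m), ∃ y₂ ∈ Y.M.deg (-a - 1),
      Y.pr₀ (dehom _ (Obj.lin h (basisF k (m + 1) a (1, 0)))) =
        dehom _ y₁ + Y.pr₀ (dehom _ y₂) := by
  by_contra! hcon
  have hnot : Y.pr₀ (dehom _ (Obj.lin h (basisF k (m + 1) a (1, 0)))) ∉
      stage Y.M (-a + m) ⊔ (stage Y.M (-a - 1)).map Y.pr₀ := by
    intro hmem
    obtain ⟨_, ⟨y₁, hy₁, rfl⟩, _, ⟨_, ⟨y₂, hy₂, rfl⟩, rfl⟩, h12⟩ := Submodule.mem_sup.1 hmem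
    exact hcon y₁ hy₁ y₂ hy₂ h12.symm
  obtain ⟨l, hl, hl'⟩ := exists_dual_eq_one hnot
  obtain ⟨r, hr⟩ := exists_functionalF_eq (m + 1) a l
    (fun z hz => hl' z (Submodule.mem_sup_left (stage_mono _ (by push_cast; omega) hz)))
    (fun z hz => hl' _ (Submodule.mem_sup_right ⟨z, hz, rfl⟩))
  exact hh (IsSplitMono.mk' ⟨r, homFromF_ext_of_torsionFree (F k (m + 1) a).property
    ((Obj.lin_comp_apply h r _).trans
      (lin_eq_basisF r (Obj.lin_mem h basisF_fst_mem) (by rw [hr, hl])))⟩)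

/-- A vector of both subspaces on which the functional of `h` is nonzero would, after rescaling,
define a section. So zero on one subspace and this functional on the other can be glued. -/
theorem exists_of_not_isSplitEpi_F (h : Y ⟶ (F k (m + 1) a).obj) (hh : ¬ IsSplitEpi h) :
    ∃ l : locZero Y.M →ₗ[k] k, (∀ z ∈ stage Y.M (-a), l (Y.pr₀ z) = 0) ∧
      ∀ z ∈ stage Y.M (-a + m + 1), l z = functionalF h z := by
  obtain ⟨l, hl, hl'⟩ := exists_dual_of_inf ((stage Y.M (-a)).map Y.pr₀) (stage Y.M (-a + m + 1))
    (functionalF h) (by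
      rintro _ ⟨_, ⟨y, hy, rfl⟩, rfl⟩ ⟨y', hy', hyy'⟩
      by_contra h0
      set c := functionalF h (Y.pr₀ (dehom Y.M y)) with hc
      let s := homFromF (m + 1) a (c⁻¹ • y) (c⁻¹ • y') (Submodule.smul_mem _ _ hy)
        (Submodule.smul_mem _ _ (by rwa [Nat.cast_add, Nat.cast_one, ← add_assoc]))
        (by rw [map_smul, map_smul, map_smul, hyy'])
      have hs : Obj.lin s (basisF k (m + 1) a (1, 0)) = c⁻¹ • y := by
        rw [lin_homFromF, one_smul, zero_smul, add_zero]
      refine hh (IsSplitEpi.mk' ⟨s, homFromF_ext_of_torsionFree (F k (m + 1) a).property ?_⟩)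
      rw [Obj.lin_comp_apply, hs]
      refine lin_eq_basisF h (Submodule.smul_mem _ _ hy) ?_
      rw [map_smul, map_smul, map_smul, ← hc, smul_eq_mul, inv_mul_cancel₀ h0])
  exact ⟨l, fun z hz => hl _ ⟨z, hz, rfl⟩, hl'⟩

end Sections

section MiddleTerm

variable {m : ℕ} {a : ℤ} {B : Obj k} {f : (F k (m + 1) (a - 1)).obj ⟶ B}
  {g : B ⟶ (F k (m + 1) a).obj} {i₁ : (F k m (a - 1)).obj ⟶ B} {i₂ : (F k (m + 2) a).obj ⟶ B}
  {p₁ : B ⟶ (F k m (a - 1)).obj} {p₂ : B ⟶ (F k (m + 2) a).obj}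

theorem toPair_lin_desc {n n' n'' : ℕ} {b b' b'' : ℤ} {B : Obj k} {g : B ⟶ (F k n b).obj}
    {i₁ : (F k n' b').obj ⟶ B} {i₂ : (F k n'' b'').obj ⟶ B}
    {γ : (F k n' b').obj ⟶ (F k n b).obj} {δ : (F k n'' b'').obj ⟶ (F k n b).obj}
    (hg₁ : i₁ ≫ g = γ) (hg₂ : i₂ ≫ g = δ) (u : (F k n' b').obj.M) (w : (F k n'' b'').obj.M) :
    toPair (Obj.lin g (Obj.lin i₁ u + Obj.lin i₂ w)) =
      toPair (Obj.lin γ u) + toPair (Obj.lin δ w) := by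
  rw [map_add, ← Obj.lin_comp_apply, ← Obj.lin_comp_apply, hg₁, hg₂, toPair_add]

theorem toPair_lin_desc_F (hg₁ : i₁ ≫ g = mulXF k m (a - 1) a (by ring))
    (hg₂ : i₂ ≫ g = inclF k (m + 1) a) (u : (F k m (a - 1)).obj.M) (w : (F k (m + 2) a).obj.M) :
    toPair (Obj.lin g (Obj.lin i₁ u + Obj.lin i₂ w)) = (X, X) * toPair u + toPair w := by
  rw [toPair_lin_desc hg₁ hg₂, toPair_mulXF, toPair_inclF]

theorem toPair_lin_lift_F₁ (hf₁ : f ≫ p₁ = inclF k m (a - 1)) (z : (F k (m + 1) (a - 1)).obj.M) :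
    toPair (Obj.lin p₁ (Obj.lin f z)) = toPair z := by
  rw [← Obj.lin_comp_apply, hf₁, toPair_inclF]

theorem toPair_lin_lift_F₂ (hf₂ : f ≫ p₂ = -mulXF k (m + 1) (a - 1) a (by ring))
    (z : (F k (m + 1) (a - 1)).obj.M) :
    toPair (Obj.lin p₂ (Obj.lin f z)) = -((X, X) * toPair z) := by
  rw [← Obj.lin_comp_apply, hf₂, Obj.lin_neg_apply, toPair_neg, toPair_mulXF]

theorem lin_total {A₁ A₂ : Obj k} {i₁ : A₁ ⟶ B} {i₂ : A₂ ⟶ B} {p₁ : B ⟶ A₁} {p₂ : B ⟶ A₂}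
    (htotal : p₁ ≫ i₁ + p₂ ≫ i₂ = 𝟙 B) (x : B.M) :
    Obj.lin i₁ (Obj.lin p₁ x) + Obj.lin i₂ (Obj.lin p₂ x) = x := by
  rw [← Obj.lin_comp_apply, ← Obj.lin_comp_apply, ← Obj.lin_add_apply, htotal, Obj.lin_id_apply]

theorem comp_eq_zero_F (htotal : p₁ ≫ i₁ + p₂ ≫ i₂ = 𝟙 B) (hf₁ : f ≫ p₁ = inclF k m (a - 1))
    (hf₂ : f ≫ p₂ = -mulXF k (m + 1) (a - 1) a (by ring))
    (hg₁ : i₁ ≫ g = mulXF k m (a - 1) a (by ring)) (hg₂ : i₂ ≫ g = inclF k (m + 1) a) :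
    f ≫ g = 0 := Obj.hom_ext fun z => toPair_injective <| by
  rw [Obj.lin_comp_apply, ← lin_total htotal (Obj.lin f z), toPair_lin_desc_F hg₁ hg₂,
    toPair_lin_lift_F₁ hf₁, toPair_lin_lift_F₂ hf₂, add_neg_cancel, Obj.lin_zero_apply, toPair_zero]

theorem surjective_lin_desc_F (hg₁ : i₁ ≫ g = mulXF k m (a - 1) a (by ring))
    (hg₂ : i₂ ≫ g = inclF k (m + 1) a) : Function.Surjective (Obj.lin g) := fun c => by
  obtain ⟨q, hq⟩ := dvd_toPair c
  -- The difference of the components of `c` is `x ^ (m + 1) q`. Removing `x (q(0) x ^ m, 0)` leaves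
  -- `x ^ (m + 1) (q - q(0))`, and `x` divides `q - q(0)`.
  have hw : X ^ (m + 2) ∣ (toPair c - (X, X) * (C (q.coeff 0) * X ^ m, 0)).1 -
      (toPair c - (X, X) * (C (q.coeff 0) * X ^ m, 0)).2 := by
    obtain ⟨q', hq'⟩ := X_dvd_sub_C (p := q)
    refine ⟨q', ?_⟩
    simp only [Prod.fst_sub, Prod.snd_sub, Prod.fst_mul, Prod.snd_mul]
    linear_combination hq + X ^ (m + 1) * hq'
  refine ⟨Obj.lin i₁ (ofPair (C (q.coeff 0) * X ^ m, 0) (by simp)) + Obj.lin i₂ (ofPair _ hw),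
    toPair_injective ?_⟩
  rw [toPair_lin_desc_F hg₁ hg₂, toPair_ofPair, toPair_ofPair, add_sub_cancel]

theorem pow_dvd_sub_of_mul_add_eq_zero {u w : k[X] × k[X]} {m : ℕ} (h : (X, X) * u + w = 0)
    (hw : X ^ (m + 1) ∣ w.1 - w.2) : X ^ m ∣ u.1 - u.2 := by
  obtain ⟨q, hq⟩ := hw
  have h1 : X * u.1 + w.1 = 0 := congrArg Prod.fst h
  have h2 : X * u.2 + w.2 = 0 := congrArg Prod.snd h
  refine ⟨-q, mul_left_cancel₀ (X_ne_zero (R := k)) ?_⟩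
  linear_combination h1 - h2 - hq

theorem exact_F (htotal : p₁ ≫ i₁ + p₂ ≫ i₂ = 𝟙 B) (hf₁ : f ≫ p₁ = inclF k m (a - 1))
    (hf₂ : f ≫ p₂ = -mulXF k (m + 1) (a - 1) a (by ring))
    (hg₁ : i₁ ≫ g = mulXF k m (a - 1) a (by ring)) (hg₂ : i₂ ≫ g = inclF k (m + 1) a) (y : B.M)
    (hy : Obj.lin g y = 0) : ∃ z, Obj.lin f z = y := by
  have h1 : (X, X) * toPair (Obj.lin p₁ y) + toPair (Obj.lin p₂ y) = 0 := by
    rw [← toPair_lin_desc_F hg₁ hg₂, lin_total htotal, hy, toPair_zero]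
  obtain ⟨z, hz⟩ : ∃ z : (F k (m + 1) (a - 1)).obj.M, toPair z = toPair (Obj.lin p₁ y) :=
    ⟨ofPair _ (pow_dvd_sub_of_mul_add_eq_zero h1 (dvd_toPair (Obj.lin p₂ y))), toPair_ofPair _ _⟩
  have h3 : Obj.lin p₁ (Obj.lin f z) = Obj.lin p₁ y :=
    toPair_injective ((toPair_lin_lift_F₁ hf₁ z).trans hz)
  have h4 : Obj.lin p₂ (Obj.lin f z) = Obj.lin p₂ y :=
    toPair_injective ((toPair_lin_lift_F₂ hf₂ z).trans (by
      rw [hz]; exact neg_eq_of_add_eq_zero_right h1))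
  exact ⟨z, by rw [← lin_total htotal (Obj.lin f z), h3, h4, lin_total htotal]⟩

theorem hom_F_eq_zero_of_lt {m n : ℕ} {a b : ℤ} (hab : b < a)
    (f : (F k m a).obj ⟶ (F k n b).obj) : f = 0 :=
  homFromF_ext_of_torsionFree (F k n b).property <| by
    have h := (mem_deg_F (z := Obj.lin f (basisF k m a (1, 0)))).1 (Obj.lin_mem _ basisF_fst_mem)
    rw [polyDeg_eq_bot (by omega)] at h
    rw [Obj.lin_zero_apply]
    refine toPair_injective ?_
    rw [toPair_zero]
    exact Prod.ext ((Submodule.mem_bot k).1 h.1) ((Submodule.mem_bot k).1 h.2)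

/-- A section would keep the pair `(x ^ m, 0)`, whose components do not differ by a multiple of `x ^
(m + 1)`. -/
theorem comp_inclF_ne_id {m : ℕ} {a : ℤ} (t : (F k m a).obj ⟶ (F k (m + 1) a).obj) :
    t ≫ inclF k m a ≠ 𝟙 _ := fun h => by
  have h3 := toPair_inclF m a (Obj.lin t (basisF k m a (0, 1)))
  rw [← Obj.lin_comp_apply, h, Obj.lin_id_apply, toPair_basisF] at h3
  obtain ⟨q, hq⟩ := dvd_toPair (Obj.lin t (basisF k m a (0, 1)))
  rw [← h3] at hq
  have h4 := congrArg (fun p => p.coeff m) hq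
  simp [coeff_X_pow_mul'] at h4

/-- For degree reasons a section has no component in `F_{m,a-1}`; it would then split the inclusion
of `F_{m+2,a}`. -/
theorem not_isSplitEpi_F (htotal : p₁ ≫ i₁ + p₂ ≫ i₂ = 𝟙 B)
    (hg₂ : i₂ ≫ g = inclF k (m + 1) a) : ¬ IsSplitEpi g := fun hs => by
  have h1 : section_ g ≫ p₁ = 0 := hom_F_eq_zero_of_lt (by omega) _
  refine comp_inclF_ne_id (section_ g ≫ p₂) ?_
  rw [← IsSplitEpi.id g, ← hg₂]
  calc (section_ g ≫ p₂) ≫ i₂ ≫ g =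
      (section_ g ≫ p₁) ≫ i₁ ≫ g + (section_ g ≫ p₂) ≫ i₂ ≫ g := by
        rw [h1, Limits.zero_comp, zero_add]
    _ = section_ g ≫ (p₁ ≫ i₁ + p₂ ≫ i₂) ≫ g := by
        simp only [Preadditive.add_comp, Preadditive.comp_add, Category.assoc]
    _ = section_ g ≫ g := by rw [htotal, Category.id_comp]

/-- The functional of `h` is the sum of `l` and the remainder. The vanishing conditions make `l` a
map to `F_{m,a-1}` and the remainder a map to `F_{m+2,a}`, and composing with the arrows changes
neither. -/
theorem exists_lift_F (hg₁ : i₁ ≫ g = mulXF k m (a - 1) a (by ring))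
    (hg₂ : i₂ ≫ g = inclF k (m + 1) a) (Y : Obj k) (h : Y ⟶ (F k (m + 1) a).obj)
    (hh : ¬ IsSplitEpi h) : ∃ l : Y ⟶ B, l ≫ g = h := by
  obtain ⟨l, hl, hl'⟩ := exists_of_not_isSplitEpi_F h hh
  have hh0 : ∀ z ∈ stage Y.M (-a + m), functionalF h z = 0 := fun z hz =>
    functionalF_eq_zero_of_mem h (by
      rwa [show -a + ((m + 1 : ℕ) : ℤ) - 1 = -a + m by push_cast; ring])
  obtain ⟨t₁, ht₁⟩ := exists_functionalF_eq m (a - 1) l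
    (fun z hz => by
      have hz' := stage_mono _ (by omega : -(a - 1) + (m : ℤ) - 1 ≤ -a + m) hz
      rw [hl' z (stage_mono _ (by omega) hz'), hh0 z hz'])
    (fun z hz => hl z (by rwa [show -(a - 1) - 1 = -a by ring] at hz))
  obtain ⟨t₂, ht₂⟩ := exists_functionalF_eq (m + 2) a (functionalF h - l)
    (fun z hz => by
      rw [LinearMap.sub_apply, hl' z (stage_mono _ (by push_cast; omega) hz), sub_self])
    (fun z hz => by
      rw [LinearMap.sub_apply, functionalF_pr₀_eq_zero_of_mem h hz,
        hl z (stage_mono _ (by omega) hz), sub_self])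
  refine ⟨t₁ ≫ i₁ + t₂ ≫ i₂, functionalF_ext ?_⟩
  rw [Preadditive.add_comp, Category.assoc, Category.assoc, hg₁, hg₂, functionalF_add,
    functionalF_comp_mulXF, functionalF_comp_inclF, ht₁, ht₂]
  abel

theorem exists_desc_F (hf₁ : f ≫ p₁ = inclF k m (a - 1))
    (hf₂ : f ≫ p₂ = -mulXF k (m + 1) (a - 1) a (by ring)) (Y : Obj k)
    (h : (F k (m + 1) (a - 1)).obj ⟶ Y) (hh : ¬ IsSplitMono h) : ∃ l : B ⟶ Y, f ≫ l = h := by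
  obtain ⟨y₁, hy₁, y₂, hy₂, hyy⟩ := exists_of_not_isSplitMono_F h hh
  set y := Obj.lin h (basisF k (m + 1) (a - 1) (1, 0)) with hy
  set y' := Obj.lin h (basisF k (m + 1) (a - 1) (0, 1)) with hy'
  have hyd : y ∈ Y.M.deg (-(a - 1)) := Obj.lin_mem h basisF_fst_mem
  have hyd' : y' ∈ Y.M.deg (-(a - 1) + (m + 1 : ℕ)) := Obj.lin_mem h basisF_snd_mem
  have hpr : Y.pr₀ (dehom _ y) = dehom _ y' := pr₀_dehom_lin h
  -- From `pr₀ y = y₁ + pr₀ y₂` one gets `pr₀ (y - x y₂) = y₁` and `pr₀ y₂ = y' - x y₁` as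
  -- fractions. These are the data of the two maps, and the corrections `x y₂` and `x y₁` cancel in
  -- the sum.
  let t₁ := homFromF m (a - 1) (y - (X : k[X]) • y₂) y₁
    (sub_mem hyd (X_smul_mem hy₂ (by ring))) hy₁
    (by rw [map_sub, dehom_X_smul, map_sub, hyy, add_sub_cancel_right])
  let t₂ := homFromF (m + 2) a y₂ (y' - (X : k[X]) • y₁)
    (by rwa [show -(a - 1) - 1 = -a by ring] at hy₂)
    (sub_mem (by convert hyd' using 2; push_cast; ring)
      (X_smul_mem hy₁ (by push_cast; ring)))
    (by rw [map_sub, dehom_X_smul, ← hpr, hyy, add_sub_cancel_left])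
  refine ⟨p₁ ≫ t₁ - p₂ ≫ t₂, ?_⟩
  rw [Preadditive.comp_sub, ← Category.assoc, ← Category.assoc, hf₁, hf₂, Preadditive.neg_comp,
    sub_neg_eq_add]
  refine homFromF_ext ?_ ?_
  · rw [Obj.lin_add_apply, Obj.lin_comp_apply, Obj.lin_comp_apply, inclF, mulXF, lin_homFromF,
      lin_homFromF, ← hy]
    simp only [one_smul, zero_smul, add_zero, map_smul]
    rw [lin_homFromF, lin_homFromF]
    simp
  · rw [Obj.lin_add_apply, Obj.lin_comp_apply, Obj.lin_comp_apply, inclF, mulXF, lin_homFromF,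
      lin_homFromF, ← hy']
    simp only [one_smul, zero_smul, zero_add, map_smul]
    rw [lin_homFromF, lin_homFromF]
    simp

/-- The middle term is given only by its inclusions and projections, so that the biproduct formed in
`ℱ` can be used in `𝒞`. -/
theorem isAlmostSplit_F (htotal : p₁ ≫ i₁ + p₂ ≫ i₂ = 𝟙 B) (hf₁ : f ≫ p₁ = inclF k m (a - 1))
    (hf₂ : f ≫ p₂ = -mulXF k (m + 1) (a - 1) a (by ring))
    (hg₁ : i₁ ≫ g = mulXF k m (a - 1) a (by ring)) (hg₂ : i₂ ≫ g = inclF k (m + 1) a) :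
    IsAlmostSplit f g :=
  Obj.isAlmostSplit_of_exact (comp_eq_zero_F htotal hf₁ hf₂ hg₁ hg₂)
    (fun x y hxy => toPair_injective (by
      rw [← toPair_lin_lift_F₁ hf₁ x, hxy, toPair_lin_lift_F₁ hf₁]))
    (surjective_lin_desc_F hg₁ hg₂) (exact_F htotal hf₁ hf₂ hg₁ hg₂) (not_isSplitEpi_F htotal hg₂)
    (exists_lift_F hg₁ hg₂) (exists_desc_F hf₁ hf₂)

end MiddleTerm

end AlmostSplit

/-! ### The almost split sequences ending in `F^i_{0a}`. -/

section AlmostSplitFactors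

variable {k : Type u} [Field k]

theorem eval_proj_ite (i j : ZMod 2) (p : k[X]) :
    (proj k j (if i = 0 then (p, 0) else (0, p))) = if i = j then p else 0 := by
  have h1 : (1 : ZMod 2) ≠ 0 := by decide
  obtain rfl | rfl := zmod_two_cases i <;> obtain rfl | rfl := zmod_two_cases j <;>
    simp [proj_zero, proj_one, h1, h1.symm]

theorem one_sub_ne (i : ZMod 2) : 1 - i ≠ i := by revert i; decide

variable (k) in
/-- The pair whose `i`-th component is `x` and whose other component is zero. -/
def axis (i : ZMod 2) (a : ℤ) : (F k 1 a).obj.M :=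
  ofPair (if i = 0 then (X, 0) else (0, X)) (by split_ifs <;> simp)

theorem axis_mem (i : ZMod 2) (a : ℤ) : axis k i a ∈ (F k 1 a).obj.M.deg (-(a - 1)) := by
  rw [mem_deg_F, axis, toPair_ofPair, show -(a - 1) + a = 1 by ring]
  split_ifs
  · exact ⟨X_mem_polyDeg, zero_mem _⟩
  · exact ⟨zero_mem _, X_mem_polyDeg⟩

theorem pr_dehom_axis (i : ZMod 2) (a : ℤ) :
    (F k 1 a).obj.pr i (dehom _ (axis k i a)) = dehom _ (axis k i a) := by
  refine locZero_F_ext fun j => ?_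
  rw [evF_pr, evF_dehom, axis, toPair_ofPair, eval_proj_ite]
  split_ifs with h h' h'
  · rfl
  · rfl
  · exact absurd h'.symm h
  · rw [eval_zero]

variable (k) in
/-- The map `F^{1-i}_{0,a-1} → F_{1a}` given by multiplication by `x`. -/
def inFactor (i : ZMod 2) (a : ℤ) : (F₀ k (1 - i) (a - 1)).obj ⟶ (F k 1 a).obj :=
  homFromF₀ (1 - i) (a - 1) (axis k (1 - i) a) (axis_mem _ _) (pr_dehom_axis _ _)

variable (k) in
/-- The `i`-th projection `F_{1a} → F^i_{0a}`. -/
def toFactor (i : ZMod 2) (a : ℤ) : (F k 1 a).obj ⟶ (F₀ k i a).obj :=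
  homFromF 1 a (ofPoly 1) (ofPoly (if i = 0 then X else 0)) ofPoly_one_mem
    (mem_deg_F₀.2 (by
      rw [toPoly_ofPoly, show -a + ((1 : ℕ) : ℤ) + a = 1 by push_cast; ring]
      split_ifs
      exacts [X_mem_polyDeg, zero_mem _]))
    (locZero_F₀_ext (by
      rw [F₀_pr₀]
      split_ifs
      · simp [evF₀_dehom]
      · simp [evF₀_dehom]))

theorem toPair_inFactor (i : ZMod 2) (a : ℤ) (z : (F₀ k (1 - i) (a - 1)).obj.M) :
    toPair (Obj.lin (inFactor k i a) z) =
      (toPoly z, toPoly z) * (if 1 - i = 0 then (X, 0) else (0, X)) := by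
  rw [inFactor, lin_homFromF₀, toPair_smul]; rfl

theorem proj_pair (i : ZMod 2) (p : k[X]) : proj k i (p, p) = p := by
  obtain rfl | rfl := zmod_two_cases i
  · rfl
  · exact proj_one _

theorem proj_inFactor (i j : ZMod 2) (a : ℤ) (z : (F₀ k (1 - i) (a - 1)).obj.M) :
    proj k j (toPair (Obj.lin (inFactor k i a) z)) = if 1 - i = j then X * toPoly z else 0 := by
  rw [toPair_inFactor, map_mul, eval_proj_ite, proj_pair]
  split_ifs
  · rw [mul_comm]
  · rw [mul_zero]

theorem toPoly_toFactor (i : ZMod 2) (a : ℤ) (z : (F k 1 a).obj.M) :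
    toPoly (Obj.lin (toFactor k i a) z) = proj k i (toPair z) := by
  obtain ⟨⟨p, q⟩, rfl⟩ := (basisF k 1 a).surjective z
  rw [toFactor, lin_homFromF, toPair_basisF]
  change toPoly (p • ofPoly 1 : (F₀ k i a).obj.M) + toPoly (q • ofPoly _ : (F₀ k i a).obj.M) = _
  rw [toPoly_smul, toPoly_smul, toPoly_ofPoly, toPoly_ofPoly]
  obtain rfl | rfl := zmod_two_cases i
  · simp [proj_zero]
  · simp [proj_one]

theorem functionalF₀_comp_toFactor (i : ZMod 2) (a : ℤ) {Y : Obj k} (h : Y ⟶ (F k 1 a).obj)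
    (z : locZero Y.M) : functionalF₀ (h ≫ toFactor k i a) z = evF 1 a i (locMap (Obj.res h) z) := by
  obtain ⟨x, rfl⟩ := dehom_surjective _ z
  change evF₀ k i a _ = _
  rw [Obj.locMap_res_dehom, Obj.locMap_res_dehom, evF₀_dehom, evF_dehom, Obj.lin_comp_apply,
    toPoly_toFactor]

theorem lin_eq_ofPoly_one {i : ZMod 2} {a : ℤ} {Y : Obj k} (h : Y ⟶ (F₀ k i a).obj) {y : Y.M}
    (hy : y ∈ Y.M.deg (-a)) (hl : functionalF₀ h (dehom _ y) = 1) : Obj.lin h y = ofPoly 1 := by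
  refine dehom_injOn (F₀ k i a).property (Obj.lin_mem h hy) ofPoly_one_mem (locZero_F₀_ext ?_)
  rw [← Obj.locMap_res_dehom, evF₀_dehom, toPoly_ofPoly, eval_one]
  exact hl

/-- Otherwise a functional `l` is `1` at the image of `1` and kills `pr i` of the stage `-a - 1`;
then `l ∘ pr i` is a retraction. -/
theorem exists_of_not_isSplitMono_F₀ {i : ZMod 2} {a : ℤ} {Y : Obj k} (h : (F₀ k i a).obj ⟶ Y)
    (hh : ¬ IsSplitMono h) :
    ∃ w ∈ Y.M.deg (-a - 1), Y.pr i (dehom _ w) = dehom _ (Obj.lin h (ofPoly 1)) := by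
  by_contra! hcon
  have hnot : dehom _ (Obj.lin h (ofPoly 1)) ∉ (stage Y.M (-a - 1)).map (Y.pr i) := by
    rintro ⟨_, ⟨w, hw, rfl⟩, h12⟩
    exact hcon w hw h12
  obtain ⟨l, hl, hl'⟩ := exists_dual_eq_one hnot
  obtain ⟨r, hr⟩ := exists_functionalF₀_eq i a (l ∘ₗ Y.pr i)
    (fun z => congrArg l (Y.pr_self i z)) (fun z hz => hl' _ ⟨z, hz, rfl⟩)
  refine hh (IsSplitMono.mk' ⟨r, homFromF₀_ext ((Obj.lin_comp_apply h r _).trans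
    (lin_eq_ofPoly_one r (Obj.lin_mem h ofPoly_one_mem) ?_))⟩)
  rw [hr, LinearMap.comp_apply, pr_dehom_lin_ofPoly, hl]

/-- Gluing works as for `F_{m+1,a}`. The functional is not asked to be invariant under `pr i`: its
values on the other summand supply the second component of a lift to `F_{1a}`. -/
theorem exists_of_not_isSplitEpi_F₀ {i : ZMod 2} {a : ℤ} {Y : Obj k} (h : Y ⟶ (F₀ k i a).obj)
    (hh : ¬ IsSplitEpi h) :
    ∃ l : locZero Y.M →ₗ[k] k, (∀ z ∈ stage Y.M (-a), l z = 0) ∧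
      ∀ z, l (Y.pr i z) = functionalF₀ h z := by
  obtain ⟨l, hl, hl'⟩ := exists_dual_of_inf (stage Y.M (-a)) (LinearMap.range (Y.pr i))
    (functionalF₀ h) (by
      rintro _ ⟨y, hy, rfl⟩ ⟨w, hw⟩
      by_contra h0
      set c := functionalF₀ h (dehom Y.M y) with hc
      have hpr : Y.pr i (dehom Y.M y) = dehom Y.M y := by rw [← hw, Obj.pr_self]
      let s := homFromF₀ i a (c⁻¹ • y) (Submodule.smul_mem _ _ hy) (by
        rw [map_smul, map_smul, hpr])
      have hs : Obj.lin s (ofPoly 1) = c⁻¹ • y := by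
        rw [lin_homFromF₀, toPoly_ofPoly, one_smul]
      refine hh (IsSplitEpi.mk' ⟨s, homFromF₀_ext ?_⟩)
      rw [Obj.lin_comp_apply, hs]
      refine lin_eq_ofPoly_one h (Submodule.smul_mem _ _ hy) ?_
      rw [map_smul, map_smul, ← hc, smul_eq_mul, inv_mul_cancel₀ h0])
  exact ⟨l, hl, fun z => by rw [hl' _ ⟨z, rfl⟩, functionalF₀_pr]⟩

variable (i : ZMod 2) (a : ℤ)

theorem inFactor_toFactor : inFactor k i a ≫ toFactor k i a = 0 := Obj.hom_ext fun z => by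
  change toPoly (Obj.lin (toFactor k i a) (Obj.lin (inFactor k i a) z)) = 0
  rw [toPoly_toFactor, proj_inFactor, if_neg (one_sub_ne i)]

theorem injective_inFactor : Function.Injective (Obj.lin (inFactor k i a)) := fun z w h => by
  have h1 := congrArg (fun t => proj k (1 - i) (toPair t)) h
  simp only [proj_inFactor, if_pos] at h1
  exact show toPoly z = toPoly w from mul_left_cancel₀ X_ne_zero h1

theorem surjective_toFactor : Function.Surjective (Obj.lin (toFactor k i a)) := fun z => by
  refine ⟨ofPair (toPoly z, toPoly z) (by simp), ?_⟩
  have := toPoly_toFactor i a (ofPair (toPoly z, toPoly z) (by simp))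
  rw [toPair_ofPair, proj_pair] at this
  exact this

theorem pair_ext {z w : k[X] × k[X]} (i : ZMod 2) (h : proj k i z = proj k i w)
    (h' : proj k (1 - i) z = proj k (1 - i) w) : z = w := by
  obtain rfl | rfl := zmod_two_cases i
  · rw [sub_zero, proj_one, proj_one] at h'
    exact Prod.ext h h'
  · rw [sub_self] at h'
    rw [proj_one, proj_one] at h
    exact Prod.ext h' h

theorem exact_factor (y : (F k 1 a).obj.M) (hy : Obj.lin (toFactor k i a) y = 0) :
    ∃ z, Obj.lin (inFactor k i a) z = y := by
  have h1 : proj k i (toPair y) = 0 := by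
    rw [← toPoly_toFactor, hy]; rfl
  obtain ⟨q, hq⟩ : X ∣ proj k (1 - i) (toPair y) := by
    have := dvd_toPair y
    rw [pow_one] at this
    obtain rfl | rfl := zmod_two_cases i
    · rw [proj_zero] at h1
      rw [sub_zero, proj_one]
      rwa [h1, zero_sub, dvd_neg] at this
    · rw [proj_one] at h1
      rw [sub_self, proj_zero]
      rwa [h1, sub_zero] at this
  refine ⟨ofPoly q, toPair_injective (pair_ext i ?_ ?_)⟩
  · rw [proj_inFactor, if_neg (one_sub_ne i), h1]
  · rw [proj_inFactor, if_pos rfl, hq, toPoly_ofPoly]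

/-- The image of `1` has degree `-a`, so it is a multiple of `(1, 1)`, but its component of index `1
- i` must vanish. -/
theorem hom_F₀_F_eq_zero {i : ZMod 2} {m : ℕ} {a : ℤ}
    (f : (F₀ k i a).obj ⟶ (F k (m + 1) a).obj) : f = 0 := by
  have h1 := (mem_deg_F (z := Obj.lin f (ofPoly 1))).1 (Obj.lin_mem f ofPoly_one_mem)
  rw [neg_add_cancel] at h1
  have h2 := eq_smul_one_of_mem_RDeg_zero (m := m)
    (z := (show R k (m + 1) from Obj.lin f (ofPoly 1))) h1
  set c : k := (proj k 0 (toPair (Obj.lin f (ofPoly 1)))).coeff 0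
  have h3 : toPair (Obj.lin f (ofPoly 1)) = c • (1, 1) := congrArg Subtype.val h2
  have h4 := congrArg (evF (k := k) (m + 1) a (1 - i)) (pr_dehom_lin_ofPoly f)
  rw [evF_pr, if_neg (one_sub_ne i), evF_dehom, h3, map_smul, proj_pair, eval_smul, eval_one,
    smul_eq_mul, mul_one] at h4
  refine homFromF₀_ext (toPair_injective ?_)
  rw [h3, ← h4, zero_smul, Obj.lin_zero_apply, toPair_zero]

theorem toFactor_not_isSplitEpi : ¬ IsSplitEpi (toFactor k i a) := fun h => by
  have h1 := IsSplitEpi.id (toFactor k i a)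
  rw [hom_F₀_F_eq_zero (m := 0) (section_ (toFactor k i a)), Limits.zero_comp] at h1
  have h2 : (0 : k[X]) = 1 := congrArg (fun f => toPoly (Obj.lin f (ofPoly 1))) h1
  exact zero_ne_one h2

theorem exists_lift_toFactor (Y : Obj k) (h : Y ⟶ (F₀ k i a).obj) (hh : ¬ IsSplitEpi h) :
    ∃ l : Y ⟶ (F k 1 a).obj, l ≫ toFactor k i a = h := by
  obtain ⟨l, hl, hl'⟩ := exists_of_not_isSplitEpi_F₀ h hh
  have hl0 : ∀ z ∈ stage Y.M (-a - 1), ∀ j, l (Y.pr j z) = 0 := fun z hz => by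
    have h1 : l (Y.pr i z) = 0 := by rw [hl', functionalF₀_eq_zero_of_mem h hz]
    have h2 : l (Y.pr (1 - i) z) = 0 := by
      have h3 := congrArg l (Y.pr_add i z)
      rwa [map_add, h1, zero_add, hl z (stage_mono _ (by omega) hz)] at h3
    have h3 : ∀ i j : ZMod 2, j = i ∨ j = 1 - i := by decide
    intro j
    obtain rfl | rfl := h3 i j
    exacts [h1, h2]
  have h1 : (1 : ZMod 2) ≠ 0 := by decide
  -- The component of index `1` is `L (pr₀ z) - L z = -L (pr 1 z)` for a functional `L`; hence the
  -- sign.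
  obtain ⟨t, ht⟩ := exists_functionalF_eq 1 a (if i = 0 then l else -l)
    (fun z hz => by
      rw [Nat.cast_one, add_sub_cancel_right] at hz
      split_ifs <;> simp [hl z hz])
    (fun z hz => by
      have := hl0 z hz 0
      rw [Obj.pr_zero] at this
      split_ifs <;> simp [this])
  refine ⟨t, functionalF₀_ext (LinearMap.ext fun z => ?_)⟩
  rw [functionalF₀_comp_toFactor, ← hl']
  obtain rfl | rfl := zmod_two_cases i
  · rw [← functionalF_pr₀, ht, if_pos rfl, Obj.pr_zero]
  · rw [evF_one_locMap, ht, if_neg h1, Obj.pr_one, map_sub, LinearMap.neg_apply,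
      LinearMap.neg_apply]
    ring

theorem exists_desc_inFactor (Y : Obj k) (h : (F₀ k (1 - i) (a - 1)).obj ⟶ Y)
    (hh : ¬ IsSplitMono h) : ∃ l : (F k 1 a).obj ⟶ Y, inFactor k i a ≫ l = h := by
  obtain ⟨w, hw, hwy⟩ := exists_of_not_isSplitMono_F₀ h hh
  set y := Obj.lin h (ofPoly 1) with hy
  have hyd : y ∈ Y.M.deg (-a + (1 : ℕ)) := by
    have := Obj.lin_mem h ofPoly_one_mem
    rwa [show -(a - 1) = -a + ((1 : ℕ) : ℤ) by push_cast; ring] at this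
  rw [show -(a - 1) - 1 = -a by ring] at hw
  obtain rfl | rfl := zmod_two_cases i
  · rw [sub_zero, Obj.pr_one] at hwy
    -- Here `F^1_{0,a-1}` has image generated by `(0, x) = x (1, 1) - (x, 0)`, so `(x, 0)` must go
    -- to `x w - y`.
    let t := homFromF 1 a w ((X : k[X]) • w - y) hw
      (sub_mem (X_smul_mem hw (by push_cast; ring)) hyd)
      (by rw [map_sub, dehom_X_smul, ← hwy, sub_sub_cancel])
    refine ⟨t, homFromF₀_ext ?_⟩
    have h1 : axis k (1 - 0) a = basisF k 1 a (X, -1) := toPair_injective (by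
      rw [toPair_basisF, axis, toPair_ofPair, if_neg (by decide)]
      simp)
    rw [Obj.lin_comp_apply, inFactor, lin_homFromF₀, toPoly_ofPoly, one_smul, h1, lin_homFromF]
    rw [neg_one_smul]
    abel
  · rw [sub_self, Obj.pr_zero] at hwy
    let t := homFromF 1 a w y hw hyd hwy
    refine ⟨t, homFromF₀_ext ?_⟩
    have h1 : axis k (1 - 1) a = basisF k 1 a (0, 1) := toPair_injective (by
      rw [toPair_basisF, axis, toPair_ofPair, if_pos (by decide)]
      simp)
    rw [Obj.lin_comp_apply, inFactor, lin_homFromF₀, toPoly_ofPoly, one_smul, h1, lin_homFromF]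
    rw [zero_smul, one_smul, zero_add]

theorem isAlmostSplit_factor : IsAlmostSplit (inFactor k i a) (toFactor k i a) :=
  Obj.isAlmostSplit_of_exact (inFactor_toFactor i a) (injective_inFactor i a)
    (surjective_toFactor i a) (exact_factor i a) (toFactor_not_isSplitEpi i a)
    (exists_lift_toFactor i a) (exists_desc_inFactor i a)

end AlmostSplitFactors

/-! ### Classification of the torsion free indecomposables. -/

section Classification

variable {k : Type u} [Field k]

theorem exists_eq_smul_basisF {m : ℕ} {a : ℤ} {z : (F k (m + 1) a).obj.M}
    (hz : z ∈ (F k (m + 1) a).obj.M.deg (-a)) : ∃ c : k, z = c • basisF k (m + 1) a (1, 0) := by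
  have h1 := mem_deg_F.1 hz
  rw [neg_add_cancel] at h1
  have h2 := eq_smul_one_of_mem_RDeg_zero (m := m) (z := (show R k (m + 1) from z)) h1
  refine ⟨(proj k 0 (toPair z)).coeff 0, toPair_injective ((congrArg Subtype.val h2).trans ?_)⟩
  rw [toPair_scalar, toPair_basisF]
  refine congrArg ((proj k 0 (toPair z)).coeff 0 • ·) (?_ : (1 : k[X] × k[X]) = _)
  simp
  rfl

theorem isBrick_F (m : ℕ) (a : ℤ) : IsBrick k (F k (m + 1) a).obj where
  id_ne_zero h := by
    have h1 := congrArg (fun f => toPair (Obj.lin f (basisF k (m + 1) a (1, 0)))) h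
    simp only [Obj.lin_id_apply, Obj.lin_zero_apply, toPair_zero, toPair_basisF] at h1
    exact one_ne_zero (congrArg Prod.snd h1)
  exists_smul f := by
    obtain ⟨c, hc⟩ := exists_eq_smul_basisF (Obj.lin_mem f basisF_fst_mem)
    exact ⟨c, homFromF_ext_of_torsionFree (F k (m + 1) a).property hc⟩

theorem isBrick_F₀ (i : ZMod 2) (a : ℤ) : IsBrick k (F₀ k i a).obj where
  id_ne_zero h := (one_ne_zero : (1 : k[X]) ≠ 0)
    (congrArg (fun f => toPoly (Obj.lin f (ofPoly 1))) h)
  exists_smul f := by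
    have h1 := (mem_deg_F₀ (z := Obj.lin f (ofPoly 1))).1 (Obj.lin_mem f ofPoly_one_mem)
    rw [neg_add_cancel] at h1
    refine ⟨(toPoly (Obj.lin f (ofPoly 1))).coeff 0, homFromF₀_ext ?_⟩
    refine (eq_C_of_mem_polyDeg_zero h1).trans ?_
    exact ((smul_eq_C_mul (p := (1 : k[X])) _).trans (mul_one _)).symm

theorem IsBrick.of_obj {X : TF k} (h : IsBrick k X.obj) : IsBrick k X where
  id_ne_zero h0 := h.id_ne_zero (congrArg InducedCategory.Hom.hom h0)
  exists_smul f := (h.exists_smul f.hom).imp fun _ hc => ObjectProperty.hom_ext _ hc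

theorem deg_F_eq_bot {m : ℕ} {a n : ℤ} (hn : n < -a) : (F k m a).obj.M.deg n = ⊥ :=
  RDeg_eq_bot m (by omega : n + a < 0)

theorem deg_F₀_eq_bot {i : ZMod 2} {a n : ℤ} (hn : n < -a) : (F₀ k i a).obj.M.deg n = ⊥ :=
  polyDeg_eq_bot (by omega : n + a < 0)

theorem hom_F_eq_zero_of_deg {m : ℕ} {a : ℤ} {Y : Obj k} (hY : torsionFree k Y)
    (h : Y.M.deg (-a) = ⊥) (f : (F k m a).obj ⟶ Y) : f = 0 :=
  homFromF_ext_of_torsionFree hY <| by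
    have h1 := Obj.lin_mem f basisF_fst_mem
    rw [h] at h1
    exact (Submodule.mem_bot k).1 h1

theorem hom_F₀_eq_zero_of_deg {i : ZMod 2} {a : ℤ} {Y : Obj k}
    (h : Y.M.deg (-a) = ⊥) (f : (F₀ k i a).obj ⟶ Y) : f = 0 :=
  homFromF₀_ext <| by
    have h1 := Obj.lin_mem f ofPoly_one_mem
    rw [h] at h1
    exact (Submodule.mem_bot k).1 h1

theorem functionalF_zero {Y : Obj k} {m : ℕ} {a : ℤ} :
    functionalF (0 : Y ⟶ (F k m a).obj) = 0 := by
  have h := functionalF_add (0 : Y ⟶ (F k m a).obj) 0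
  rw [add_zero] at h
  exact left_eq_add.1 h

/-- The generators of the source have degrees `-a` and `-a + m + 1`, both at most `-a + n`, where
the functional of a map to `F_{n+1,a}` vanishes. In the other direction there are inclusions. -/
theorem hom_F_F_eq_zero {m n : ℕ} {a : ℤ} (hmn : m < n)
    (f : (F k (m + 1) a).obj ⟶ (F k (n + 1) a).obj) : f = 0 := by
  have h1 : functionalF f (dehom _ (basisF k (m + 1) a (1, 0))) = 0 :=
    functionalF_eq_zero_of_mem f
      (stage_mono _ (by push_cast; omega) (dehom_mem_stage basisF_fst_mem))
  have h2 : functionalF f (dehom _ (basisF k (m + 1) a (0, 1))) = 0 :=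
    functionalF_eq_zero_of_mem f
      (stage_mono _ (by push_cast; omega) (dehom_mem_stage basisF_snd_mem))
  refine functionalF_ext (locZero_linearMap_ext fun n x _ => ?_)
  obtain ⟨⟨p, q⟩, rfl⟩ := (basisF k (m + 1) a).surjective x
  have h3 : ((p, q) : k[X] × k[X]) = p • (1, 0) + q • (0, 1) := by simp
  rw [h3, map_add, map_smul, map_smul, map_add, dehom_smul, dehom_smul, map_add, map_smul,
    map_smul, h1, h2, smul_zero, smul_zero, add_zero, functionalF_zero, LinearMap.zero_apply]

theorem hom_F₀_F₀_eq_zero {i j : ZMod 2} {a : ℤ} (hij : i ≠ j)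
    (f : (F₀ k i a).obj ⟶ (F₀ k j a).obj) : f = 0 := by
  have h1 := pr_dehom_lin_ofPoly f
  rw [F₀_pr, if_neg hij.symm] at h1
  exact homFromF₀_ext (eq_zero_of_dehom_eq_zero (F₀ k j a).property
    (Obj.lin_mem f ofPoly_one_mem) h1.symm)

/-- Since degree `-a - 1` is zero, the term `y₂` disappears from the decomposition, and the lift of
`pr₀ y` moves down by one degree. At degree `-a` both `pr₀ y` and its complement come from elements
of `X`, and the case of `F^i_{0a}` kills them. -/
theorem deg_eq_bot_of_forall_not_isSplitMono {X : Obj k} (hX : torsionFree k X) {a : ℤ}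
    (hF : ∀ (m : ℕ) (s : (F k (m + 1) a).obj ⟶ X), ¬ IsSplitMono s)
    (hF₀ : ∀ (i : ZMod 2) (s : (F₀ k i a).obj ⟶ X), ¬ IsSplitMono s)
    (h : X.M.deg (-a - 1) = ⊥) : X.M.deg (-a) = ⊥ := by
  have h₀ : ∀ i, ∀ y ∈ X.M.deg (-a), X.pr i (dehom _ y) = dehom _ y → y = 0 := by
    intro i y hy hyi
    obtain ⟨w, hw, hwy⟩ := exists_of_not_isSplitMono_F₀ _ (hF₀ i (homFromF₀ i a y hy hyi))
    rw [h, Submodule.mem_bot] at hw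
    rw [lin_homFromF₀, toPoly_ofPoly, one_smul, hw, map_zero, map_zero] at hwy
    exact eq_zero_of_dehom_eq_zero hX hy hwy.symm
  have key : ∀ m : ℕ, ∀ y ∈ X.M.deg (-a), ∀ y' ∈ X.M.deg (-a + m),
      X.pr₀ (dehom _ y) = dehom _ y' → y = 0 := by
    intro m
    induction m with
    | zero =>
      intro y hy y' hy' hyy
      rw [Nat.cast_zero, add_zero] at hy'
      have h1 : y' = 0 := h₀ 0 y' hy' (by rw [Obj.pr_zero, ← hyy, Obj.pr₀_pr₀])
      refine h₀ 1 y hy ?_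
      rw [Obj.pr_one, hyy, h1, map_zero, sub_zero]
    | succ m ih =>
      intro y hy y' hy' hyy
      obtain ⟨y₁, hy₁, y₂, hy₂, h12⟩ :=
        exists_of_not_isSplitMono_F _ (hF m (homFromF (m + 1) a y y' hy hy' hyy))
      rw [h, Submodule.mem_bot] at hy₂
      rw [lin_homFromF, one_smul, zero_smul, add_zero, hy₂, map_zero, map_zero, add_zero] at h12
      exact ih y hy y₁ hy₁ h12
  rw [eq_bot_iff]
  intro y hy
  -- The fraction `pr₀ y` has a numerator in some degree at least `-a`, which starts the descent.
  obtain ⟨n, hn, y', hy', hyy⟩ := exists_dehom_eq (X.pr₀ (dehom _ y)) (-a).toNat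
  exact key (n + a).toNat y hy y' (by convert hy' using 2; omega) hyy.symm

/-- If nothing splits off, the vanishing below some degree propagates upwards to all degrees. -/
theorem exists_isSplitMono {X : Obj k} (hX : torsionFree k X) (hX0 : ¬ IsZero X) :
    (∃ (m : ℕ) (a : ℤ) (s : (F k (m + 1) a).obj ⟶ X), IsSplitMono s) ∨
      ∃ (i : ZMod 2) (a : ℤ) (s : (F₀ k i a).obj ⟶ X), IsSplitMono s := by
  by_contra! hcon
  obtain ⟨hF, hF₀⟩ := hcon
  obtain ⟨b, hb⟩ := exists_deg_eq_bot X.M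
  have key : ∀ j : ℕ, X.M.deg (b - 1 + j) = ⊥ := fun j => by
    induction j with
    | zero => exact hb _ (by simp)
    | succ j ih =>
      have := deg_eq_bot_of_forall_not_isSplitMono hX (a := -(b - 1 + (j + 1 : ℕ)))
        (fun m s => hF m _ s) (fun i s => hF₀ i _ s)
        (by rw [show - -(b - 1 + ((j + 1 : ℕ) : ℤ)) - 1 = b - 1 + j by push_cast; ring]; exact ih)
      rwa [neg_neg] at this
  have hdeg : ∀ n, X.M.deg n = ⊥ := fun n => by
    rcases lt_or_ge n b with h | h
    · exact hb n h
    · have := key (n - (b - 1)).toNat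
      rwa [show b - 1 + ((n - (b - 1)).toNat : ℤ) = n by omega] at this
  refine hX0 ((IsZero.iff_id_eq_zero X).2 (Obj.hom_ext_deg fun n x hx => ?_))
  rw [hdeg n, Submodule.mem_bot] at hx
  rw [hx, map_zero, map_zero]

theorem torsionFree_of_iso {X Y : Obj k} (e : X ≅ Y) (hY : torsionFree k Y) : torsionFree k X :=
  fun x hx => by
    have h1 : Obj.lin e.hom x = 0 := hY _ (by rw [← map_smul, hx, map_zero])
    rw [← Obj.lin_id_apply x, ← e.hom_inv_id, Obj.lin_comp_apply, h1, map_zero]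

theorem torsionFree_and_indecomposable_iff (X : Obj k) :
    (torsionFree k X ∧ Indecomposable X) ↔
      ((∃ (m : ℕ) (a : ℤ), Nonempty (X ≅ (F k (m + 1) a).obj)) ∨
        ∃ (i : ZMod 2) (a : ℤ), Nonempty (X ≅ (F₀ k i a).obj)) := by
  constructor
  · rintro ⟨hX, hX'⟩
    obtain ⟨m, a, s, hs⟩ | ⟨i, a, s, hs⟩ := exists_isSplitMono hX hX'.1
    · have := isIso_of_isSplitMono_of_indecomposable hX' (isBrick_F m a).not_isZero s
      exact Or.inl ⟨m, a, ⟨(asIso s).symm⟩⟩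
    · have := isIso_of_isSplitMono_of_indecomposable hX' (isBrick_F₀ i a).not_isZero s
      exact Or.inr ⟨i, a, ⟨(asIso s).symm⟩⟩
  · rintro (⟨m, a, ⟨e⟩⟩ | ⟨i, a, ⟨e⟩⟩)
    · exact ⟨torsionFree_of_iso e (F k (m + 1) a).property,
        ((isBrick_F m a).of_iso e.symm).indecomposable⟩
    · exact ⟨torsionFree_of_iso e (F₀ k i a).property,
        ((isBrick_F₀ i a).of_iso e.symm).indecomposable⟩

variable (k) in
theorem isBrick_label (p : ZQuiver DInfty) : IsBrick k (label k p) := by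
  obtain ⟨a, _ | _⟩ := p
  · exact (isBrick_F₀ _ a).of_obj
  · exact (isBrick_F _ a).of_obj

/-- A map out of a label at level `a` into a torsion free object is determined by the image of an
element of degree `-a`, and labels at smaller levels vanish in that degree. -/
theorem le_of_label_hom_ne_zero {p q : ZQuiver DInfty} {f : label k p ⟶ label k q} (hf : f ≠ 0) :
    p.n ≤ q.n := by
  by_contra! h
  refine hf (ObjectProperty.hom_ext _ ?_)
  obtain ⟨a, _ | _⟩ := p <;> obtain ⟨b, _ | _⟩ := q
  · exact hom_F₀_eq_zero_of_deg (deg_F₀_eq_bot (neg_lt_neg h)) _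
  · exact hom_F₀_eq_zero_of_deg (deg_F_eq_bot (neg_lt_neg h)) _
  · exact hom_F_eq_zero_of_deg (F₀ k _ b).property (deg_F₀_eq_bot (neg_lt_neg h)) _
  · exact hom_F_eq_zero_of_deg (F k _ b).property (deg_F_eq_bot (neg_lt_neg h)) _

/-- Nonzero maps in both directions force equal levels. Between different labels of one level, at
least one direction has only the zero map. -/
theorem eq_of_label_iso (p q : ZQuiver DInfty) (h : Nonempty (label k p ≅ label k q)) : p = q := by
  obtain ⟨e⟩ := h
  have h1 : e.hom ≠ 0 := fun h0 => (isBrick_label k p).id_ne_zero (by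
    rw [← e.hom_inv_id, h0, Limits.zero_comp])
  have h2 : e.inv ≠ 0 := fun h0 => (isBrick_label k p).id_ne_zero (by
    rw [← e.hom_inv_id, h0, Limits.comp_zero])
  have h3 := le_antisymm (le_of_label_hom_ne_zero h1) (le_of_label_hom_ne_zero h2)
  obtain ⟨a, v⟩ := p
  obtain ⟨b, w⟩ := q
  obtain rfl : a = b := h3
  congr 1
  by_contra hvw
  obtain i | m := v <;> obtain j | n := w
  · refine h1 (ObjectProperty.hom_ext _ (hom_F₀_F₀_eq_zero (fun hij => hvw ?_) _))
    rw [add_right_cancel hij]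
  · exact h1 (ObjectProperty.hom_ext _ (hom_F₀_F_eq_zero _))
  · exact h2 (ObjectProperty.hom_ext _ (hom_F₀_F_eq_zero _))
  · rcases lt_trichotomy m n with hmn | rfl | hmn
    · exact h1 (ObjectProperty.hom_ext _ (hom_F_F_eq_zero hmn _))
    · exact hvw rfl
    · exact h2 (ObjectProperty.hom_ext _ (hom_F_F_eq_zero hmn _))

theorem indecomposable_iff_label (X : TF k) : Indecomposable X ↔ ∃ p, Nonempty (X ≅ label k p) := by
  constructor
  · intro hX
    have hX0 : ¬ IsZero X.obj := fun h => hX.1 ((IsZero.iff_id_eq_zero X).2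
      (ObjectProperty.hom_ext _ (h.eq_of_src _ _)))
    have key : ∀ p, ∀ s : (label k p).obj ⟶ X.obj, IsSplitMono s →
        ∃ p, Nonempty (X ≅ label k p) := fun p s hs => by
      let s' : label k p ⟶ X := ObjectProperty.homMk s
      have : IsSplitMono s' := IsSplitMono.mk' ⟨ObjectProperty.homMk (retraction s),
        ObjectProperty.hom_ext _ (IsSplitMono.id s)⟩
      have := isIso_of_isSplitMono_of_indecomposable hX (isBrick_label k p).not_isZero s'
      exact ⟨p, ⟨(asIso s').symm⟩⟩
    obtain ⟨m, a, s, hs⟩ | ⟨i, a, s, hs⟩ := exists_isSplitMono X.property hX0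
    · exact key ⟨a, .node m⟩ s hs
    -- The labelling twists the forks by the level, so the factor `i` sits at the fork `i - a`.
    · obtain ⟨j, rfl⟩ : ∃ j : ZMod 2, i = j + a := ⟨i - a, (sub_add_cancel _ _).symm⟩
      exact key ⟨a, .fork j⟩ s hs
  · rintro ⟨p, ⟨e⟩⟩
    exact ((isBrick_label k p).of_iso e.symm).indecomposable

end Classification

/-! ### The decomposition of `F_{0a}`, and the sequences in `ℱ` and in `𝒞`. -/

section Sequences

variable {k : Type u} [Field k]

/-- The idempotent of `R_0 = k[x] ⊕ k[x]` of the `i`-th factor. -/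
def unitF (i : ZMod 2) (a : ℤ) : (F k 0 a).obj.M :=
  ofPair (if i = 0 then (1, 0) else (0, 1)) (by rw [pow_zero]; exact one_dvd _)

theorem unitF_mem (i : ZMod 2) (a : ℤ) : unitF i a ∈ (F k 0 a).obj.M.deg (-a) := by
  rw [mem_deg_F, unitF, toPair_ofPair, neg_add_cancel]
  split_ifs
  · exact ⟨monomial_mem_polyDeg 0 1, zero_mem _⟩
  · exact ⟨zero_mem _, monomial_mem_polyDeg 0 1⟩

theorem pr_dehom_unitF (i : ZMod 2) (a : ℤ) :
    (F k 0 a).obj.pr i (dehom _ (unitF i a)) = dehom _ (unitF i a) := by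
  refine locZero_F_ext fun j => ?_
  rw [evF_pr, evF_dehom, unitF, toPair_ofPair, eval_proj_ite]
  split_ifs with h h' h'
  · rfl
  · rfl
  · exact absurd h'.symm h
  · rw [eval_zero]

variable (k) in
/-- The inclusion `F^i_{0a} → F_{0a}`. -/
def splitIncl (i : ZMod 2) (a : ℤ) : (F₀ k i a).obj ⟶ (F k 0 a).obj :=
  homFromF₀ i a (unitF i a) (unitF_mem _ _) (pr_dehom_unitF _ _)

variable (k) in
/-- The projection `F_{0a} → F^i_{0a}`. -/
def splitProj (i : ZMod 2) (a : ℤ) : (F k 0 a).obj ⟶ (F₀ k i a).obj :=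
  homFromF 0 a (ofPoly 1) (ofPoly (if i = 0 then 1 else 0)) ofPoly_one_mem
    (mem_deg_F₀.2 (by
      rw [toPoly_ofPoly, Nat.cast_zero, add_zero, neg_add_cancel]
      split_ifs
      exacts [monomial_mem_polyDeg 0 1, zero_mem _]))
    (locZero_F₀_ext (by
      rw [F₀_pr₀]
      split_ifs
      · simp [evF₀_dehom]
      · simp [evF₀_dehom]))

theorem proj_splitIncl (i j : ZMod 2) (a : ℤ) (z : (F₀ k i a).obj.M) :
    proj k j (toPair (Obj.lin (splitIncl k i a) z)) = if i = j then toPoly z else 0 := by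
  rw [splitIncl, lin_homFromF₀, toPair_smul, unitF, toPair_ofPair, map_mul, eval_proj_ite,
    proj_pair]
  split_ifs
  · rw [mul_one]
  · rw [mul_zero]

theorem toPoly_splitProj (i : ZMod 2) (a : ℤ) (z : (F k 0 a).obj.M) :
    toPoly (Obj.lin (splitProj k i a) z) = proj k i (toPair z) := by
  obtain ⟨⟨p, q⟩, rfl⟩ := (basisF k 0 a).surjective z
  rw [splitProj, lin_homFromF, toPair_basisF]
  change toPoly (p • ofPoly 1 : (F₀ k i a).obj.M) + toPoly (q • ofPoly _ : (F₀ k i a).obj.M) = _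
  rw [toPoly_smul, toPoly_smul, toPoly_ofPoly, toPoly_ofPoly]
  obtain rfl | rfl := zmod_two_cases i
  · simp [proj_zero]
  · simp [proj_one]

theorem splitIncl_splitProj (i : ZMod 2) (a : ℤ) : splitIncl k i a ≫ splitProj k i a = 𝟙 _ :=
  Obj.hom_ext fun z => by
    change toPoly (Obj.lin (splitProj k i a) (Obj.lin (splitIncl k i a) z)) = toPoly z
    rw [toPoly_splitProj, proj_splitIncl, if_pos rfl]

theorem splitIncl_splitProj_of_ne {i j : ZMod 2} (h : i ≠ j) (a : ℤ) :
    splitIncl k i a ≫ splitProj k j a = 0 := hom_F₀_F₀_eq_zero h _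

theorem splitProj_splitIncl (a : ℤ) :
    splitProj k 0 a ≫ splitIncl k 0 a + splitProj k 1 a ≫ splitIncl k 1 a = 𝟙 _ := by
  have h1 : (1 : ZMod 2) ≠ 0 := by decide
  refine Obj.hom_ext fun z => toPair_injective (pair_ext 0 ?_ ?_)
  · rw [Obj.lin_add_apply, toPair_add, map_add, Obj.lin_comp_apply, Obj.lin_comp_apply,
      proj_splitIncl, proj_splitIncl, if_pos rfl, if_neg h1, toPoly_splitProj, add_zero]
    rfl
  · rw [sub_zero, Obj.lin_add_apply, toPair_add, map_add, Obj.lin_comp_apply, Obj.lin_comp_apply,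
      proj_splitIncl, proj_splitIncl, if_pos rfl, if_neg h1.symm, toPoly_splitProj, zero_add]
    rfl

variable (k) in
/-- The decomposition `F_{0a} ≅ F^0_{0a} ⊕ F^1_{0a}`. -/
def splitIso (a : ℤ) : F k 0 a ≅ F₀ k 0 a ⊞ F₀ k 1 a where
  hom := biprod.lift (ObjectProperty.homMk (splitProj k 0 a))
    (ObjectProperty.homMk (splitProj k 1 a))
  inv := biprod.desc (ObjectProperty.homMk (splitIncl k 0 a))
    (ObjectProperty.homMk (splitIncl k 1 a))
  hom_inv_id := by
    rw [biprod.lift_desc]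
    exact ObjectProperty.hom_ext _ (splitProj_splitIncl a)
  inv_hom_id := by
    have h1 : (1 : ZMod 2) ≠ 0 := by decide
    have h (i : ZMod 2) : ((ObjectProperty.homMk (splitIncl k i a) : F₀ k i a ⟶ F k 0 a) ≫
        (ObjectProperty.homMk (splitProj k i a) : F k 0 a ⟶ F₀ k i a)) = 𝟙 _ :=
      ObjectProperty.hom_ext _ (splitIncl_splitProj i a)
    have h' {i j : ZMod 2} (hij : i ≠ j) :
        ((ObjectProperty.homMk (splitIncl k i a) : F₀ k i a ⟶ F k 0 a) ≫
        (ObjectProperty.homMk (splitProj k j a) : F k 0 a ⟶ F₀ k j a)) = 0 :=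
      ObjectProperty.hom_ext _ (splitIncl_splitProj_of_ne hij a)
    refine biprod.hom_ext' _ _ (biprod.hom_ext _ _ ?_ ?_) (biprod.hom_ext _ _ ?_ ?_)
    · simpa using h 0
    · simpa using h' h1.symm
    · simpa using h' h1
    · simpa using h 1

variable (k) in
theorem isAlmostSplit_map_F (m : ℕ) (a : ℤ) :
    IsAlmostSplit ((torsionFree k).ι.map (biprod.lift
        (ObjectProperty.homMk (inclF k m (a - 1)) : F k (m + 1) (a - 1) ⟶ F k m (a - 1))
        (-(ObjectProperty.homMk (mulXF k (m + 1) (a - 1) a (by ring)) :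
          F k (m + 1) (a - 1) ⟶ F k (m + 2) a))))
      ((torsionFree k).ι.map (biprod.desc
        (ObjectProperty.homMk (mulXF k m (a - 1) a (by ring)) : F k m (a - 1) ⟶ F k (m + 1) a)
        (ObjectProperty.homMk (inclF k (m + 1) a) : F k (m + 2) a ⟶ F k (m + 1) a))) := by
  refine isAlmostSplit_F 
    (p₁ := (torsionFree k).ι.map (biprod.fst : F k m (a - 1) ⊞ F k (m + 2) a ⟶ _))
    (p₂ := (torsionFree k).ι.map (biprod.snd : F k m (a - 1) ⊞ F k (m + 2) a ⟶ _))
    (i₁ := (torsionFree k).ι.map (biprod.inl : _ ⟶ F k m (a - 1) ⊞ F k (m + 2) a))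
    (i₂ := (torsionFree k).ι.map (biprod.inr : _ ⟶ F k m (a - 1) ⊞ F k (m + 2) a)) ?_ ?_ ?_ ?_ ?_
  · rw [← Functor.map_comp, ← Functor.map_comp, ← Functor.map_add, biprod.total, CategoryTheory.Functor.map_id]
  · rw [← Functor.map_comp, biprod.lift_fst]; rfl
  · rw [← Functor.map_comp, biprod.lift_snd]; rfl
  · rw [← Functor.map_comp, biprod.inl_desc]; rfl
  · rw [← Functor.map_comp, biprod.inr_desc]; rfl

theorem exists_isAlmostSplit_F (m : ℕ) (a : ℤ) :
    ∃ (α : F k (m + 1) (a - 1) ⟶ F k m (a - 1)) (β : F k (m + 1) (a - 1) ⟶ F k (m + 2) a)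
      (γ : F k m (a - 1) ⟶ F k (m + 1) a) (δ : F k (m + 2) a ⟶ F k (m + 1) a),
      (∀ z, toPair (TF.lin α z) = toPair z) ∧
      (∀ z, toPair (TF.lin β z) = (X, X) * toPair z) ∧
      (∀ z, toPair (TF.lin γ z) = (X, X) * toPair z) ∧
      (∀ z, toPair (TF.lin δ z) = toPair z) ∧
      IsAlmostSplit (biprod.lift α (-β)) (biprod.desc γ δ) ∧
      IsAlmostSplit ((torsionFree k).ι.map (biprod.lift α (-β)))
        ((torsionFree k).ι.map (biprod.desc γ δ)) :=
  ⟨ObjectProperty.homMk (inclF k m (a - 1)),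
    ObjectProperty.homMk (mulXF k (m + 1) (a - 1) a (by ring)),
    ObjectProperty.homMk (mulXF k m (a - 1) a (by ring)), ObjectProperty.homMk (inclF k (m + 1) a),
    toPair_inclF _ _, toPair_mulXF _ _ _ (by ring), toPair_mulXF _ _ _ (by ring), toPair_inclF _ _,
    (isAlmostSplit_map_F k m a).of_map_ι, isAlmostSplit_map_F k m a⟩

theorem exists_isAlmostSplit_F₀ (i : ZMod 2) (a : ℤ) :
    ∃ (κ : F₀ k (1 - i) (a - 1) ⟶ F k 1 a) (π : F k 1 a ⟶ F₀ k i a),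
      (∀ z, proj k i (toPair (TF.lin κ z)) = 0 ∧
        proj k (1 - i) (toPair (TF.lin κ z)) = X * toPoly z) ∧
      (∀ z, toPoly (TF.lin π z) = proj k i (toPair z)) ∧
      IsAlmostSplit κ π ∧
      IsAlmostSplit ((torsionFree k).ι.map κ) ((torsionFree k).ι.map π) :=
  have h : IsAlmostSplit
      ((torsionFree k).ι.map (ObjectProperty.homMk (inFactor k i a) :
        F₀ k (1 - i) (a - 1) ⟶ F k 1 a))
      ((torsionFree k).ι.map (ObjectProperty.homMk (toFactor k i a) : F k 1 a ⟶ F₀ k i a)) :=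
    isAlmostSplit_factor i a
  ⟨ObjectProperty.homMk (inFactor k i a), ObjectProperty.homMk (toFactor k i a),
    fun z => ⟨(proj_inFactor i i a z).trans (if_neg (one_sub_ne i)),
    (proj_inFactor i (1 - i) a z).trans (if_pos rfl)⟩, toPoly_toFactor i a, h.of_map_ι, h⟩

end Sequences

/-! ### The arrows of `ℤD_∞`. -/

section TranslationQuiverArrows

theorem heq_of_dInfty_hom {v v' w w' : DInfty} (α : DInfty.Hom v w) (β : DInfty.Hom v' w')
    (hv : v = v') (hw : w = w') : HEq α β := by
  cases α <;> cases β <;> cases hv <;> cases hw <;> rfl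

/-- Free endpoints make the case analysis possible. Arrows of the two kinds never share endpoints,
as only `next` changes the level. -/
theorem heq_of_zQuiver_hom {p p' q q' : ZQuiver DInfty} (α : ZQuiver.Hom p q)
    (β : ZQuiver.Hom p' q') (hp : p = p') (hq : q = q') : HEq α β := by
  obtain ⟨n, α⟩ | ⟨n, α⟩ := α <;> obtain ⟨n', β⟩ | ⟨n', β⟩ := β <;>
    obtain ⟨h1, h2⟩ := (ZQuiver.mk.injEq _ _ _ _).mp hp <;>
    obtain ⟨h3, h4⟩ := (ZQuiver.mk.injEq _ _ _ _).mp hq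
  · subst h1 h2 h4
    rw [eq_of_heq (heq_of_dInfty_hom α β rfl rfl)]
  · omega
  · omega
  · subst h1 h2 h4
    rw [eq_of_heq (heq_of_dInfty_hom α β rfl rfl)]

instance (p q : ZQuiver DInfty) : Subsingleton (p ⟶ q) :=
  ⟨fun α β => eq_of_heq (heq_of_zQuiver_hom α β rfl rfl)⟩

theorem nonempty_hom_node_zero_iff (n : ℤ) (q : ZQuiver DInfty) :
    Nonempty ((⟨n, .node 0⟩ : ZQuiver DInfty) ⟶ q) ↔
      (∃ j, q = ⟨n, .fork j⟩) ∨ q = ⟨n + 1, .node 1⟩ := by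
  constructor
  · rintro ⟨α⟩
    obtain ⟨_, α⟩ | ⟨_, α⟩ := (α : ZQuiver.Hom _ q)
    · change DInfty.Hom _ _ at α; cases α; exact Or.inl ⟨_, rfl⟩
    · change DInfty.Hom _ _ at α; cases α; exact Or.inr rfl
  · rintro (⟨j, rfl⟩ | rfl)
    · exact ⟨ZQuiver.Hom.level n (DInfty.Hom.fork j)⟩
    · exact ⟨ZQuiver.Hom.next n (DInfty.Hom.step 0)⟩

theorem nonempty_hom_node_succ_iff (n : ℤ) (m : ℕ) (q : ZQuiver DInfty) :
    Nonempty ((⟨n, .node (m + 1)⟩ : ZQuiver DInfty) ⟶ q) ↔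
      q = ⟨n, .node m⟩ ∨ q = ⟨n + 1, .node (m + 2)⟩ := by
  constructor
  · rintro ⟨α⟩
    obtain ⟨_, α⟩ | ⟨_, α⟩ := (α : ZQuiver.Hom _ q)
    · change DInfty.Hom _ _ at α; cases α; exact Or.inl rfl
    · change DInfty.Hom _ _ at α; cases α; exact Or.inr rfl
  · rintro (rfl | rfl)
    · exact ⟨ZQuiver.Hom.level n (DInfty.Hom.step m)⟩
    · exact ⟨ZQuiver.Hom.next n (DInfty.Hom.step (m + 1))⟩

theorem nonempty_hom_fork_iff (n : ℤ) (j : ZMod 2) (q : ZQuiver DInfty) :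
    Nonempty ((⟨n, .fork j⟩ : ZQuiver DInfty) ⟶ q) ↔ q = ⟨n + 1, .node 0⟩ := by
  constructor
  · rintro ⟨α⟩
    obtain ⟨_, α⟩ | ⟨_, α⟩ := (α : ZQuiver.Hom _ q)
    · change DInfty.Hom _ _ at α; cases α
    · change DInfty.Hom _ _ at α; cases α; rfl
  · rintro rfl
    exact ⟨ZQuiver.Hom.next n (DInfty.Hom.fork j)⟩

/-- This keeps the last term of an almost split sequence from being a summand of its middle term, as
the computation of irreducible maps requires. -/
theorem not_nonempty_hom_τ (p : ZQuiver DInfty) : ¬ Nonempty (p.τ ⟶ p) := by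
  obtain ⟨a, j | _ | m⟩ := p
  · simp [ZQuiver.τ, nonempty_hom_fork_iff]
  · simp [ZQuiver.τ, nonempty_hom_node_zero_iff]
  · simp [ZQuiver.τ, nonempty_hom_node_succ_iff]

end TranslationQuiverArrows

/-! ### Middle terms as sums of labels, and the Auslander–Reiten quiver. -/

section LabelSums

variable {k : Type u} [Field k]

theorem mem_rad_label {p q : ZQuiver DInfty} (h : p ≠ q) (f : label k p ⟶ label k q) :
    f ∈ rad k (label k p) (label k q) :=
  (isBrick_label k p).mem_rad_of_not_iso (isBrick_label k q)
    ⟨fun e => h (eq_of_label_iso p q ⟨e⟩)⟩ f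

/-- `E` behaves, with respect to maps to the labels, like the direct sum of the labels of the
vertices in `S`. -/
structure IsLabelSum (E : TF k) (S : Set (ZQuiver DInfty)) : Prop where
  mem_rad : ∀ q ∉ S, ∀ l : E ⟶ label k q, l ∈ rad k E (label k q)
  exists_split : ∀ q ∈ S, ∃ (i : label k q ⟶ E) (p : E ⟶ label k q), i ≫ p = 𝟙 _ ∧
    ∀ l : E ⟶ label k q, i ≫ l = 0 → l ∈ rad k E (label k q)

variable (k) in
theorem isLabelSum_label (p : ZQuiver DInfty) : IsLabelSum (label k p) {p} where
  mem_rad _ hq := mem_rad_label (Ne.symm hq)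
  exists_split := by
    rintro q rfl
    refine ⟨𝟙 _, 𝟙 _, Category.comp_id _, fun l hl => ?_⟩
    rw [Category.id_comp] at hl
    exact hl ▸ zero_mem _

theorem IsLabelSum.of_iso {E E' : TF k} {S : Set (ZQuiver DInfty)} (h : IsLabelSum E S)
    (e : E ≅ E') : IsLabelSum E' S where
  mem_rad q hq l := mem_rad_of_iso e.symm (h.mem_rad q hq _)
  exists_split q hq := by
    obtain ⟨i, p, hip, hl⟩ := h.exists_split q hq
    exact ⟨i ≫ e.hom, e.inv ≫ p, by simp [hip],
      fun l h => mem_rad_of_iso e.symm (hl _ (by rw [← h, Category.assoc]; rfl))⟩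

/-- Disjointness matters: the summand that does not contain the label `q` has only radical maps to
it, so a map is radical once it vanishes on the chosen copy. -/
theorem IsLabelSum.biprod {E E' : TF k} {S S' : Set (ZQuiver DInfty)} (h : IsLabelSum E S)
    (h' : IsLabelSum E' S') (hS : Disjoint S S') : IsLabelSum (E ⊞ E') (S ∪ S') where
  mem_rad q hq l :=
    mem_rad_biprod (h.mem_rad q (fun h => hq (Or.inl h)) _) (h'.mem_rad q (fun h => hq (Or.inr h)) _)
  exists_split q hq := by
    obtain hq | hq := hq
    · obtain ⟨i, p, hip, hl⟩ := h.exists_split q hq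
      exact ⟨i ≫ biprod.inl, biprod.fst ≫ p, by simp [hip], fun l h => mem_rad_biprod
        (hl _ (by rw [← h, Category.assoc])) (h'.mem_rad q (hS.notMem_of_mem_left hq) _)⟩
    · obtain ⟨i, p, hip, hl⟩ := h'.exists_split q hq
      exact ⟨i ≫ biprod.inr, biprod.snd ≫ p, by simp [hip], fun l h' => mem_rad_biprod
        (h.mem_rad q (hS.notMem_of_mem_right hq) _) (hl _ (by rw [← h', Category.assoc]))⟩

variable (k) in
theorem isLabelSum_F₀ (i : ZMod 2) (a : ℤ) : IsLabelSum (F₀ k i a) {⟨a, .fork (i - a)⟩} := by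
  have h := isLabelSum_label k ⟨a, .fork (i - a)⟩
  rwa [show label k ⟨a, .fork (i - a)⟩ = F₀ k i a from
    congrArg (F₀ k · a) (sub_add_cancel i (a : ZMod 2))] at h

variable (k) in
theorem isLabelSum_F (m : ℕ) (a : ℤ) : IsLabelSum (F k (m + 1) a) {⟨a, .node m⟩} :=
  isLabelSum_label k ⟨a, .node m⟩

variable (k) in
theorem isLabelSum_F_zero (a : ℤ) : IsLabelSum (F k 0 a) {q | ∃ j, q = ⟨a, .fork j⟩} := by
  have h := ((isLabelSum_F₀ k 0 a).biprod (isLabelSum_F₀ k 1 a) (by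
    simpa using (one_sub_ne (a : ZMod 2)).symm)).of_iso
    (splitIso k a).symm
  convert h using 1
  ext q
  constructor
  · rintro ⟨j, rfl⟩
    obtain hj | hj := zmod_two_cases (j + a)
    · exact Or.inl (by rw [← hj, add_sub_cancel_right]; rfl)
    · exact Or.inr (by rw [← hj, add_sub_cancel_right]; rfl)
  · rintro (h | h)
    · exact ⟨_, h⟩
    · exact ⟨_, h⟩

variable (k) in
theorem exists_isAlmostSplit_label (p : ZQuiver DInfty) :
    ∃ (E : TF k) (f : label k p.τ ⟶ E) (g : E ⟶ label k p),
      IsAlmostSplit f g ∧ IsLabelSum E {q | Nonempty (p.τ ⟶ q)} := by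
  obtain ⟨a, j | _ | m⟩ := p
  · obtain ⟨κ, π, -, -, h, -⟩ := exists_isAlmostSplit_F₀ (k := k) (j + a) a
    -- The translation of sequences swaps the two factors; modulo `2` this is the shift of the level
    -- by one, so the fork `j` stays fixed.
    have hj : 1 - (j + (a : ZMod 2)) = j + ((a - 1 : ℤ) : ZMod 2) := by
      have h : ∀ b c : ZMod 2, 1 - (b + c) = b + (c - 1) := by decide
      rw [Int.cast_sub, Int.cast_one, h]
    obtain ⟨κ', h'⟩ := h.of_eq (congrArg (F₀ k · (a - 1)) hj)
    refine ⟨_, κ', π, h', ?_⟩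
    convert isLabelSum_F k 0 a using 1
    ext q
    simp [ZQuiver.τ, nonempty_hom_fork_iff]
  -- Here the summand `F_{0,a-1}` of the middle term breaks up into the two forks.
  · obtain ⟨α, β, γ, δ, -, -, -, -, h, -⟩ := exists_isAlmostSplit_F (k := k) 0 a
    refine ⟨_, _, _, h, ?_⟩
    convert (isLabelSum_F_zero k (a - 1)).biprod (isLabelSum_F k 1 a) (by simp) using 1
    ext q
    simp [ZQuiver.τ, nonempty_hom_node_zero_iff, or_comm]
  · obtain ⟨α, β, γ, δ, -, -, -, -, h, -⟩ := exists_isAlmostSplit_F (k := k) (m + 1) a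
    refine ⟨_, _, _, h, ?_⟩
    convert (isLabelSum_F k m (a - 1)).biprod (isLabelSum_F k (m + 2) a) (by simp) using 1
    ext q
    simp [ZQuiver.τ, nonempty_hom_node_succ_iff, or_comm]

variable (k) in
theorem nonempty_basis_irr_label (p q : ZQuiver DInfty) :
    Nonempty (Module.Basis (p ⟶ q) k (Irr k (label k p) (label k q))) := by
  -- Every vertex is a translate, so every label is the first term of an almost split sequence.
  obtain ⟨r, rfl⟩ : ∃ r : ZQuiver DInfty, r.τ = p :=
    ⟨⟨p.n + 1, p.v⟩, by rw [ZQuiver.τ, add_sub_cancel_right]⟩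
  obtain ⟨E, f, g, h, hE⟩ := exists_isAlmostSplit_label k r
  obtain hq | hq := isEmpty_or_nonempty (r.τ ⟶ q)
  · have := h.subsingleton_irr (isBrick_label k _) (hE.mem_rad q (not_nonempty_iff.2 hq))
    exact ⟨Module.Basis.empty _⟩
  · obtain ⟨i, p, hip, hl⟩ := hE.exists_split q hq
    have hqr : q ≠ r := fun hqr => not_nonempty_hom_τ r (hqr ▸ hq)
    have : Unique (r.τ ⟶ q) := @Unique.mk' _ ⟨hq.some⟩ _
    exact h.nonempty_basis_irr (isBrick_label k _) (isBrick_label k q)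
      (fun t => not_isSplitMono_of_mem_rad (isBrick_label k q).id_ne_zero (mem_rad_label hqr t))
      hip hl _

variable (k) in
theorem isARQuiver_label : IsARQuiver k (ZQuiver DInfty) ZQuiver.τ (label k) where
  indecomposable_iff := indecomposable_iff_label
  eq_of_iso := eq_of_label_iso
  irr_basis := nonempty_basis_irr_label k
  almostSplit p := by
    obtain ⟨E, f, g, h, -⟩ := exists_isAlmostSplit_label k p
    exact ⟨E, f, g, h⟩

end LabelSums

end

end ZDInf

theorem proposition5p1 (k : Type u) [Field k] :
    -- the graded indecomposable projective `R_m`-modules, for `m > 0` and for `m = 0`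
    (∀ (m : ℕ) (a : ℤ) (P : ZDInf.GrR k (m + 1)),
      (Projective P ∧ Indecomposable P ∧ P.StartsAt (-a)) ↔
        Nonempty (P ≅ (ZDInf.regular k (m + 1)).shift a)) ∧
    (∀ (a : ℤ) (P : ZDInf.GrR k 0),
      (Projective P ∧ Indecomposable P ∧ P.StartsAt (-a)) ↔
        ∃ i : ZMod 2, Nonempty (P ≅ (ZDInf.factor k i).shift a)) ∧
    -- the indecomposable torsion free objects of `𝒞`
    (∀ X : ZDInf.Obj k, (ZDInf.torsionFree k X ∧ Indecomposable X) ↔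
      ((∃ (m : ℕ) (a : ℤ), Nonempty (X ≅ (ZDInf.F k (m + 1) a).obj)) ∨
        ∃ (i : ZMod 2) (a : ℤ), Nonempty (X ≅ (ZDInf.F₀ k i a).obj))) ∧
    -- the Auslander–Reiten quiver of `ℱ` is `ℤD_∞`, with the labelling `ZDInf.label`
    ZDInf.IsARQuiver k (ZDInf.ZQuiver ZDInf.DInfty) ZDInf.ZQuiver.τ (ZDInf.label k) ∧
    -- `F_{0a} = F^0_{0a} ⊕ F^1_{0a}`
    (∀ a : ℤ, Nonempty (ZDInf.F k 0 a ≅ ZDInf.F₀ k 0 a ⊞ ZDInf.F₀ k 1 a)) ∧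
    -- the almost split sequence ending in `F_{m+1,a}`
    (∀ (m : ℕ) (a : ℤ),
      ∃ (α : ZDInf.F k (m + 1) (a - 1) ⟶ ZDInf.F k m (a - 1))
        (β : ZDInf.F k (m + 1) (a - 1) ⟶ ZDInf.F k (m + 2) a)
        (γ : ZDInf.F k m (a - 1) ⟶ ZDInf.F k (m + 1) a)
        (δ : ZDInf.F k (m + 2) a ⟶ ZDInf.F k (m + 1) a),
        (∀ z, ZDInf.toPair (ZDInf.TF.lin α z) = ZDInf.toPair z) ∧
        (∀ z, ZDInf.toPair (ZDInf.TF.lin β z) = (X, X) * ZDInf.toPair z) ∧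
        (∀ z, ZDInf.toPair (ZDInf.TF.lin γ z) = (X, X) * ZDInf.toPair z) ∧
        (∀ z, ZDInf.toPair (ZDInf.TF.lin δ z) = ZDInf.toPair z) ∧
        ZDInf.IsAlmostSplit (biprod.lift α (-β)) (biprod.desc γ δ) ∧
        ZDInf.IsAlmostSplit ((ZDInf.torsionFree k).ι.map (biprod.lift α (-β)))
          ((ZDInf.torsionFree k).ι.map (biprod.desc γ δ))) ∧
    -- the almost split sequence ending in `F^i_{0a}`
    (∀ (i : ZMod 2) (a : ℤ),
      ∃ (κ : ZDInf.F₀ k (1 - i) (a - 1) ⟶ ZDInf.F k 1 a) (π : ZDInf.F k 1 a ⟶ ZDInf.F₀ k i a),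
        (∀ z, ZDInf.proj k i (ZDInf.toPair (ZDInf.TF.lin κ z)) = 0 ∧
          ZDInf.proj k (1 - i) (ZDInf.toPair (ZDInf.TF.lin κ z)) = X * ZDInf.toPoly z) ∧
        (∀ z, ZDInf.toPoly (ZDInf.TF.lin π z) = ZDInf.proj k i (ZDInf.toPair z)) ∧
        ZDInf.IsAlmostSplit κ π ∧
        ZDInf.IsAlmostSplit ((ZDInf.torsionFree k).ι.map κ)
          ((ZDInf.torsionFree k).ι.map π)) := by
  exact ⟨ZDInf.projective_indecomposable_iff_regular, ZDInf.projective_indecomposable_iff_factor,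
    ZDInf.torsionFree_and_indecomposable_iff, ZDInf.isARQuiver_label k,
    fun a => ⟨ZDInf.splitIso k a⟩, ZDInf.exists_isAlmostSplit_F, ZDInf.exists_isAlmostSplit_F₀⟩
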